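/- Let $L>0$, $\mathcal Q=[-L,L]$, and let $k\ge 2$ be an integer. Let $H^k_{\mathrm{per}}(\mathcal Q)$ be the Sobolev space of $2L$-periodic complex functions with weak derivatives up to order $k$ in $L^2(\mathcal Q)$, and let $H^{-1}_{\mathrm{per}}(\mathcal Q)$ be the dual of $H^1_{\mathrm{per}}(\mathcal Q)$, in which $L^2(\mathcal Q)$ is embedded by $f\mapsto (w\mapsto\int_{\mathcal Q} f w\,dx)$. For $\gamma,\delta\in\mathbb R$ and $u_0\in H^k_{\mathrm{per}}(\mathcal Q)$ consider the problem $$ i u_t+\tfrac12 u_{xx}+|u|^2u=i\gamma u+i\delta|u|^2u,\qquad u(x+2L,t)=u(x,t),\qquad u(x,0)=u_0(x). $$ A solution on $[0,T)$, $0<T\le\infty$, is a function $u\in C([0,T),H^k_{\mathrm{per}}(\mathcal Q))$ with $u_t\in C([0,T),H^{k-2}_{\mathrm{per}}(\mathcal Q))$ that satisfies the equation for every $t\in[0,T)$ and a.e. $x$; for a solution that cannot be continued to a longer interval, $[0,T_{\max})$ denotes its (maximal) interval of existence. Put $$ M(t)=\frac{e^{-2\gamma t}}{2L}\int_{-L}^{L}|u(x,t)|^2dx,\qquad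 \hat T_{\max}[\gamma,\delta,m]=\frac1{2\gamma}\log\Big[1+\frac{\gamma}{\delta m}\Big]\ (\gamma\ne0),\qquad \tilde T_{\max}[\delta,m]=\frac1{2\delta m}. $$ 1. (Collapse in finite time.) Let $\delta>0$, let $u$ be the maximal solution with initial value $u_0\in H^k_{\mathrm{per}}(\mathcal Q)$, and let $M(0)>0$. Put $\gamma^*=-\delta M(0)$. If $\gamma\neq0$ and $\gamma>\gamma^*$, then $T_{\max}$ is finite and $T_{\max}\le\hat T_{\max}[\gamma,\delta,M(0)]$. If $\gamma=0$, then $T_{\max}$ is finite and $T_{\max}\le\tilde T_{\max}[\delta,M(0)]$. 2. (Global existence and limit set.) Let $\gamma>0$ and $\delta<0$. For every $u_0\in H^k_{\mathrm{per}}(\mathcal Q)$ a maximal solution exists, every maximal solution with initial value $u_0$ has $T_{\max}=\infty$, and its values are determined by $u_0$. It satisfies $u\in C([0,\infty),L^2(\mathcal Q))$ and $u_t\in C([0,\infty),H^{-1}_{\mathrm{per}}(\mathcal Q))$. Hence maps $\varphi(t,\cdot):H^k_{\mathrm{per}}(\mathcal Q)\to L^2(\mathcal Q)$, $\varphi(t,u_0)=u(t)$,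 are defined for $t\ge0$. They form a dynamical system: $\varphi(0,u_0)=u_0$; if $\varphi(s,u_0)=v_0\in H^k_{\mathrm{per}}(\mathcal Q)$ then $\varphi(s+t,u_0)=\varphi(t,v_0)$ for $s,t\ge0$; and each $\varphi(t,\cdot)$ is continuous. Every orbit $\{\varphi(t,u_0):t\ge0\}$ is bounded in $L^2(\mathcal Q)$. For every bounded set $\mathcal B\subset H^k_{\mathrm{per}}(\mathcal Q)$, the $\omega$-limit set $$\omega(\mathcal B)=\bigcap_{s\ge0}\overline{\bigcup_{t\ge s}\varphi(t,\mathcal B)},$$ with closures in the weak topology of $L^2(\mathcal Q)$, is weakly compact in $L^2(\mathcal Q)$ and compact in $H^{-1}_{\mathrm{per}}(\mathcal Q)$, and it is nonempty if $\mathcal B$ is nonempty. 3. (Full decay.) Let $\gamma,\delta<0$. Then, for every $u_0\in H^k_{\mathrm{per}}(\mathcal Q)$, the maximal solution has $T_{\max}=\infty$ and $\lim_{t\to\infty}\|u(\cdot,t)\|_{L^2(\mathcal Q)}=0$. 4. (Behaviour of the bound.) Let $\delta>0$, $m>0$ and $\gamma^*=-\delta m$. Then $\hat T_{\max}[\gamma,\delta,m]\to+\infty$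 as $\gamma\downarrow\gamma^*$, and $\hat T_{\max}[\gamma,\delta,m]\to\tilde T_{\max}[\delta,m]$ as $\gamma\to0$, $\gamma\ne0$. -/

import Mathlib

open MeasureTheory Filter Set Topology
open scoped ContDiff

noncomputable section

/-- Lebesgue measure on the fundamental interval `Q = [-L, L]`. -/
abbrev volQ (L : ℝ) : Measure ℝ := volume.restrict (Icc (-L) L)

/-- The complex Hilbert space `L²(Q)`, `Q = [-L, L]`. -/
abbrev L2Q (L : ℝ) : Type := Lp ℂ 2 (volQ L)

/-- Smooth complex test functions on the line with period `2L`. -/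
def IsPeriodicTest (L : ℝ) (φ : ℝ → ℂ) : Prop :=
  ContDiff ℝ ∞ φ ∧ Function.Periodic φ (2 * L)

/-- `v` is the weak derivative of `u` in the `2L`-periodic sense. Testing against all smooth
`2L`-periodic functions (not only those vanishing near `±L`) expresses both that `v` is the weak
derivative of `u` on `Q` and that `u(-L) = u(L)`. -/
def IsWeakDeriv (L : ℝ) (u v : L2Q L) : Prop :=
  ∀ φ : ℝ → ℂ, IsPeriodicTest L φ →
    ∫ x, u x * deriv φ x ∂(volQ L) = -∫ x, v x * φ x ∂(volQ L)

theorem L2Q.integrable_mul {L : ℝ} (u : L2Q L) {φ : ℝ → ℂ} (hφ : Continuous φ) :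
    Integrable (fun x => u x * φ x) (volQ L) := by
  have hu : Integrable (fun x => u x) (volQ L) := (Lp.memLp u).integrable (by norm_num)
  obtain ⟨C, hC⟩ := isCompact_Icc.exists_bound_of_continuousOn (s := Icc (-L) L) hφ.continuousOn
  refine hu.mul_bdd (c := C) hφ.aestronglyMeasurable ?_
  filter_upwards [ae_restrict_mem measurableSet_Icc] with x hx using hC x hx

theorem IsPeriodicTest.continuous_deriv {L : ℝ} {φ : ℝ → ℂ} (h : IsPeriodicTest L φ) :
    Continuous (deriv φ) := h.1.continuous_deriv (by simp)

theorem L2Q.integral_add_mul {L : ℝ} (u v : L2Q L) {φ : ℝ → ℂ} (hφ : Continuous φ) :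
    ∫ x, (u + v : L2Q L) x * φ x ∂(volQ L)
      = ∫ x, u x * φ x ∂(volQ L) + ∫ x, v x * φ x ∂(volQ L) := by
  rw [← integral_add (L2Q.integrable_mul u hφ) (L2Q.integrable_mul v hφ)]
  refine integral_congr_ae ?_
  filter_upwards [Lp.coeFn_add u v] with x hx
  rw [hx, Pi.add_apply, add_mul]

theorem L2Q.integral_smul_mul {L : ℝ} (c : ℂ) (u : L2Q L) (φ : ℝ → ℂ) :
    ∫ x, (c • u : L2Q L) x * φ x ∂(volQ L) = c * ∫ x, u x * φ x ∂(volQ L) := by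
  rw [← integral_const_mul]
  refine integral_congr_ae ?_
  filter_upwards [Lp.coeFn_smul c u] with x hx
  rw [hx, Pi.smul_apply, smul_eq_mul, mul_assoc]

theorem L2Q.integral_zero_mul {L : ℝ} (φ : ℝ → ℂ) :
    ∫ x, (0 : L2Q L) x * φ x ∂(volQ L) = 0 := by
  simpa using L2Q.integral_smul_mul (0 : ℂ) (0 : L2Q L) φ

/-- The periodic Sobolev space `H^k_per(Q)` as a subspace of `L²(Q)^{k+1}`: an element is stored as the tuple
`(u, ∂ₓu, …, ∂ₓᵏu)` of functions in `L²(Q)`, each of which is the periodic weak derivative of the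
preceding one. (The tuple is determined by `u`.) The norm inherited from the `ℓ²`-product is the
usual one, `‖u‖² = ∑_{j ≤ k} ‖∂ₓʲu‖²_{L²(Q)}`. -/
def HperSub (L : ℝ) (k : ℕ) : Submodule ℂ (PiLp 2 (fun _ : Fin (k + 1) => L2Q L)) where
  carrier := {w | ∀ j : Fin k, IsWeakDeriv L (w j.castSucc) (w j.succ)}
  zero_mem' := by
    intro j φ _
    simp only [PiLp.zero_apply, L2Q.integral_zero_mul, neg_zero]
  add_mem' := by
    intro a b ha hb j φ hφ
    simp only [PiLp.add_apply]
    rw [L2Q.integral_add_mul _ _ hφ.continuous_deriv, L2Q.integral_add_mul _ _ hφ.1.continuous,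
      ha j φ hφ, hb j φ hφ]
    ring
  smul_mem' := by
    intro c a ha j φ hφ
    simp only [PiLp.smul_apply]
    rw [L2Q.integral_smul_mul, L2Q.integral_smul_mul, ha j φ hφ]
    ring

/-- The periodic Sobolev space `H^k_per(Q)`, with the Hilbert space structure of `HperSub L k`. -/
def Hper (L : ℝ) (k : ℕ) : Type := ↥(HperSub L k)

namespace Hper

variable {L : ℝ} {k m : ℕ}

instance instNormedAddCommGroup : NormedAddCommGroup (Hper L k) :=
  inferInstanceAs (NormedAddCommGroup ↥(HperSub L k))

instance instInnerProductSpace : InnerProductSpace ℂ (Hper L k) :=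
  inferInstanceAs (InnerProductSpace ℂ ↥(HperSub L k))

/-- The `j`-th weak derivative `∂ₓʲu ∈ L²(Q)` of `u ∈ H^k_per(Q)`, for `j ≤ k`. -/
def dx (u : Hper L k) (j : ℕ) (hj : j ≤ k) : L2Q L := u.1 ⟨j, Nat.lt_succ_of_le hj⟩

/-- The embedding `H^k_per(Q) → L²(Q)`, as a bounded operator. -/
def toL2 : Hper L k →L[ℂ] L2Q L :=
  ((PiLp.proj 2 (fun _ : Fin (k + 1) => L2Q L) 0).comp (HperSub L k).subtypeL :
    ↥(HperSub L k) →L[ℂ] L2Q L)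

/-- The embedding `H^k_per(Q) → H^m_per(Q)` for `m ≤ k`. -/
def incl (h : m ≤ k) (u : Hper L k) : Hper L m :=
  ⟨WithLp.toLp 2 fun j => u.1 (Fin.castLE (Nat.succ_le_succ h) j), fun j => u.2 (Fin.castLE h j)⟩

end Hper

/-- The negative order space `H^{-s}_per(Q)`: bounded linear functionals on `H^s_per(Q)`, with the
operator norm. -/
abbrev HperDual (L : ℝ) (s : ℕ) : Type := StrongDual ℂ (Hper L s)

/-- The embedding `L²(Q) → H^{-s}_per(Q)`, `f ↦ (w ↦ ∫_Q f w dx)`. -/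
def L2Q.toDual {L : ℝ} (s : ℕ) (f : L2Q L) : HperDual L s :=
  ((ContinuousLinearMap.mul ℂ ℂ).lpPairing (volQ L) 2 2 f).comp Hper.toL2

theorem L2Q.toDual_apply {L : ℝ} (s : ℕ) (f : L2Q L) (w : Hper L s) :
    L2Q.toDual s f w = ∫ x, f x * (Hper.toL2 w) x ∂(volQ L) := by
  simp [L2Q.toDual, ContinuousLinearMap.lpPairing_eq_integral]

/-- The time interval `[0, T)`, with `T = +∞` allowed. -/
def timeInterval (T : EReal) : Set ℝ := {t | 0 ≤ t ∧ (t : EReal) < T}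

/-- `u` solves, on `[0, T)`, the `2L`-periodic initial value problem
`i u_t + ½ u_xx + |u|²u = iγu + iδ|u|²u`, `u(0) = u₀`, with
`u ∈ C([0,T), H^k_per)` and `u_t ∈ C([0,T), H^{k-2}_per)`, where `k ≥ 2`. The derivative in time is
that of a function with values in `H^{k-2}_per` (one-sided at `0`), and the equation holds at each
time for almost every `x ∈ Q`. Values of `u` outside `[0, T)` are irrelevant. -/
structure IsSolution (L γ δ : ℝ) {k : ℕ} (hk : 2 ≤ k) (u₀ : Hper L k) (T : EReal)
    (u : ℝ → Hper L k) : Prop where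
  pos : 0 < T
  init : u 0 = u₀
  cont : ContinuousOn u (timeInterval T)
  eqn : ∃ ut : ℝ → Hper L (k - 2), ContinuousOn ut (timeInterval T) ∧
    ∀ t ∈ timeInterval T,
      HasDerivWithinAt (fun s => Hper.incl (Nat.sub_le k 2) (u s)) (ut t) (timeInterval T) t ∧
      ∀ᵐ x ∂(volQ L),
        Complex.I * (Hper.toL2 (ut t)) x + (1 / 2 : ℂ) * (Hper.dx (u t) 2 hk) x
            + (‖(Hper.toL2 (u t)) x‖ : ℂ) ^ 2 * (Hper.toL2 (u t)) x
          = Complex.I * (γ : ℂ) * (Hper.toL2 (u t)) x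
            + Complex.I * (δ : ℂ) * (‖(Hper.toL2 (u t)) x‖ : ℂ) ^ 2 * (Hper.toL2 (u t)) x

/-- `u` is a solution on `[0, Tmax)` that cannot be continued as a solution to a longer interval:
`[0, Tmax)` is its maximal interval of existence. -/
def IsMaximalSolution (L γ δ : ℝ) {k : ℕ} (hk : 2 ≤ k) (u₀ : Hper L k) (Tmax : EReal)
    (u : ℝ → Hper L k) : Prop :=
  IsSolution L γ δ hk u₀ Tmax u ∧
    ∀ (T : EReal) (v : ℝ → Hper L k), IsSolution L γ δ hk u₀ T v →
      EqOn u v (timeInterval Tmax) → T ≤ Tmax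

/-- The functional `M(t) = e^{-2γt} / (2L) · ∫_{-L}^{L} |u(x,t)|² dx`. -/
def massM (L γ : ℝ) {k : ℕ} (u : ℝ → Hper L k) (t : ℝ) : ℝ :=
  Real.exp (-2 * γ * t) / (2 * L) * ∫ x, ‖(Hper.toL2 (u t)) x‖ ^ 2 ∂(volQ L)

/-- The collapse time bound `(1/2γ) log(1 + γ/(δ M₀))` for `γ ≠ 0`. -/
def That (γ δ M₀ : ℝ) : ℝ := 1 / (2 * γ) * Real.log (1 + γ / (δ * M₀))

/-- The collapse time bound `1/(2δM₀)` for `γ = 0`. -/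
def Ttilde (δ M₀ : ℝ) : ℝ := 1 / (2 * δ * M₀)

/-- The `ω`-limit set `⋂_{s} closure (⋃_{t ≥ s} φ(t, B))` of `B ⊆ H^k_per(Q)` under
`φ(t, ·) : H^k_per(Q) → L²(Q)`, the closures being taken in the weak topology of `L²(Q)`. -/
def weakOmegaLimit {L : ℝ} {k : ℕ} (φ : ℝ → Hper L k → L2Q L) (B : Set (Hper L k)) :
    Set (WeakSpace ℂ (L2Q L)) :=
  omegaLimit atTop (fun t u₀ => toWeakSpace ℂ (L2Q L) (φ t u₀)) B

end

/-!
The equation is treated through Fourier coefficients. In them, `H^k_per(Q)` is a weighted `ℓ²`, its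
elements with `k ≥ 1` have absolutely summable coefficients (`Hper.wiener`), products are
convolutions, and Young's inequality makes `H^k_per(Q)` an algebra, with the tame estimate
`Hper.norm_cub_le` : `‖|u|²u‖_{H^k} ≤ C (∑ |û_n|)² ‖u‖_{H^k}`. The free Schrödinger group acts
by the unimodular factors `Hper.phase`, and `v(t) = e^{-it∂ₓ²/2}u(t)` solves an ordinary
differential equation in `H^k_per(Q)` with a locally Lipschitz right-hand side.

Two balance laws carry the theorem. The mass law
`(‖u‖²)' = 2γ‖u‖² + 2δ∫|u|⁴` (`Hper.StrongSol.hasDerivWithinAt_norm_sq`), with the Cauchy–Schwarz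
bound `‖u‖⁴ ≤ 2L∫|u|⁴` (`Hper.norm_pow_four_le_quart`), is a Riccati inequality. For `δ > 0` it
bounds the lifetime (`Hper.StrongSol.mul_norm_sq_lt_one`); for `δ < 0` it bounds the orbits in
`L²(Q)`, uniformly over bounded sets of initial values (`Hper.StrongSol.norm_toL2_sq_le_add`), and
for `γ, δ < 0` it gives exponential decay.
The energy law (`Hper.StrongSol.hasDerivWithinAt_energy`) for `‖∂ₓu‖² - ∫|u|⁴` has a dissipative
second-order term for `δ ≤ 0`. With the interpolation of `∑ |û_n|` between `L²` and `H¹` it bounds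
`∑ |û_n|` on bounded time intervals (`Hper.StrongSol.exists_wiener_bound`); by the tame estimate the
`H^k`-norm grows at most exponentially there, so that solutions are global, and the difference
estimate `Hper.StrongSol.norm_toL2_sub_le` gives uniqueness and the continuity of the flow in
`L²(Q)`.

The orbits of a bounded set lie in a ball of `L²(Q)`. The ball is weakly compact by reflexivity, and
on it the embedding `L²(Q) → H^{-1}_per(Q)` is a uniform limit of its Fourier truncations, hence
continuous from the weak to the norm topology (`L2Q.continuousOn_toDual_toWeakSpace`); the
assertions on limit sets follow.
-/

noncomputable section

open scoped InnerProductSpace ComplexConjugate ENNReal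

/-! ### Fourier series in `L²(Q)` -/

namespace L2Q

variable {L : ℝ}

/-- The frequency `πn/L` of the `n`-th exponential of period `2L`. -/
def freq (L : ℝ) (n : ℤ) : ℝ := Real.pi * n / L

/-- The exponential `x ↦ e^{iπnx/L}` of period `2L`. -/
def expo (L : ℝ) (n : ℤ) (x : ℝ) : ℂ := Complex.exp (Complex.I * freq L n * x)

theorem freq_neg (n : ℤ) : freq L (-n) = -freq L n := by simp [freq, neg_div]

theorem freq_add (m n : ℤ) : freq L (m + n) = freq L m + freq L n := by
  simp only [freq]; push_cast; ring

theorem freq_sub (m n : ℤ) : freq L (m - n) = freq L m - freq L n := by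
  simp only [freq]; push_cast; ring

theorem norm_expo (n : ℤ) (x : ℝ) : ‖expo L n x‖ = 1 := by
  rw [expo, mul_assoc, ← Complex.ofReal_mul, mul_comm, Complex.norm_exp_ofReal_mul_I]

theorem expo_add (m n : ℤ) (x : ℝ) : expo L (m + n) x = expo L m x * expo L n x := by
  rw [expo, expo, expo, ← Complex.exp_add, freq_add]
  push_cast
  ring_nf

theorem conj_expo (n : ℤ) (x : ℝ) : conj (expo L n x) = expo L (-n) x := by
  rw [expo, expo, ← Complex.exp_conj, freq_neg]
  simp

theorem expo_zero (x : ℝ) : expo L 0 x = 1 := by simp [expo, freq]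

theorem hasDerivAt_expo (n : ℤ) (x : ℝ) :
    HasDerivAt (expo L n) (Complex.I * freq L n * expo L n x) x := by
  have h : HasDerivAt (fun y : ℝ => Complex.I * freq L n * (y : ℂ)) (Complex.I * freq L n) x := by
    simpa using (Complex.ofRealCLM.hasDerivAt (x := x)).const_mul (Complex.I * (freq L n : ℂ))
  have h' := h.cexp
  rwa [mul_comm (Complex.exp _)] at h'

theorem contDiff_expo (n : ℤ) : ContDiff ℝ ∞ (expo L n) := by
  unfold expo
  exact ((contDiff_const.mul Complex.ofRealCLM.contDiff)).cexp

theorem continuous_expo (n : ℤ) : Continuous (expo L n) := (contDiff_expo n).continuous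

theorem expo_periodic (hL : L ≠ 0) (n : ℤ) : Function.Periodic (expo L n) (2 * L) := by
  intro x
  have hL' : (L : ℂ) ≠ 0 := by exact_mod_cast hL
  rw [expo, expo, Complex.exp_eq_exp_iff_exists_int]
  refine ⟨n, ?_⟩
  simp only [freq]
  push_cast
  field_simp

theorem isPeriodicTest_expo (hL : L ≠ 0) (n : ℤ) : IsPeriodicTest L (expo L n) :=
  ⟨contDiff_expo n, expo_periodic hL n⟩

theorem memLp_of_continuous {φ : ℝ → ℂ} (hφ : Continuous φ) : MemLp φ 2 (volQ L) := by
  obtain ⟨C, hC⟩ := isCompact_Icc.exists_bound_of_continuousOn (s := Icc (-L) L) hφ.continuousOn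
  refine MemLp.of_bound hφ.aestronglyMeasurable C ?_
  filter_upwards [ae_restrict_mem measurableSet_Icc] with x hx using hC x hx

theorem integral_volQ (hL : 0 < L) (f : ℝ → ℂ) : ∫ x, f x ∂(volQ L) = ∫ x in (-L)..L, f x := by
  rw [intervalIntegral.integral_of_le (by linarith), ← integral_Icc_eq_integral_Ioc]

theorem integral_expo (hL : 0 < L) (n : ℤ) :
    ∫ x, expo L n x ∂(volQ L) = if n = 0 then (2 * L : ℂ) else 0 := by
  rw [integral_volQ hL]
  split_ifs with hn
  · subst hn
    simp only [expo_zero, intervalIntegral.integral_const]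
    simp
    ring
  · have hc : Complex.I * (freq L n : ℂ) ≠ 0 := by
      simp [freq, hn, hL.ne', Real.pi_ne_zero]
    simp only [expo]
    rw [integral_exp_mul_complex hc]
    have h := expo_periodic hL.ne' n (-L)
    rw [show -L + 2 * L = L by ring] at h
    simp only [expo] at h
    rw [h, sub_self, zero_div]

/-- The `n`-th normalised exponential, as an element of `L²(Q)`. -/
def expoLp (L : ℝ) (n : ℤ) : L2Q L :=
  (((√(2 * L))⁻¹ : ℝ) : ℂ) • (memLp_of_continuous (continuous_expo n)).toLp (expo L n)

theorem coeFn_expoLp (n : ℤ) :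
    expoLp L n =ᵐ[volQ L] fun x => (((√(2 * L))⁻¹ : ℝ) : ℂ) * expo L n x := by
  filter_upwards [Lp.coeFn_smul (((√(2 * L))⁻¹ : ℝ) : ℂ)
    ((memLp_of_continuous (continuous_expo n)).toLp (expo L n)),
    (memLp_of_continuous (L := L) (continuous_expo n)).coeFn_toLp] with x h1 h2
  rw [expoLp, h1, Pi.smul_apply, h2, smul_eq_mul]

theorem inner_expoLp_left (n : ℤ) (f : L2Q L) :
    ⟪expoLp L n, f⟫_ℂ = (((√(2 * L))⁻¹ : ℝ) : ℂ) * ∫ x, f x * expo L (-n) x ∂(volQ L) := by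
  rw [L2.inner_def, ← integral_const_mul]
  refine integral_congr_ae ?_
  filter_upwards [coeFn_expoLp (L := L) n] with x hx
  rw [RCLike.inner_apply, hx, map_mul, conj_expo, Complex.conj_ofReal]
  ring

theorem orthonormal_expoLp (hL : 0 < L) : Orthonormal ℂ (expoLp L) := by
  rw [orthonormal_iff_ite]
  intro m n
  rw [inner_expoLp_left]
  have h : ∫ x, expoLp L n x * expo L (-m) x ∂(volQ L)
      = (((√(2 * L))⁻¹ : ℝ) : ℂ) * ∫ x, expo L (n - m) x ∂(volQ L) := by
    rw [← integral_const_mul]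
    refine integral_congr_ae ?_
    filter_upwards [coeFn_expoLp (L := L) n] with x hx
    rw [hx, mul_assoc, ← expo_add, sub_eq_add_neg]
  rw [h, integral_expo hL]
  by_cases hmn : m = n
  · subst hmn
    have h2 : √(2 * L) * √(2 * L) = 2 * L := Real.mul_self_sqrt (by positivity)
    have h3 : √(2 * L) ≠ 0 := by positivity
    simp only [sub_self, if_true]
    rw [show (2 * L : ℂ) = ((√(2 * L) * √(2 * L) : ℝ) : ℂ) by rw [h2]; push_cast; rfl]
    norm_cast
    field_simp
  · rw [if_neg (by omega), if_neg hmn, mul_zero, mul_zero]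

theorem eq_zero_of_inner_expoLp (hL : 0 < L) (f : L2Q L) (hf : ∀ n, ⟪expoLp L n, f⟫_ℂ = 0) :
    f = 0 := by
  have hab : -L < L := by linarith
  have hmem : MemLp f 2 (volume.restrict (Ioc (-L) L)) :=
    (Lp.memLp f).mono_measure (Measure.restrict_mono Ioc_subset_Icc_self le_rfl)
  have hsum := hasSum_sq_fourierCoeffOn hab hmem
  have hpos : (√(2 * L))⁻¹ ≠ 0 := by positivity
  have hz : ∀ n, fourierCoeffOn hab f n = 0 := by
    intro n
    have h := hf n
    rw [inner_expoLp_left, mul_eq_zero] at h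
    have h' := h.resolve_left (by exact_mod_cast hpos)
    rw [integral_volQ hL] at h'
    rw [fourierCoeffOn_eq_integral]
    convert smul_zero _
    rw [← h']
    congr 1 with x
    rw [fourier_coe_apply, smul_eq_mul, mul_comm, expo]
    congr 2
    have hL' : (L : ℂ) ≠ 0 := by exact_mod_cast hL.ne'
    simp only [freq]
    push_cast
    field_simp
    ring
  simp only [hz, norm_zero, ne_eq, OfNat.ofNat_ne_zero, not_false_eq_true, zero_pow] at hsum
  have h0 := hsum.unique hasSum_zero
  rw [smul_eq_mul, mul_eq_zero, or_iff_right (inv_ne_zero (by linarith)),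
    intervalIntegral.integral_of_le hab.le, ← integral_Icc_eq_integral_Ioc] at h0
  rw [integral_eq_zero_iff_of_nonneg (fun x => by positivity)
    ((memLp_two_iff_integrable_sq_norm (Lp.memLp f).1).1 (Lp.memLp f))] at h0
  rw [Lp.eq_zero_iff_ae_eq_zero]
  filter_upwards [h0] with x hx
  simpa using hx

variable [hL : Fact (0 < L)]

/-- The normalised exponentials as a Hilbert basis of `L²(Q)`. -/
def expoBasis (L : ℝ) [hL : Fact (0 < L)] : HilbertBasis ℤ ℂ (L2Q L) :=
  HilbertBasis.mkOfOrthogonalEqBot (orthonormal_expoLp hL.out) (by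
    rw [Submodule.eq_bot_iff]
    intro f hf
    refine eq_zero_of_inner_expoLp hL.out f fun n => ?_
    exact hf _ (Submodule.subset_span ⟨n, rfl⟩))

theorem expoBasis_apply (n : ℤ) : expoBasis L n = expoLp L n := by
  rw [expoBasis, HilbertBasis.coe_mkOfOrthogonalEqBot]

/-- The `n`-th Fourier coefficient with respect to the normalised exponentials. -/
def coef (f : L2Q L) (n : ℤ) : ℂ := (expoBasis L).repr f n

theorem coef_eq_inner (f : L2Q L) (n : ℤ) : coef f n = ⟪expoLp L n, f⟫_ℂ := by
  rw [coef, HilbertBasis.repr_apply_apply, expoBasis_apply]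

theorem coef_eq (f : L2Q L) (n : ℤ) :
    coef f n = (((√(2 * L))⁻¹ : ℝ) : ℂ) * ∫ x, f x * expo L (-n) x ∂(volQ L) := by
  rw [coef_eq_inner, inner_expoLp_left]

theorem coef_add (f g : L2Q L) (n : ℤ) : coef (f + g) n = coef f n + coef g n := by
  simp [coef]

theorem coef_sub (f g : L2Q L) (n : ℤ) : coef (f - g) n = coef f n - coef g n := by
  simp [coef]

theorem coef_smul (c : ℂ) (f : L2Q L) (n : ℤ) : coef (c • f) n = c * coef f n := by
  simp [coef]

theorem coef_ext {f g : L2Q L} (h : ∀ n, coef f n = coef g n) : f = g :=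
  (expoBasis L).repr.injective (by ext n; exact h n)

theorem hasSum_inner (f g : L2Q L) :
    HasSum (fun n => conj (coef f n) * coef g n) ⟪f, g⟫_ℂ := by
  have h := (expoBasis L).hasSum_inner_mul_inner f g
  convert! h using 2 with n
  rw [coef_eq_inner, coef_eq_inner, expoBasis_apply, inner_conj_symm]

theorem hasSum_norm_sq (f : L2Q L) : HasSum (fun n => ‖coef f n‖ ^ 2) (‖f‖ ^ 2) := by
  have h := Complex.hasSum_re (hasSum_inner f f)
  convert h using 1
  · ext n
    rw [← Complex.normSq_eq_conj_mul_self, Complex.ofReal_re, Complex.normSq_eq_norm_sq]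
  · rw [inner_self_eq_norm_sq_to_K]
    norm_cast

/-- The element of `L²(Q)` with prescribed square summable Fourier coefficients. -/
def ofCoef (a : ℤ → ℂ) (ha : Summable fun n => ‖a n‖ ^ 2) : L2Q L :=
  (expoBasis L).repr.symm ⟨a, by
    refine memℓp_gen ?_
    simpa using ha⟩

theorem coef_ofCoef (a : ℤ → ℂ) (ha : Summable fun n => ‖a n‖ ^ 2) (n : ℤ) :
    coef (L := L) (ofCoef a ha) n = a n := by
  simp [coef, ofCoef]

theorem hasSum_integral_mul_mul_expo (f g : L2Q L) (n : ℤ) :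
    HasSum (fun m => coef f (n - m) * coef g m) (∫ x, f x * g x * expo L (-n) x ∂(volQ L)) := by
  have hF : MemLp (fun x => conj (f x * expo L (-n) x)) 2 (volQ L) := by
    have h1 : MemLp (fun x => f x * expo L (-n) x) 2 (volQ L) := by
      refine (Lp.memLp f).mono ((Lp.memLp f).1.mul (continuous_expo _).aestronglyMeasurable) ?_
      filter_upwards with x
      rw [norm_mul, norm_expo, mul_one]
    exact h1.star
  have h := (expoBasis L).hasSum_inner_mul_inner (hF.toLp _) g
  convert! h using 1
  · ext m
    rw [expoBasis_apply, ← coef_eq_inner, L2.inner_def, coef_eq, ← integral_const_mul]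
    congr 1
    refine integral_congr_ae ?_
    filter_upwards [hF.coeFn_toLp, coeFn_expoLp (L := L) m] with x h1 h2
    rw [RCLike.inner_apply, h1, h2, Complex.conj_conj, show -(n - m) = m + -n by ring, expo_add]
    ring
  · rw [L2.inner_def]
    refine integral_congr_ae ?_
    filter_upwards [hF.coeFn_toLp] with x h1
    rw [RCLike.inner_apply, h1, Complex.conj_conj]
    ring

/-- The Fourier coefficients of a product are the convolution of the Fourier coefficients. -/
theorem hasSum_coef_of_ae_eq_mul {f g p : L2Q L} (h : p =ᵐ[volQ L] fun x => f x * g x) (n : ℤ) :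
    HasSum (fun m => (((√(2 * L))⁻¹ : ℝ) : ℂ) * (coef f (n - m) * coef g m)) (coef p n) := by
  rw [coef_eq]
  convert! (hasSum_integral_mul_mul_expo f g n).mul_left (((√(2 * L))⁻¹ : ℝ) : ℂ) using 2
  refine integral_congr_ae ?_
  filter_upwards [h] with x hx
  rw [hx]

theorem hasSum_integral_mul (f g : L2Q L) :
    HasSum (fun m => coef f (-m) * coef g m) (∫ x, f x * g x ∂(volQ L)) := by
  simpa [expo_zero] using hasSum_integral_mul_mul_expo f g 0

theorem coef_deriv {φ : ℝ → ℂ} (hφ : IsPeriodicTest L φ) (n : ℤ) :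
    coef ((memLp_of_continuous hφ.continuous_deriv).toLp (deriv φ) : L2Q L) n
      = Complex.I * freq L n * coef ((memLp_of_continuous hφ.1.continuous).toLp φ : L2Q L) n := by
  have key : ∫ x in (-L)..L, expo L (-n) x * deriv φ x =
      expo L (-n) L * φ L - expo L (-n) (-L) * φ (-L)
        - ∫ x in (-L)..L, (Complex.I * freq L (-n) * expo L (-n) x) * φ x := by
    refine intervalIntegral.integral_mul_deriv_eq_deriv_mul (fun x _ => hasDerivAt_expo _ x)
      (fun x _ => (hφ.1.differentiable (by simp) x).hasDerivAt) ?_ ?_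
    · exact (continuous_const.mul (continuous_expo _)).intervalIntegrable _ _
    · exact hφ.continuous_deriv.intervalIntegrable _ _
  have h1 := expo_periodic hL.out.ne' (-n) (-L)
  have h2 := hφ.2 (-L)
  rw [show -L + 2 * L = L by ring] at h1 h2
  rw [h1, h2, sub_self, zero_sub] at key
  rw [coef_eq, coef_eq, mul_left_comm]
  congr 1
  have e1 : ∫ x, ((memLp_of_continuous hφ.continuous_deriv).toLp (deriv φ) : L2Q L) x
      * expo L (-n) x ∂(volQ L) = ∫ x in (-L)..L, expo L (-n) x * deriv φ x := by
    rw [← integral_volQ hL.out]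
    refine integral_congr_ae ?_
    filter_upwards [(memLp_of_continuous (L := L) hφ.continuous_deriv).coeFn_toLp] with x hx
    rw [hx, mul_comm]
  have e2 : ∫ x, ((memLp_of_continuous hφ.1.continuous).toLp φ : L2Q L) x
      * expo L (-n) x ∂(volQ L) = ∫ x in (-L)..L, expo L (-n) x * φ x := by
    rw [← integral_volQ hL.out]
    refine integral_congr_ae ?_
    filter_upwards [(memLp_of_continuous (L := L) hφ.1.continuous).coeFn_toLp] with x hx
    rw [hx, mul_comm]
  rw [e1, e2, key, ← intervalIntegral.integral_neg, ← intervalIntegral.integral_const_mul]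
  congr 1 with x
  rw [freq_neg]
  push_cast
  ring

/-- In terms of Fourier coefficients, the weak derivative multiplies by `iπn/L`. -/
theorem isWeakDeriv_iff (u v : L2Q L) :
    IsWeakDeriv L u v ↔ ∀ n, coef v n = Complex.I * freq L n * coef u n := by
  constructor
  · intro h n
    have h1 := h _ (isPeriodicTest_expo hL.out.ne' (-n))
    have h2 : deriv (expo L (-n)) = fun x => Complex.I * freq L (-n) * expo L (-n) x :=
      funext fun x => (hasDerivAt_expo _ x).deriv
    have h3 : ∫ x, u x * deriv (expo L (-n)) x ∂(volQ L)
        = Complex.I * freq L (-n) * ∫ x, u x * expo L (-n) x ∂(volQ L) := by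
      rw [← integral_const_mul, h2]
      congr 1 with x
      ring
    rw [h3, freq_neg] at h1
    rw [coef_eq, coef_eq, ← neg_neg (∫ x, v x * _ ∂(volQ L)), ← h1]
    push_cast
    ring
  · intro h φ hφ
    have h1 := hasSum_integral_mul u ((memLp_of_continuous hφ.continuous_deriv).toLp (deriv φ))
    have h2 := (hasSum_integral_mul v ((memLp_of_continuous hφ.1.continuous).toLp φ)).neg
    have e1 : ∫ x, u x * deriv φ x ∂(volQ L) = ∫ x, u x *
        ((memLp_of_continuous hφ.continuous_deriv).toLp (deriv φ) : L2Q L) x ∂(volQ L) := by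
      refine integral_congr_ae ?_
      filter_upwards [(memLp_of_continuous (L := L) hφ.continuous_deriv).coeFn_toLp] with x hx
      rw [hx]
    have e2 : ∫ x, v x * φ x ∂(volQ L) = ∫ x, v x *
        ((memLp_of_continuous hφ.1.continuous).toLp φ : L2Q L) x ∂(volQ L) := by
      refine integral_congr_ae ?_
      filter_upwards [(memLp_of_continuous (L := L) hφ.1.continuous).coeFn_toLp] with x hx
      rw [hx]
    rw [e1, e2]
    refine h1.unique ?_
    convert! h2 using 2 with m
    rw [coef_deriv hφ, h, freq_neg]
    push_cast
    ring

end L2Q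

/-! ### Periodic Sobolev spaces through Fourier coefficients -/

namespace Hper

open L2Q (freq expo)

variable {L : ℝ} {k m : ℕ}

theorem toL2_incl (h : m ≤ k) (u : Hper L k) : toL2 (incl h u) = toL2 u := rfl

theorem dx_incl (h : m ≤ k) (u : Hper L k) (j : ℕ) (hj : j ≤ m) :
    dx (incl h u) j hj = dx u j (hj.trans h) := rfl

theorem dx_zero (u : Hper L k) : dx u 0 (Nat.zero_le k) = toL2 u := rfl

theorem norm_sq_eq_sum (u : Hper L k) :
    ‖u‖ ^ 2 = ∑ j : Fin (k + 1), ‖dx u j (Nat.le_of_lt_succ j.2)‖ ^ 2 :=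
  PiLp.norm_sq_eq_of_L2 _ u.1

/-- The weak derivative of order `j ≤ k` as a bounded operator from `H^k_per(Q)` to `L²(Q)`. -/
def dxCLM (j : ℕ) (hj : j ≤ k) : Hper L k →L[ℂ] L2Q L :=
  ((PiLp.proj 2 (fun _ : Fin (k + 1) => L2Q L) ⟨j, Nat.lt_succ_of_le hj⟩).comp
    (HperSub L k).subtypeL : ↥(HperSub L k) →L[ℂ] L2Q L)

theorem dxCLM_apply (j : ℕ) (hj : j ≤ k) (u : Hper L k) : dxCLM j hj u = dx u j hj := rfl

theorem norm_dx_le (j : ℕ) (hj : j ≤ k) (u : Hper L k) : ‖dx u j hj‖ ≤ ‖u‖ :=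
  PiLp.norm_apply_le u.1 _

theorem norm_toL2_le (u : Hper L k) : ‖toL2 u‖ ≤ ‖u‖ := norm_dx_le 0 (Nat.zero_le k) u

theorem incl_add (h : m ≤ k) (u v : Hper L k) : incl h (u + v) = incl h u + incl h v := rfl

theorem incl_smul (h : m ≤ k) (c : ℂ) (u : Hper L k) : incl h (c • u) = c • incl h u := rfl

theorem norm_incl_le (h : m ≤ k) (u : Hper L k) : ‖incl h u‖ ≤ ‖u‖ := by
  rw [← abs_norm (incl h u), ← abs_norm u, ← sq_le_sq, norm_sq_eq_sum, norm_sq_eq_sum]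
  simp only [dx_incl]
  have key : ∀ (f : ℕ → ℝ), (∀ j, 0 ≤ f j) →
      ∑ j : Fin (m + 1), f j ≤ ∑ j : Fin (k + 1), f j := fun f hf => by
    rw [Fin.sum_univ_eq_sum_range f, Fin.sum_univ_eq_sum_range f]
    exact Finset.sum_le_sum_of_subset_of_nonneg (Finset.range_mono (by omega)) fun j _ _ => hf j
  have h := key (fun j => if hj : j ≤ k then ‖dx u j hj‖ ^ 2 else 0)
    fun j => by split_ifs <;> positivity
  convert! h using 2 with j _ j _
  · rw [dif_pos]
  · rw [dif_pos]

/-- The embedding `H^k_per(Q) → H^m_per(Q)` for `m ≤ k`, as a bounded operator. -/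
def inclCLM (h : m ≤ k) : Hper L k →L[ℂ] Hper L m :=
  LinearMap.mkContinuous
    { toFun := incl h, map_add' := incl_add h, map_smul' := incl_smul h } 1
    fun u => by simpa using norm_incl_le h u

theorem inclCLM_apply (h : m ≤ k) (u : Hper L k) : inclCLM h u = incl h u := rfl

/-- The Fourier weight `∑_{j ≤ k} (πn/L)^{2j}` of the norm of `H^k_per(Q)`. -/
def weight (L : ℝ) (k : ℕ) (n : ℤ) : ℝ := ∑ j ∈ Finset.range (k + 1), freq L n ^ (2 * j)

theorem one_le_weight (n : ℤ) : 1 ≤ weight L k n := by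
  rw [weight, Finset.sum_range_succ']
  have : 0 ≤ ∑ j ∈ Finset.range k, freq L n ^ (2 * (j + 1)) :=
    Finset.sum_nonneg fun j _ => (even_two_mul _).pow_nonneg _
  simpa using this

theorem weight_nonneg (n : ℤ) : 0 ≤ weight L k n := zero_le_one.trans (one_le_weight n)

theorem weight_neg (n : ℤ) : weight L k (-n) = weight L k n := by
  simp only [weight, L2Q.freq_neg, (even_two_mul _).neg_pow]

theorem freq_pow_le_weight (j : ℕ) (hj : j ≤ k) (n : ℤ) : freq L n ^ (2 * j) ≤ weight L k n :=
  Finset.single_le_sum (f := fun j => freq L n ^ (2 * j))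
    (fun j _ => (even_two_mul j).pow_nonneg (freq L n)) (Finset.mem_range.2 (Nat.lt_succ_of_le hj))

theorem norm_I_mul_freq_pow (n : ℤ) (j : ℕ) (z : ℂ) :
    ‖(Complex.I * freq L n) ^ j * z‖ ^ 2 = freq L n ^ (2 * j) * ‖z‖ ^ 2 := by
  rw [norm_mul, mul_pow, norm_pow, norm_mul, Complex.norm_I, one_mul, Complex.norm_real,
    ← pow_mul, mul_comm j 2, pow_mul, Real.norm_eq_abs, sq_abs, ← pow_mul]

variable [hL : Fact (0 < L)]

/-- The `n`-th Fourier coefficient of an element of `H^k_per(Q)`. -/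
def coef (u : Hper L k) (n : ℤ) : ℂ := L2Q.coef (toL2 u) n

theorem coef_add (u v : Hper L k) (n : ℤ) : coef (u + v) n = coef u n + coef v n := by
  simp [coef, L2Q.coef_add]

theorem coef_sub (u v : Hper L k) (n : ℤ) : coef (u - v) n = coef u n - coef v n := by
  simp [coef, L2Q.coef_sub]

theorem coef_smul (c : ℂ) (u : Hper L k) (n : ℤ) : coef (c • u) n = c * coef u n := by
  simp [coef, L2Q.coef_smul]

theorem coef_incl (h : m ≤ k) (u : Hper L k) : coef (incl h u) = coef u := rfl

theorem coef_dx (u : Hper L k) (j : ℕ) (hj : j ≤ k) (n : ℤ) :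
    L2Q.coef (dx u j hj) n = (Complex.I * freq L n) ^ j * coef u n := by
  induction j with
  | zero => simp [dx_zero, coef]
  | succ j ih =>
    have h := (L2Q.isWeakDeriv_iff _ _).1 (u.2 ⟨j, hj⟩) n
    have h2 := ih (Nat.le_of_succ_le hj)
    simp only [dx] at h2 ⊢
    refine h.trans ?_
    rw [pow_succ', mul_assoc (Complex.I * _), ← h2]
    rfl

theorem ext_coef {u v : Hper L k} (h : ∀ n, coef u n = coef v n) : u = v := by
  refine Subtype.ext (PiLp.ext fun j => L2Q.coef_ext fun n => ?_)
  have h1 := coef_dx u j (Nat.le_of_lt_succ j.2) n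
  have h2 := coef_dx v j (Nat.le_of_lt_succ j.2) n
  rw [h n, ← h2] at h1
  exact h1

theorem toL2_injective : Function.Injective (toL2 : Hper L k → L2Q L) := fun u v h =>
  ext_coef fun n => by rw [coef, coef, h]

/-- The norm of `H^k_per(Q)` in terms of Fourier coefficients. -/
theorem hasSum_norm_sq (u : Hper L k) :
    HasSum (fun n => weight L k n * ‖coef u n‖ ^ 2) (‖u‖ ^ 2) := by
  rw [norm_sq_eq_sum]
  have h := hasSum_sum (s := Finset.univ)
    (f := fun (j : Fin (k + 1)) n => ‖L2Q.coef (dx u j (Nat.le_of_lt_succ j.2)) n‖ ^ 2)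
    fun j _ => L2Q.hasSum_norm_sq (dx u j (Nat.le_of_lt_succ j.2))
  convert! h using 2 with n
  simp only [coef_dx, norm_I_mul_freq_pow]
  rw [weight, Finset.sum_mul,
    Fin.sum_univ_eq_sum_range (fun j => freq L n ^ (2 * j) * ‖coef u n‖ ^ 2)]

/-- The element of `H^k_per(Q)` with prescribed Fourier coefficients. -/
def ofCoef (a : ℤ → ℂ) (ha : Summable fun n => weight L k n * ‖a n‖ ^ 2) : Hper L k :=
  ⟨WithLp.toLp 2 fun j => L2Q.ofCoef (fun n => (Complex.I * freq L n) ^ (j : ℕ) * a n) (by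
      refine ha.of_nonneg_of_le (fun n => by positivity) fun n => ?_
      rw [norm_I_mul_freq_pow]
      exact mul_le_mul_of_nonneg_right
        (freq_pow_le_weight _ (Nat.le_of_lt_succ j.2) n) (by positivity)), by
    intro j
    rw [L2Q.isWeakDeriv_iff]
    intro n
    rw [L2Q.coef_ofCoef, L2Q.coef_ofCoef, Fin.val_succ, Fin.val_castSucc, pow_succ']
    ring⟩

theorem coef_ofCoef (a : ℤ → ℂ) (ha : Summable fun n => weight L k n * ‖a n‖ ^ 2) (n : ℤ) :
    coef (ofCoef a ha) n = a n := by
  have h : toL2 (ofCoef a ha) = L2Q.ofCoef (fun n => (Complex.I * freq L n) ^ 0 * a n) (by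
      refine ha.of_nonneg_of_le (fun n => by positivity) fun n => ?_
      rw [norm_I_mul_freq_pow]
      exact mul_le_mul_of_nonneg_right
        (freq_pow_le_weight _ (Nat.zero_le k) n) (by positivity)) := rfl
  rw [coef, h, L2Q.coef_ofCoef, pow_zero, one_mul]

theorem continuous_L2Q_coef (n : ℤ) : Continuous fun f : L2Q L => L2Q.coef f n := by
  simp only [L2Q.coef_eq_inner]
  fun_prop

instance instCompleteSpace : CompleteSpace (Hper L k) := by
  have h : IsClosed (HperSub L k : Set (PiLp 2 (fun _ : Fin (k + 1) => L2Q L))) := by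
    have : (HperSub L k : Set (PiLp 2 (fun _ : Fin (k + 1) => L2Q L)))
        = ⋂ (j : Fin k) (n : ℤ), {w | L2Q.coef (w j.succ) n
            = Complex.I * freq L n * L2Q.coef (w j.castSucc) n} := by
      ext w
      simp only [mem_iInter, Set.mem_ofPred_eq]
      exact forall_congr' fun j => L2Q.isWeakDeriv_iff _ _
    rw [this]
    refine isClosed_iInter fun j => isClosed_iInter fun n => isClosed_eq ?_ ?_
    · exact (continuous_L2Q_coef n).comp (PiLp.continuous_apply 2 _ _)
    · exact continuous_const.mul ((continuous_L2Q_coef n).comp (PiLp.continuous_apply 2 _ _))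
  exact h.completeSpace_coe

/-- Integration by parts: `⟨f, ∂ₓ²g⟩ = -⟨∂ₓf, ∂ₓg⟩` for `f ∈ H¹` and `g ∈ H²`. -/
theorem inner_dx_two (hm : 1 ≤ m) (hk : 2 ≤ k) (u : Hper L m) (v : Hper L k) :
    ⟪toL2 u, dx v 2 hk⟫_ℂ = -⟪dx u 1 hm, dx v 1 (by omega)⟫_ℂ := by
  refine (L2Q.hasSum_inner _ _).unique ?_
  convert! (L2Q.hasSum_inner (dx u 1 hm) (dx v 1 (by omega))).neg using 2 with n
  rw [coef_dx, coef_dx, coef_dx]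
  simp only [map_mul, map_pow, Complex.conj_I, Complex.conj_ofReal, coef]
  ring

end Hper

/-! ### Inequalities for sequences -/

namespace ENNReal

theorem mul_le_sq_add_sq (a b : ℝ≥0∞) : a * b ≤ a ^ 2 + b ^ 2 := by
  rcases le_total a b with h | h
  · calc a * b ≤ b * b := mul_le_mul_left h b
      _ ≤ a ^ 2 + b ^ 2 := by rw [← sq]; exact le_add_self
  · calc a * b ≤ a * a := mul_le_mul_right h a
      _ ≤ a ^ 2 + b ^ 2 := by rw [← sq]; exact le_self_add

theorem add_sq_le_four_mul (a b : ℝ≥0∞) : (a + b) ^ 2 ≤ 4 * (a ^ 2 + b ^ 2) := by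
  have h : ∀ x y : ℝ≥0∞, x ≤ y → (x + y) ^ 2 ≤ 4 * y ^ 2 := fun x y hxy => by
    calc (x + y) ^ 2 ≤ (y + y) ^ 2 := by gcongr
      _ = 4 * y ^ 2 := by ring
  rcases le_total a b with hab | hab
  · exact (h a b hab).trans (mul_le_mul_right le_add_self 4)
  · rw [add_comm a b]
    exact (h b a hab).trans (mul_le_mul_right le_self_add 4)

theorem tsum_mul_sq_le (x b : ℤ → ℝ≥0∞) :
    (∑' m, x m * b m) ^ 2 ≤ 2 * (∑' m, b m) * ∑' m, x m ^ 2 * b m := by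
  calc (∑' m, x m * b m) ^ 2 = ∑' m, ∑' l, (x m * b m) * (x l * b l) := by
        rw [sq, ← ENNReal.tsum_mul_right]
        exact tsum_congr fun m => by rw [← ENNReal.tsum_mul_left]
    _ ≤ ∑' m, ∑' l, ((x m ^ 2 * b m) * b l + b m * (x l ^ 2 * b l)) := by
        refine ENNReal.tsum_le_tsum fun m => ENNReal.tsum_le_tsum fun l => ?_
        calc (x m * b m) * (x l * b l) = (x m * x l) * (b m * b l) := by ring
          _ ≤ (x m ^ 2 + x l ^ 2) * (b m * b l) := by gcongr; exact mul_le_sq_add_sq _ _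
          _ = _ := by ring
    _ = 2 * (∑' m, b m) * ∑' m, x m ^ 2 * b m := by
        simp only [ENNReal.tsum_add, ENNReal.tsum_mul_left, ENNReal.tsum_mul_right]
        ring

/-- A form of Young's inequality `‖a ⋆ b‖₂ ≲ ‖a‖₂ ‖b‖₁` for the convolution on `ℤ`. -/
theorem tsum_conv_sq_le (a b : ℤ → ℝ≥0∞) :
    ∑' n, (∑' m, a (n - m) * b m) ^ 2 ≤ 2 * (∑' m, b m) ^ 2 * ∑' n, a n ^ 2 := by
  calc ∑' n, (∑' m, a (n - m) * b m) ^ 2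
      ≤ ∑' n, 2 * (∑' m, b m) * ∑' m, a (n - m) ^ 2 * b m :=
        ENNReal.tsum_le_tsum fun n => tsum_mul_sq_le (fun m => a (n - m)) b
    _ = 2 * (∑' m, b m) * ∑' m, ∑' n, a (n - m) ^ 2 * b m := by
        rw [ENNReal.tsum_mul_left, ENNReal.tsum_comm]
    _ = 2 * (∑' m, b m) * ∑' m, (∑' n, a n ^ 2) * b m := by
        congr 2
        ext m
        rw [ENNReal.tsum_mul_right, ← (Equiv.subRight m).tsum_eq fun n => a n ^ 2]
        rfl
    _ = _ := by
        rw [ENNReal.tsum_mul_left]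
        ring

end ENNReal

theorem hasSum_inv_sub_inv (μ : ℝ) (hμ : 1 ≤ μ) :
    HasSum (fun n : ℕ => 2 * ((μ + n - 1 / 2)⁻¹ - (μ + n + 1 / 2)⁻¹)) (2 * (μ - 1 / 2)⁻¹) := by
  have hn : ∀ n : ℕ, (0 : ℝ) ≤ n := fun n => n.cast_nonneg
  rw [hasSum_iff_tendsto_nat_of_nonneg]
  · have h1 : ∀ N : ℕ, ∑ n ∈ Finset.range N, 2 * ((μ + n - 1 / 2)⁻¹ - (μ + n + 1 / 2)⁻¹)
        = 2 * ((μ - 1 / 2)⁻¹ - (μ + N - 1 / 2)⁻¹) := by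
      intro N
      rw [← Finset.mul_sum]
      have := Finset.sum_range_sub' (fun n : ℕ => (μ + n - 1 / 2)⁻¹) N
      simp only [Nat.cast_zero, add_zero] at this
      rw [← this]
      congr 1
      refine Finset.sum_congr rfl fun n _ => ?_
      push_cast
      ring_nf
    simp only [h1]
    have h2 : Tendsto (fun N : ℕ => (μ + N - 1 / 2)⁻¹) atTop (𝓝 0) := by
      refine tendsto_inv_atTop_zero.comp ?_
      refine tendsto_atTop_mono (fun N => ?_) tendsto_natCast_atTop_atTop
      linarith
    simpa using (tendsto_const_nhds.sub h2).const_mul 2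
  · intro n
    have h3 : (μ + n + 1 / 2)⁻¹ ≤ (μ + n - 1 / 2)⁻¹ :=
      inv_anti₀ (by linarith [hn n]) (by linarith)
    linarith

theorem inv_sq_add_sq_le (μ x : ℝ) (hμ : 1 ≤ μ) (hx : 0 ≤ x) :
    (μ ^ 2 + x ^ 2)⁻¹ ≤ 2 * ((μ + x - 1 / 2)⁻¹ - (μ + x + 1 / 2)⁻¹) := by
  have h1 : 0 < μ + x - 1 / 2 := by linarith
  have h2 : 0 < μ + x + 1 / 2 := by linarith
  have h3 : 0 < μ ^ 2 + x ^ 2 := by positivity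
  rw [inv_sub_inv h1.ne' h2.ne', ← one_div, ← mul_div_assoc, div_le_div_iff₀ h3 (by positivity)]
  nlinarith [sq_nonneg (μ - x)]

/-- `∑_{n ∈ s} 1/(μ² + n²) ≤ 8/μ`, uniformly in the finite set `s`. -/
theorem sum_inv_sq_add_sq_le (μ : ℝ) (hμ : 1 ≤ μ) (s : Finset ℤ) :
    ∑ n ∈ s, (μ ^ 2 + (n : ℝ) ^ 2)⁻¹ ≤ 8 / μ := by
  have hn : ∀ n : ℕ, (0 : ℝ) ≤ n := fun n => n.cast_nonneg
  have hpos : ∀ n : ℕ, (0 : ℝ) ≤ (μ ^ 2 + (n : ℝ) ^ 2)⁻¹ := fun n => by positivity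
  have hM := hasSum_inv_sub_inv μ hμ
  have hle : ∀ n : ℕ, (μ ^ 2 + (n : ℝ) ^ 2)⁻¹ ≤ 2 * ((μ + n - 1 / 2)⁻¹ - (μ + n + 1 / 2)⁻¹) :=
    fun n => inv_sq_add_sq_le μ n hμ (hn n)
  have hsum : Summable fun n : ℕ => (μ ^ 2 + (n : ℝ) ^ 2)⁻¹ :=
    hM.summable.of_nonneg_of_le hpos hle
  have hZ : HasSum (fun n : ℤ => (μ ^ 2 + (n : ℝ) ^ 2)⁻¹) _ :=
    HasSum.of_nat_of_neg (by simpa using hsum.hasSum) (by simpa using hsum.hasSum)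
  have h0 : ∑' n : ℕ, (μ ^ 2 + (n : ℝ) ^ 2)⁻¹ ≤ 2 * (μ - 1 / 2)⁻¹ :=
    hasSum_le hle hsum.hasSum hM
  have h4 : (μ - 1 / 2)⁻¹ ≤ 2 * μ⁻¹ := by
    rw [← one_div, ← one_div, mul_one_div, div_le_div_iff₀ (by linarith) (by linarith)]
    linarith
  have h5 : (0 : ℝ) ≤ (μ ^ 2 + ((0 : ℤ) : ℝ) ^ 2)⁻¹ := by positivity
  calc ∑ n ∈ s, (μ ^ 2 + (n : ℝ) ^ 2)⁻¹ ≤ _ := sum_le_hasSum s (fun n _ => by positivity) hZ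
    _ ≤ 8 / μ := by
      rw [div_eq_mul_inv]
      linarith

/-- A square summable sequence with square summable `n c_n` is summable, with a bound that
interpolates between the two norms through the free parameter `μ`. -/
theorem summable_norm_and_sq_le (c : ℤ → ℂ) (μ S : ℝ) (hμ : 1 ≤ μ)
    (hS : HasSum (fun n : ℤ => (μ ^ 2 + (n : ℝ) ^ 2) * ‖c n‖ ^ 2) S) :
    Summable (fun n => ‖c n‖) ∧ (∑' n, ‖c n‖) ^ 2 ≤ 8 / μ * S := by
  have hS0 : 0 ≤ S := hS.nonneg fun n => by positivity
  have key : ∀ s : Finset ℤ, (∑ n ∈ s, ‖c n‖) ^ 2 ≤ 8 / μ * S := by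
    intro s
    refine (Finset.sum_sq_le_sum_mul_sum_of_sq_le_mul s
      (f := fun n : ℤ => (μ ^ 2 + (n : ℝ) ^ 2)⁻¹)
      (g := fun n : ℤ => (μ ^ 2 + (n : ℝ) ^ 2) * ‖c n‖ ^ 2)
      (fun n _ => by positivity) (fun n _ => by positivity) fun n _ => ?_).trans ?_
    · have : μ ^ 2 + (n : ℝ) ^ 2 ≠ 0 := by positivity
      rw [inv_mul_cancel_left₀ this]
    · exact mul_le_mul (sum_inv_sq_add_sq_le μ hμ s) (sum_le_hasSum s (fun n _ => by positivity) hS)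
        (Finset.sum_nonneg fun n _ => by positivity) (by positivity)
  have key2 : ∀ s : Finset ℤ, ∑ n ∈ s, ‖c n‖ ≤ √(8 / μ * S) := fun s =>
    Real.le_sqrt_of_sq_le (key s)
  refine ⟨summable_of_sum_le (fun n => norm_nonneg _) key2, ?_⟩
  have h : ∑' n, ‖c n‖ ≤ √(8 / μ * S) :=
    Real.tsum_le_of_sum_le (fun n => norm_nonneg _) key2
  calc (∑' n, ‖c n‖) ^ 2 ≤ √(8 / μ * S) ^ 2 := by
        gcongr
    _ = 8 / μ * S := Real.sq_sqrt (by positivity)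

/-! ### The Wiener norm and the algebra structure of `H^k_per(Q)` -/

theorem summable_and_tsum_le_of_tsum_ofReal_le {f : ℤ → ℝ} (hf : ∀ n, 0 ≤ f n) {R : ℝ} (hR : 0 ≤ R)
    (h : ∑' n, ENNReal.ofReal (f n) ≤ ENNReal.ofReal R) : Summable f ∧ ∑' n, f n ≤ R := by
  have h1 : Summable f := by
    have h2 := ENNReal.summable_toReal (h.trans_lt ENNReal.ofReal_lt_top).ne
    simpa [ENNReal.toReal_ofReal, hf] using h2
  refine ⟨h1, ?_⟩
  rwa [← ENNReal.ofReal_tsum_of_nonneg hf h1, ENNReal.ofReal_le_ofReal_iff hR] at h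

namespace Hper

open L2Q (freq expo)

variable {L : ℝ} {k m : ℕ}

/-- Peetre-type inequality for the Fourier weights. -/
theorem weight_le (n l : ℤ) :
    weight L k n ≤ 4 ^ k * (weight L k (n - l) + weight L k l) := by
  rw [weight, weight, weight, ← Finset.sum_add_distrib, Finset.mul_sum]
  refine Finset.sum_le_sum fun j hj => ?_
  rw [Finset.mem_range] at hj
  have e : freq L n = freq L (n - l) + freq L l := by rw [L2Q.freq_sub]; ring
  set x := freq L (n - l)
  set y := freq L l
  rw [e, pow_mul, pow_mul, pow_mul]
  calc ((x + y) ^ 2) ^ j ≤ (2 * (x ^ 2 + y ^ 2)) ^ j := by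
        gcongr
        nlinarith [sq_nonneg (x - y)]
    _ = 2 ^ j * (x ^ 2 + y ^ 2) ^ j := by rw [mul_pow]
    _ ≤ 2 ^ j * (2 ^ (j - 1) * ((x ^ 2) ^ j + (y ^ 2) ^ j)) := by
        gcongr
        exact add_pow_le (sq_nonneg _) (sq_nonneg _) j
    _ ≤ 2 ^ k * (2 ^ k * ((x ^ 2) ^ j + (y ^ 2) ^ j)) := by
        gcongr
        all_goals first | omega | norm_num
    _ = 4 ^ k * ((x ^ 2) ^ j + (y ^ 2) ^ j) := by
        rw [← mul_assoc, ← mul_pow]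
        norm_num

theorem sqrt_weight_le (n l : ℤ) :
    √(weight L k n) ≤ 2 ^ k * (√(weight L k (n - l)) + √(weight L k l)) := by
  rw [Real.sqrt_le_left (by positivity)]
  refine (weight_le n l).trans ?_
  rw [mul_pow, ← pow_mul, mul_comm k 2, pow_mul, show (2 : ℝ) ^ 2 = 4 by norm_num]
  gcongr
  have h1 := Real.sq_sqrt (weight_nonneg (L := L) (k := k) (n - l))
  have h2 := Real.sq_sqrt (weight_nonneg (L := L) (k := k) l)
  nlinarith [Real.sqrt_nonneg (weight L k (n - l)), Real.sqrt_nonneg (weight L k l)]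

/-- A constant in the Sobolev inequalities below. -/
def sobConst (L : ℝ) : ℝ := 1 + (L / Real.pi) ^ 2

theorem sobConst_pos : 0 < sobConst L := by unfold sobConst; positivity

theorem norm_toL2_sq_add_norm_dx_sq_le (hk : 1 ≤ k) (u : Hper L k) :
    ‖toL2 u‖ ^ 2 + ‖dx u 1 hk‖ ^ 2 ≤ ‖u‖ ^ 2 := by
  have h1 := norm_incl_le hk u
  have h2 := norm_sq_eq_sum (incl hk u)
  rw [Fin.sum_univ_two] at h2
  have h3 : ‖incl hk u‖ ^ 2 = ‖toL2 u‖ ^ 2 + ‖dx u 1 hk‖ ^ 2 := h2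
  rw [← h3]
  gcongr

/-- The normalisation `(2L)^{-1/2}` of the exponentials. -/
def expoNorm (L : ℝ) : ℝ := (√(2 * L))⁻¹

theorem expoNorm_nonneg : 0 ≤ expoNorm L := by unfold expoNorm; positivity

/-- A constant in the product estimate. -/
def mulConst (L : ℝ) (k : ℕ) : ℝ := √(8 * expoNorm L ^ 2 * 4 ^ k)

theorem mulConst_nonneg : 0 ≤ mulConst L k := Real.sqrt_nonneg _

theorem tsum_conv_comm (a b : ℤ → ℝ≥0∞) (n : ℤ) :
    ∑' l, a (n - l) * b l = ∑' l, b (n - l) * a l := by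
  rw [← (Equiv.subLeft n).tsum_eq fun l => b (n - l) * a l]
  refine tsum_congr fun l => ?_
  simp [mul_comm]

variable [hL : Fact (0 < L)]

/-- The Wiener norm, the `ℓ¹` norm of the Fourier coefficients. It is finite for `k ≥ 1`. -/
def wiener (u : Hper L k) : ℝ := ∑' n, ‖coef u n‖

theorem wiener_nonneg (u : Hper L k) : 0 ≤ wiener u := tsum_nonneg fun _ => norm_nonneg _

theorem wiener_incl (h : m ≤ k) (u : Hper L k) : wiener (incl h u) = wiener u := rfl

/-- Interpolation between `L²` and `H¹` with a free parameter `μ`. -/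
theorem summable_and_wiener_sq_le (hk : 1 ≤ k) (u : Hper L k) {μ : ℝ} (hμ : 1 ≤ μ) :
    Summable (fun n => ‖coef u n‖) ∧
      wiener u ^ 2 ≤ 8 / μ * (μ ^ 2 * ‖toL2 u‖ ^ 2 + (L / Real.pi) ^ 2 * ‖dx u 1 hk‖ ^ 2) := by
  refine summable_norm_and_sq_le (coef u) μ _ hμ ?_
  have h1 := (L2Q.hasSum_norm_sq (toL2 u)).mul_left (μ ^ 2)
  have h2 := (L2Q.hasSum_norm_sq (dx u 1 hk)).mul_left ((L / Real.pi) ^ 2)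
  convert! h1.add h2 using 2 with n
  rw [coef_dx, norm_I_mul_freq_pow, freq, coef]
  have := hL.out.ne'
  have := Real.pi_ne_zero
  simp only [mul_one]
  field_simp

theorem summable_norm_coef (hk : 1 ≤ k) (u : Hper L k) : Summable (fun n => ‖coef u n‖) :=
  (summable_and_wiener_sq_le hk u le_rfl).1

theorem wiener_le (hk : 1 ≤ k) (u : Hper L k) : wiener u ≤ √(8 * sobConst L) * ‖u‖ := by
  have h := (summable_and_wiener_sq_le hk u le_rfl).2
  have h2 := norm_toL2_sq_add_norm_dx_sq_le hk u
  refine abs_le_of_sq_le_sq' ?_ (by positivity) |>.2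
  rw [mul_pow, Real.sq_sqrt (by have := sobConst_pos (L := L); positivity)]
  refine h.trans ?_
  unfold sobConst
  have h3 := sq_nonneg ‖toL2 u‖
  have h4 := sq_nonneg ‖dx u 1 hk‖
  have h5 := sq_nonneg (L / Real.pi)
  calc 8 / 1 * (1 ^ 2 * ‖toL2 u‖ ^ 2 + (L / Real.pi) ^ 2 * ‖dx u 1 hk‖ ^ 2)
      ≤ 8 * (1 + (L / Real.pi) ^ 2) * (‖toL2 u‖ ^ 2 + ‖dx u 1 hk‖ ^ 2) := by
        nlinarith [mul_nonneg h5 h3, mul_nonneg h5 h4]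
    _ ≤ _ := by gcongr

/-- A Gagliardo–Nirenberg inequality: the fourth power of the Wiener norm is of first order in
`‖∂ₓu‖²`. -/
theorem wiener_pow_four_le (hk : 1 ≤ k) (u : Hper L k) :
    wiener u ^ 4 ≤ 256 * sobConst L ^ 2 * (‖toL2 u‖ ^ 2 * (‖toL2 u‖ ^ 2 + ‖dx u 1 hk‖ ^ 2)) := by
  have h3 := sq_nonneg ‖dx u 1 hk‖
  rcases (sq_nonneg ‖toL2 u‖).eq_or_lt' with h0 | h0
  · have : toL2 u = 0 := by simpa using h0
    have hz : wiener u = 0 := by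
      have : ∀ n, coef u n = 0 := fun n => by simp [coef, this, L2Q.coef]
      simp [wiener, this]
    rw [hz, h0]
    simp
  · set a := ‖toL2 u‖ ^ 2
    set y := ‖dx u 1 hk‖ ^ 2
    -- the parameter `μ` that balances the two terms of the interpolation inequality
    have hμ2 : √((a + y) / a) ^ 2 = (a + y) / a := Real.sq_sqrt (by positivity)
    have hμ : 1 ≤ √((a + y) / a) := by
      rw [Real.one_le_sqrt, le_div_iff₀ h0]
      linarith
    have h := (summable_and_wiener_sq_le hk u hμ).2
    set μ := √((a + y) / a)
    have hμ0 : 0 < μ := by linarith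
    have e : μ ^ 2 * a = a + y := by rw [hμ2]; field_simp
    have hb : 1 ≤ sobConst L := by
      unfold sobConst; linarith [sq_nonneg (L / Real.pi)]
    have hb' : (L / Real.pi) ^ 2 ≤ sobConst L := by unfold sobConst; linarith
    have h5 : wiener u ^ 2 ≤ 16 * sobConst L * ((a + y) / μ) := by
      refine h.trans ?_
      have : μ ^ 2 * a + (L / Real.pi) ^ 2 * y ≤ 2 * sobConst L * (a + y) := by
        rw [e]
        nlinarith [mul_le_mul_of_nonneg_right hb' h3, mul_le_mul_of_nonneg_right hb h0.le,
          mul_le_mul_of_nonneg_right hb h3]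
      calc 8 / μ * (μ ^ 2 * a + (L / Real.pi) ^ 2 * y) ≤ 8 / μ * (2 * sobConst L * (a + y)) := by
            gcongr
        _ = _ := by ring
    calc wiener u ^ 4 = (wiener u ^ 2) ^ 2 := by ring
      _ ≤ (16 * sobConst L * ((a + y) / μ)) ^ 2 := by gcongr
      _ = 256 * sobConst L ^ 2 * ((a + y) ^ 2 / μ ^ 2) := by ring
      _ = _ := by rw [hμ2]; field_simp

theorem expoNorm_sq : expoNorm L * expoNorm L * (2 * L) = 1 := by
  have h := hL.out
  have h2 : √(2 * L) * √(2 * L) = 2 * L := Real.mul_self_sqrt (by positivity)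
  have h3 : √(2 * L) ≠ 0 := by positivity
  unfold expoNorm
  field_simp
  rw [sq, h2]

/-- The Wiener norm controls the supremum. -/
theorem ae_norm_le_wiener (hk : 1 ≤ k) (u : Hper L k) :
    ∀ᵐ x ∂(volQ L), ‖toL2 u x‖ ≤ expoNorm L * wiener u := by
  have hs := summable_norm_coef hk u
  have hs' : Summable fun n => ‖(expoNorm L : ℂ) * coef u n‖ := by
    simpa [norm_mul] using hs.mul_left ‖(expoNorm L : ℂ)‖
  have hb : ∀ n x, ‖(expoNorm L : ℂ) * coef u n * expo L n x‖ = ‖(expoNorm L : ℂ) * coef u n‖ :=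
    fun n x => by rw [norm_mul, L2Q.norm_expo, mul_one]
  set G : ℝ → ℂ := fun x => ∑' n, (expoNorm L : ℂ) * coef u n * expo L n x with hG
  have hGc : Continuous G := continuous_tsum
    (fun n => continuous_const.mul (L2Q.continuous_expo n)) hs' fun n x => (hb n x).le
  have hGb : ∀ x, ‖G x‖ ≤ expoNorm L * wiener u := fun x => by
    refine (norm_tsum_le_tsum_norm (by simpa only [hb] using hs')).trans ?_
    simp only [hb, norm_mul, Complex.norm_real, Real.norm_eq_abs, abs_of_nonneg expoNorm_nonneg]
    rw [tsum_mul_left, wiener]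
  have hmem := L2Q.memLp_of_continuous (L := L) hGc
  -- `u` agrees with the sum `G` of its Fourier series, which has the same coefficients
  have key : toL2 u = hmem.toLp G := by
    refine L2Q.coef_ext fun n => ?_
    have e : ∫ x, (hmem.toLp G : L2Q L) x * expo L (-n) x ∂(volQ L)
        = ∫ x, ∑' l, (expoNorm L : ℂ) * coef u l * expo L (l - n) x ∂(volQ L) := by
      refine integral_congr_ae ?_
      filter_upwards [hmem.coeFn_toLp] with x hx
      rw [hx, hG, ← tsum_mul_right]
      refine tsum_congr fun l => ?_
      rw [mul_assoc, ← L2Q.expo_add, sub_eq_add_neg]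
    have h1 := hasSum_integral_of_summable_integral_norm (μ := volQ L)
      (F := fun l x => (expoNorm L : ℂ) * coef u l * expo L (l - n) x) (fun l =>
        ((L2Q.memLp_of_continuous (L2Q.continuous_expo _)).integrable (by norm_num)).const_mul _) (by
        simp only [norm_mul, L2Q.norm_expo, mul_one]
        simp only [integral_const, smul_eq_mul]
        exact (by simpa [norm_mul] using hs' : Summable fun l =>
          ‖(expoNorm L : ℂ)‖ * ‖coef u l‖).mul_left _)
    rw [L2Q.coef_eq (hmem.toLp G), e]
    have h2 : HasSum (fun l => ∫ x, (expoNorm L : ℂ) * coef u l * expo L (l - n) x ∂(volQ L))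
        ((expoNorm L : ℂ) * coef u n * (2 * L)) := by
      convert! hasSum_ite_eq n ((expoNorm L : ℂ) * coef u n * (2 * L)) using 2 with l
      rw [integral_const_mul, L2Q.integral_expo hL.out]
      by_cases h : l = n
      · subst h; simp
      · rw [if_neg (by omega), if_neg h, mul_zero]
    rw [h1.unique h2]
    have h3 : ((expoNorm L : ℂ) * expoNorm L * (2 * L)) = 1 := by exact_mod_cast expoNorm_sq (L := L)
    change coef u n = (expoNorm L : ℂ) * (expoNorm L * coef u n * (2 * L))
    linear_combination (-coef u n) * h3
  rw [key]
  filter_upwards [hmem.coeFn_toLp] with x hx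
  rw [hx]
  exact hGb x

/-- The Fourier coefficients of the product `uv`: the convolution of those of `u` and `v`, up to
the normalisation of the exponentials. -/
def convCoef (u v : Hper L k) (n : ℤ) : ℂ := expoNorm L * ∑' l, coef u (n - l) * coef v l

theorem ofReal_wiener (hk : 1 ≤ k) (u : Hper L k) :
    ∑' n, ‖coef u n‖ₑ = ENNReal.ofReal (wiener u) := by
  rw [wiener, ENNReal.ofReal_tsum_of_nonneg (fun n => norm_nonneg _) (summable_norm_coef hk u)]
  simp only [ofReal_norm]

theorem tsum_sqrt_weight_sq (u : Hper L k) :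
    ∑' n, (ENNReal.ofReal √(weight L k n) * ‖coef u n‖ₑ) ^ 2 = ENNReal.ofReal (‖u‖ ^ 2) := by
  rw [← (hasSum_norm_sq u).tsum_eq, ENNReal.ofReal_tsum_of_nonneg
    (fun n => mul_nonneg (weight_nonneg n) (by positivity)) (hasSum_norm_sq u).summable]
  refine tsum_congr fun n => ?_
  rw [← ofReal_norm, ← ENNReal.ofReal_mul (by positivity), ← ENNReal.ofReal_pow (by positivity),
    mul_pow, Real.sq_sqrt (weight_nonneg n)]

theorem summable_convCoef_and_le (hk : 1 ≤ k) (u v : Hper L k) :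
    Summable (fun n => weight L k n * ‖convCoef u v n‖ ^ 2) ∧
      ∑' n, weight L k n * ‖convCoef u v n‖ ^ 2 ≤ 8 * expoNorm L ^ 2 * 4 ^ k *
        (wiener v ^ 2 * ‖u‖ ^ 2 + wiener u ^ 2 * ‖v‖ ^ 2) := by
  refine summable_and_tsum_le_of_tsum_ofReal_le
    (fun n => mul_nonneg (weight_nonneg n) (by positivity)) (by positivity) ?_
  set w : ℤ → ℝ≥0∞ := fun n => ENNReal.ofReal √(weight L k n)
  set A : ℤ → ℝ≥0∞ := fun n => ‖coef u n‖ₑ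
  set B : ℤ → ℝ≥0∞ := fun n => ‖coef v n‖ₑ
  set κ : ℝ≥0∞ := ENNReal.ofReal (expoNorm L)
  have hw : ∀ n l, w n ≤ 2 ^ k * (w (n - l) + w l) := fun n l => by
    have := ENNReal.ofReal_le_ofReal (sqrt_weight_le (L := L) (k := k) n l)
    rwa [ENNReal.ofReal_mul (by positivity), ENNReal.ofReal_pow (by norm_num),
      ENNReal.ofReal_add (by positivity) (by positivity), ENNReal.ofReal_ofNat] at this
  have hconv : ∀ n, w n * ‖convCoef u v n‖ₑ ≤ κ * 2 ^ k *
      (∑' l, (w (n - l) * A (n - l)) * B l + ∑' l, (w (n - l) * B (n - l)) * A l) := by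
    intro n
    have h1 : ‖convCoef u v n‖ₑ ≤ κ * ∑' l, A (n - l) * B l := by
      rw [convCoef, enorm_mul, ← ofReal_norm, Complex.norm_real, Real.norm_eq_abs,
        abs_of_nonneg expoNorm_nonneg]
      gcongr
      refine enorm_tsum_le_tsum_enorm.trans (le_of_eq ?_)
      simp only [enorm_mul, A, B]
    calc w n * ‖convCoef u v n‖ₑ ≤ w n * (κ * ∑' l, A (n - l) * B l) := by gcongr
      _ = κ * ∑' l, w n * (A (n - l) * B l) := by rw [ENNReal.tsum_mul_left]; ring
      _ ≤ κ * ∑' l, 2 ^ k * ((w (n - l) * A (n - l)) * B l + A (n - l) * (w l * B l)) := by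
          refine mul_le_mul_right (ENNReal.tsum_le_tsum fun l => ?_) κ
          calc w n * (A (n - l) * B l) ≤ 2 ^ k * (w (n - l) + w l) * (A (n - l) * B l) := by
                gcongr
                exact hw n l
            _ = 2 ^ k * ((w (n - l) * A (n - l)) * B l + A (n - l) * (w l * B l)) := by ring
      _ = _ := by
          rw [ENNReal.tsum_mul_left, ENNReal.tsum_add,
            tsum_conv_comm A (fun l => w l * B l), ← mul_assoc]
  calc ∑' n, ENNReal.ofReal (weight L k n * ‖convCoef u v n‖ ^ 2)
      = ∑' n, (w n * ‖convCoef u v n‖ₑ) ^ 2 := by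
        refine tsum_congr fun n => ?_
        rw [← ofReal_norm, ← ENNReal.ofReal_mul (by positivity),
          ← ENNReal.ofReal_pow (by positivity), mul_pow, Real.sq_sqrt (weight_nonneg n)]
    _ ≤ ∑' n, (κ * 2 ^ k) ^ 2 * (4 * ((∑' l, (w (n - l) * A (n - l)) * B l) ^ 2
          + (∑' l, (w (n - l) * B (n - l)) * A l) ^ 2)) := by
        refine ENNReal.tsum_le_tsum fun n => ?_
        calc (w n * ‖convCoef u v n‖ₑ) ^ 2 ≤ _ := pow_le_pow_left' (hconv n) 2
          _ ≤ _ := by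
            rw [mul_pow]
            gcongr
            exact ENNReal.add_sq_le_four_mul _ _
    _ ≤ (κ * 2 ^ k) ^ 2 * (4 * (2 * (∑' l, B l) ^ 2 * ∑' n, (w n * A n) ^ 2
          + 2 * (∑' l, A l) ^ 2 * ∑' n, (w n * B n) ^ 2)) := by
        rw [ENNReal.tsum_mul_left, ENNReal.tsum_mul_left, ENNReal.tsum_add]
        gcongr
        · exact ENNReal.tsum_conv_sq_le (fun l => w l * A l) B
        · exact ENNReal.tsum_conv_sq_le (fun l => w l * B l) A
    _ = _ := by
        rw [tsum_sqrt_weight_sq, tsum_sqrt_weight_sq, ofReal_wiener hk, ofReal_wiener hk]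
        have h8 : (8 : ℝ≥0∞) = ENNReal.ofReal 8 := by simp
        have h4 : (4 : ℝ≥0∞) = ENNReal.ofReal 4 := by simp
        have hn := wiener_nonneg u
        have hn' := wiener_nonneg v
        have hκ := expoNorm_nonneg (L := L)
        rw [ENNReal.ofReal_mul (by positivity), ENNReal.ofReal_mul (by positivity),
          ENNReal.ofReal_mul (by positivity), ENNReal.ofReal_add (by positivity) (by positivity),
          ENNReal.ofReal_mul (by positivity), ENNReal.ofReal_mul (by positivity),
          ENNReal.ofReal_pow hκ, ENNReal.ofReal_pow (show (0 : ℝ) ≤ 4 by norm_num), ENNReal.ofReal_pow hn, ENNReal.ofReal_pow hn',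
          ← h8, ← h4]
        rw [mul_pow, ← pow_mul, mul_comm k 2, pow_mul, show (2 : ℝ≥0∞) ^ 2 = 4 by norm_num]
        ring

/-- The product of two elements of `H^k_per(Q)`, `k ≥ 1`. -/
def mul (hk : 1 ≤ k) (u v : Hper L k) : Hper L k :=
  ofCoef (convCoef u v) (summable_convCoef_and_le hk u v).1

theorem coef_mul (hk : 1 ≤ k) (u v : Hper L k) (n : ℤ) : coef (mul hk u v) n = convCoef u v n :=
  coef_ofCoef _ _ n

/-- The tame product estimate: it is linear in the norms of `H^k`. -/
theorem norm_mul_le (hk : 1 ≤ k) (u v : Hper L k) :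
    ‖mul hk u v‖ ≤ mulConst L k * (wiener v * ‖u‖ + wiener u * ‖v‖) := by
  have hn := wiener_nonneg u
  have hn' := wiener_nonneg v
  have h := (summable_convCoef_and_le hk u v).2
  have h1 := (hasSum_norm_sq (mul hk u v)).tsum_eq
  simp only [coef_mul] at h1
  rw [h1] at h
  refine (abs_le_of_sq_le_sq' ?_ (by have := mulConst_nonneg (L := L) (k := k); positivity)).2
  refine h.trans ?_
  rw [mul_pow, mulConst, Real.sq_sqrt (by positivity)]
  gcongr
  nlinarith [mul_nonneg (mul_nonneg hn' (norm_nonneg u)) (mul_nonneg hn (norm_nonneg v))]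

end Hper

/-! ### Products, conjugates and the cubic nonlinearity -/

namespace Hper

open L2Q (freq expo)

variable {L : ℝ} {k m : ℕ}

theorem toL2_add_ae (u v : Hper L k) :
    toL2 (u + v) =ᵐ[volQ L] fun x => toL2 u x + toL2 v x := by
  rw [map_add]
  exact Lp.coeFn_add _ _

theorem toL2_sub_ae (u v : Hper L k) :
    toL2 (u - v) =ᵐ[volQ L] fun x => toL2 u x - toL2 v x := by
  rw [map_sub]
  exact Lp.coeFn_sub _ _

theorem toL2_smul_ae (c : ℂ) (u : Hper L k) :
    toL2 (c • u) =ᵐ[volQ L] fun x => c * toL2 u x := by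
  rw [map_smul]
  exact Lp.coeFn_smul _ _

/-- A constant in the estimate of the cubic nonlinearity. -/
def cubConst (L : ℝ) (k : ℕ) : ℝ := 2 * mulConst L k ^ 2 + mulConst L k * expoNorm L

theorem cubConst_nonneg : 0 ≤ cubConst L k := by
  have := mulConst_nonneg (L := L) (k := k)
  have := expoNorm_nonneg (L := L)
  unfold cubConst
  positivity

variable [hL : Fact (0 < L)]

theorem wiener_mul_le (hk : 1 ≤ k) (u v : Hper L k) :
    wiener (mul hk u v) ≤ expoNorm L * (wiener u * wiener v) := by
  have hn := wiener_nonneg u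
  have hn' := wiener_nonneg v
  have hκ := expoNorm_nonneg (L := L)
  have h : ∑' n, ‖coef (mul hk u v) n‖ₑ
      ≤ ENNReal.ofReal (expoNorm L) * ((∑' n, ‖coef u n‖ₑ) * ∑' n, ‖coef v n‖ₑ) := by
    calc ∑' n, ‖coef (mul hk u v) n‖ₑ
        ≤ ∑' n, ENNReal.ofReal (expoNorm L) * ∑' l, ‖coef u (n - l)‖ₑ * ‖coef v l‖ₑ := by
          refine ENNReal.tsum_le_tsum fun n => ?_
          rw [coef_mul, convCoef, enorm_mul, ← ofReal_norm, Complex.norm_real, Real.norm_eq_abs,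
            abs_of_nonneg hκ]
          refine mul_le_mul_right (enorm_tsum_le_tsum_enorm.trans (le_of_eq ?_)) _
          simp only [enorm_mul]
      _ = _ := by
          have e : ∀ l, ∑' n, ‖coef u (n - l)‖ₑ * ‖coef v l‖ₑ
              = (∑' n, ‖coef u n‖ₑ) * ‖coef v l‖ₑ := fun l => by
            rw [ENNReal.tsum_mul_right, ← (Equiv.subRight l).tsum_eq fun n => ‖coef u n‖ₑ]
            rfl
          rw [ENNReal.tsum_mul_left, ENNReal.tsum_comm]
          simp only [e]
          rw [ENNReal.tsum_mul_left]
  rw [ofReal_wiener hk, ofReal_wiener hk, ofReal_wiener hk, ← ENNReal.ofReal_mul hn,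
    ← ENNReal.ofReal_mul hκ, ENNReal.ofReal_le_ofReal_iff (by positivity)] at h
  exact h

theorem memLp_mul (hk : 1 ≤ k) (u : Hper L k) (f : L2Q L) :
    MemLp (fun x => toL2 u x * f x) 2 (volQ L) := by
  refine (Lp.memLp f).of_le_mul (c := expoNorm L * wiener u)
    ((Lp.memLp (toL2 u)).1.mul (Lp.memLp f).1) ?_
  filter_upwards [ae_norm_le_wiener hk u] with x hx
  rw [norm_mul]
  gcongr

theorem toL2_mul (hk : 1 ≤ k) (u v : Hper L k) :
    toL2 (mul hk u v) =ᵐ[volQ L] fun x => toL2 u x * toL2 v x := by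
  have hm := memLp_mul hk u (toL2 v)
  have key : toL2 (mul hk u v) = hm.toLp _ := by
    refine L2Q.coef_ext fun n => ?_
    rw [← (L2Q.hasSum_coef_of_ae_eq_mul hm.coeFn_toLp n).tsum_eq, tsum_mul_left]
    exact coef_mul hk u v n
  rw [key]
  exact hm.coeFn_toLp

theorem norm_toL2_mul_le (hk : 1 ≤ k) (u v : Hper L k) :
    ‖toL2 (mul hk u v)‖ ≤ expoNorm L * wiener u * ‖toL2 v‖ := by
  refine Lp.norm_le_mul_norm_of_ae_le_mul ?_
  filter_upwards [ae_norm_le_wiener hk u, toL2_mul hk u v] with x hx h2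
  rw [h2, norm_mul]
  gcongr

theorem ext_ae {u v : Hper L k} (h : toL2 u =ᵐ[volQ L] toL2 v) : u = v :=
  toL2_injective (Lp.ext h)

/-- The product of `H^k_per(Q)`, `k ≥ 1`, as a bounded bilinear operator. -/
def mulCLM (hk : 1 ≤ k) : Hper L k →L[ℂ] Hper L k →L[ℂ] Hper L k :=
  LinearMap.mkContinuous₂
    (LinearMap.mk₂ ℂ (mul hk)
      (fun u v w => ext_ae (by
        filter_upwards [toL2_mul hk (u + v) w, toL2_add_ae u v, toL2_mul hk u w, toL2_mul hk v w,
          toL2_add_ae (mul hk u w) (mul hk v w)] with x h1 h2 h3 h4 h5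
        rw [h1, h2, h5, h3, h4, add_mul]))
      (fun c u v => ext_ae (by
        filter_upwards [toL2_mul hk (c • u) v, toL2_smul_ae c u, toL2_mul hk u v,
          toL2_smul_ae c (mul hk u v)] with x h1 h2 h3 h4
        rw [h1, h2, h4, h3, mul_assoc]))
      (fun u v w => ext_ae (by
        filter_upwards [toL2_mul hk u (v + w), toL2_add_ae v w, toL2_mul hk u v, toL2_mul hk u w,
          toL2_add_ae (mul hk u v) (mul hk u w)] with x h1 h2 h3 h4 h5
        rw [h1, h2, h5, h3, h4, mul_add]))
      (fun c u v => ext_ae (by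
        filter_upwards [toL2_mul hk u (c • v), toL2_smul_ae c v, toL2_mul hk u v,
          toL2_smul_ae c (mul hk u v)] with x h1 h2 h3 h4
        rw [h1, h2, h4, h3, mul_left_comm])))
    (2 * mulConst L k * √(8 * sobConst L)) fun u v => by
      have h1 := wiener_le hk u
      have h2 := wiener_le hk v
      have h3 := mulConst_nonneg (L := L) (k := k)
      calc ‖mul hk u v‖ ≤ mulConst L k * (wiener v * ‖u‖ + wiener u * ‖v‖) := norm_mul_le hk u v
        _ ≤ mulConst L k * (√(8 * sobConst L) * ‖v‖ * ‖u‖ + √(8 * sobConst L) * ‖u‖ * ‖v‖) := by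
          gcongr
        _ = _ := by ring

theorem mulCLM_apply (hk : 1 ≤ k) (u v : Hper L k) : mulCLM hk u v = mul hk u v := rfl

theorem incl_mul (hm : 1 ≤ m) (h : m ≤ k) (u v : Hper L k) :
    incl h (mul (hm.trans h) u v) = mul hm (incl h u) (incl h v) := by
  refine ext_ae ?_
  filter_upwards [toL2_mul (hm.trans h) u v, toL2_mul hm (incl h u) (incl h v)] with x h1 h2
  rw [h2, toL2_incl, h1, toL2_incl, toL2_incl]

/-- The product rule. -/
theorem dx_one_mul (hk : 1 ≤ k) (u v : Hper L k) :
    dx (mul hk u v) 1 hk =ᵐ[volQ L]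
      fun x => dx u 1 hk x * toL2 v x + toL2 u x * dx v 1 hk x := by
  have hm1 := memLp_mul hk v (dx u 1 hk)
  have hm2 := memLp_mul hk u (dx v 1 hk)
  have e1 : hm1.toLp _ =ᵐ[volQ L] fun x => dx u 1 hk x * toL2 v x := by
    filter_upwards [hm1.coeFn_toLp] with x hx
    rw [hx, mul_comm]
  have key : dx (mul hk u v) 1 hk = hm1.toLp _ + hm2.toLp _ := by
    refine L2Q.coef_ext fun n => ?_
    have h1 := L2Q.hasSum_coef_of_ae_eq_mul e1 n
    have h2 := L2Q.hasSum_coef_of_ae_eq_mul hm2.coeFn_toLp n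
    have h3 := L2Q.hasSum_coef_of_ae_eq_mul (toL2_mul hk u v) n
    rw [L2Q.coef_add, coef_dx, pow_one]
    refine (h3.mul_left _).unique ?_
    convert! h1.add h2 using 2 with l
    rw [coef_dx, coef_dx, coef, coef, L2Q.freq_sub]
    push_cast
    ring
  rw [key]
  filter_upwards [Lp.coeFn_add (hm1.toLp _) (hm2.toLp _), e1, hm2.coeFn_toLp] with x h1 h2 h3
  rw [h1, Pi.add_apply, h2, h3]

/-- Complex conjugation on `H^k_per(Q)`. -/
def conjH (u : Hper L k) : Hper L k :=
  ofCoef (fun n => conj (coef u (-n))) (by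
    have h := (Equiv.neg ℤ).summable_iff.2 (hasSum_norm_sq u).summable
    refine h.congr fun n => ?_
    simp [weight_neg])

theorem coef_conjH (u : Hper L k) (n : ℤ) : coef (conjH u) n = conj (coef u (-n)) :=
  coef_ofCoef _ _ n

theorem wiener_conjH (u : Hper L k) : wiener (conjH u) = wiener u := by
  rw [wiener, wiener, ← (Equiv.neg ℤ).tsum_eq fun n => ‖coef u n‖]
  simp [coef_conjH]

theorem norm_conjH (u : Hper L k) : ‖conjH u‖ = ‖u‖ := by
  have h := (hasSum_norm_sq u)
  rw [← (Equiv.neg ℤ).hasSum_iff] at h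
  have h2 := (hasSum_norm_sq (conjH u)).unique (a₁ := ‖conjH u‖ ^ 2) (a₂ := ‖u‖ ^ 2) (by
    convert! h using 2 with n
    simp [coef_conjH, weight_neg])
  rwa [sq_eq_sq₀ (norm_nonneg _) (norm_nonneg _)] at h2

theorem coef_conj_ae {f g : L2Q L} (h : g =ᵐ[volQ L] fun x => conj (f x)) (n : ℤ) :
    L2Q.coef g n = conj (L2Q.coef f (-n)) := by
  rw [L2Q.coef_eq, L2Q.coef_eq, map_mul, Complex.conj_ofReal, ← integral_conj]
  congr 1
  refine integral_congr_ae ?_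
  filter_upwards [h] with x hx
  rw [hx, map_mul, L2Q.conj_expo, neg_neg]

theorem dx_conjH (u : Hper L k) (j : ℕ) (hj : j ≤ k) :
    dx (conjH u) j hj =ᵐ[volQ L] fun x => conj (dx u j hj x) := by
  have hm : MemLp (fun x => conj (dx u j hj x)) 2 (volQ L) := (Lp.memLp (dx u j hj)).star
  have key : dx (conjH u) j hj = hm.toLp _ := by
    refine L2Q.coef_ext fun n => ?_
    rw [coef_conj_ae hm.coeFn_toLp, coef_dx, coef_dx, coef_conjH, L2Q.freq_neg]
    simp
  rw [key]
  exact hm.coeFn_toLp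

theorem toL2_conjH (u : Hper L k) : toL2 (conjH u) =ᵐ[volQ L] fun x => conj (toL2 u x) :=
  dx_conjH u 0 (Nat.zero_le k)

theorem conjH_sub (u v : Hper L k) : conjH (u - v) = conjH u - conjH v :=
  ext_coef fun n => by simp [coef_conjH, coef_sub]

theorem norm_toL2_conjH (u : Hper L k) : ‖toL2 (conjH u)‖ = ‖toL2 u‖ := by
  refine le_antisymm (Lp.norm_le_norm_of_ae_le ?_) (Lp.norm_le_norm_of_ae_le ?_) <;>
  · filter_upwards [toL2_conjH u] with x hx
    rw [hx, RCLike.norm_conj]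

theorem continuous_conjH : Continuous (conjH : Hper L k → Hper L k) := by
  refine (LipschitzWith.of_dist_le_mul (K := 1) fun u v => ?_).continuous
  rw [dist_eq_norm, dist_eq_norm, ← conjH_sub, norm_conjH, NNReal.coe_one, one_mul]

/-- The cubic nonlinearity `u ↦ |u|²u` on `H^k_per(Q)`, `k ≥ 1`. -/
def cub (hk : 1 ≤ k) (u : Hper L k) : Hper L k := mul hk (mul hk u (conjH u)) u

theorem toL2_mul_conjH (hk : 1 ≤ k) (u : Hper L k) :
    toL2 (mul hk u (conjH u)) =ᵐ[volQ L] fun x => (‖toL2 u x‖ : ℂ) ^ 2 := by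
  filter_upwards [toL2_mul hk u (conjH u), toL2_conjH u] with x h1 h2
  rw [h1, h2, Complex.mul_conj, Complex.normSq_eq_norm_sq]
  push_cast
  rfl

theorem toL2_cub (hk : 1 ≤ k) (u : Hper L k) :
    toL2 (cub hk u) =ᵐ[volQ L] fun x => (‖toL2 u x‖ : ℂ) ^ 2 * toL2 u x := by
  filter_upwards [toL2_mul hk (mul hk u (conjH u)) u, toL2_mul_conjH hk u] with x h1 h2
  rw [cub, h1, h2]

theorem continuous_cub (hk : 1 ≤ k) : Continuous (cub hk : Hper L k → Hper L k) := by
  have h : Continuous fun u : Hper L k => mulCLM hk (mulCLM hk u (conjH u)) u := by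
    have := continuous_conjH (L := L) (k := k)
    fun_prop
  exact h

theorem incl_conjH (h : m ≤ k) (u : Hper L k) : incl h (conjH u) = conjH (incl h u) :=
  ext_coef fun n => by rw [coef_incl, coef_conjH, coef_conjH, coef_incl]

theorem incl_cub (hm : 1 ≤ m) (h : m ≤ k) (u : Hper L k) :
    incl h (cub (hm.trans h) u) = cub hm (incl h u) := by
  rw [cub, cub, incl_mul, incl_mul, incl_conjH]

/-- The tame estimate of the cubic nonlinearity: it is linear in the norm of `H^k`, with a factor
that only involves the Wiener norm. -/
theorem norm_cub_le (hk : 1 ≤ k) (u : Hper L k) :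
    ‖cub hk u‖ ≤ cubConst L k * wiener u ^ 2 * ‖u‖ := by
  have hM := mulConst_nonneg (L := L) (k := k)
  have hw := wiener_nonneg u
  have h1 : ‖mul hk u (conjH u)‖ ≤ 2 * mulConst L k * wiener u * ‖u‖ := by
    refine (norm_mul_le hk u (conjH u)).trans (le_of_eq ?_)
    rw [wiener_conjH, norm_conjH]
    ring
  have h2 : wiener (mul hk u (conjH u)) ≤ expoNorm L * wiener u ^ 2 := by
    refine (wiener_mul_le hk u (conjH u)).trans (le_of_eq ?_)
    rw [wiener_conjH]
    ring
  calc ‖cub hk u‖ ≤ mulConst L k * (wiener u * ‖mul hk u (conjH u)‖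
        + wiener (mul hk u (conjH u)) * ‖u‖) := norm_mul_le hk _ u
    _ ≤ mulConst L k * (wiener u * (2 * mulConst L k * wiener u * ‖u‖)
        + expoNorm L * wiener u ^ 2 * ‖u‖) := by gcongr
    _ = _ := by unfold cubConst; ring

/-- `|u|²u - |v|²v = |u|²(u - v) + vū(u - v) + v²(ū - v̄)`. -/
theorem cub_sub_cub (hk : 1 ≤ k) (u v : Hper L k) :
    cub hk u - cub hk v = mul hk (mul hk u (conjH u)) (u - v)
      + mul hk (mul hk v (conjH u)) (u - v) + mul hk (mul hk v v) (conjH (u - v)) := by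
  refine ext_ae ?_
  filter_upwards [toL2_sub_ae (cub hk u) (cub hk v), toL2_cub hk u, toL2_cub hk v,
    toL2_add_ae (mul hk (mul hk u (conjH u)) (u - v) + mul hk (mul hk v (conjH u)) (u - v))
      (mul hk (mul hk v v) (conjH (u - v))),
    toL2_add_ae (mul hk (mul hk u (conjH u)) (u - v)) (mul hk (mul hk v (conjH u)) (u - v)),
    toL2_mul hk (mul hk u (conjH u)) (u - v), toL2_mul hk (mul hk v (conjH u)) (u - v),
    toL2_mul hk (mul hk v v) (conjH (u - v)), toL2_mul hk u (conjH u), toL2_mul hk v (conjH u),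
    toL2_mul hk v v, toL2_conjH u, toL2_conjH (u - v), toL2_sub_ae u v]
    with x h1 h2 h3 h4 h5 h6 h7 h8 h9 h10 h11 h12 h13 h14
  rw [h1, h2, h3, h4, h5, h6, h7, h8, h9, h10, h11, h12, h13, h14]
  have e : ∀ z : ℂ, (‖z‖ : ℂ) ^ 2 = z * conj z := fun z => by
    rw [Complex.mul_conj, Complex.normSq_eq_norm_sq]; push_cast; rfl
  rw [e, e, map_sub]
  ring

theorem norm_toL2_cub_sub_le (hk : 1 ≤ k) (u v : Hper L k) {W : ℝ} (hu : wiener u ≤ W)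
    (hv : wiener v ≤ W) :
    ‖toL2 (cub hk u) - toL2 (cub hk v)‖ ≤ 3 * (expoNorm L * W) ^ 2 * ‖toL2 u - toL2 v‖ := by
  have hκ := expoNorm_nonneg (L := L)
  have hu0 := wiener_nonneg u
  have hv0 := wiener_nonneg v
  have hW : 0 ≤ W := hu0.trans hu
  have key : ∀ a b c : Hper L k, wiener a ≤ W → wiener b ≤ W →
      ‖toL2 (mul hk (mul hk a b) c)‖ ≤ (expoNorm L * W) ^ 2 * ‖toL2 c‖ := fun a b c ha hb => by
    have ha0 := wiener_nonneg a
    have hb0 := wiener_nonneg b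
    calc _ ≤ expoNorm L * wiener (mul hk a b) * ‖toL2 c‖ := norm_toL2_mul_le hk _ _
      _ ≤ expoNorm L * (expoNorm L * (wiener a * wiener b)) * ‖toL2 c‖ := by
        gcongr
        exact wiener_mul_le hk a b
      _ ≤ expoNorm L * (expoNorm L * (W * W)) * ‖toL2 c‖ := by gcongr
      _ = _ := by ring
  rw [← map_sub, ← map_sub, cub_sub_cub, map_add, map_add]
  have h1 := key u (conjH u) (u - v) hu (by rwa [wiener_conjH])
  have h2 := key v (conjH u) (u - v) hv (by rwa [wiener_conjH])
  have h3 := key v v (conjH (u - v)) hv hv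
  rw [norm_toL2_conjH] at h3
  refine (norm_add₃_le).trans ?_
  linarith

/-- The cubic nonlinearity is Lipschitz on bounded sets of `H^k`. -/
theorem exists_norm_cub_sub_le (hk : 1 ≤ k) (R : ℝ) (hR : 0 ≤ R) : ∃ K : ℝ, 0 ≤ K ∧
    ∀ u v : Hper L k, ‖u‖ ≤ R → ‖v‖ ≤ R → ‖cub hk u - cub hk v‖ ≤ K * ‖u - v‖ := by
  set M := ‖mulCLM (L := L) hk‖
  have hM : ∀ u v : Hper L k, ‖mul hk u v‖ ≤ M * ‖u‖ * ‖v‖ := fun u v =>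
    (mulCLM hk).le_opNorm₂ u v
  have hM0 : 0 ≤ M := norm_nonneg _
  have key : ∀ a b c : Hper L k, ‖a‖ ≤ R → ‖b‖ ≤ R →
      ‖mul hk (mul hk a b) c‖ ≤ M * (M * R * R) * ‖c‖ := fun a b c ha hb => by
    calc _ ≤ M * ‖mul hk a b‖ * ‖c‖ := hM _ _
      _ ≤ M * (M * ‖a‖ * ‖b‖) * ‖c‖ := by
        gcongr
        exact hM _ _
      _ ≤ _ := by gcongr
  refine ⟨3 * (M * (M * R * R)), by positivity, fun u v hu hv => ?_⟩
  rw [cub_sub_cub]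
  have h1 := key u (conjH u) (u - v) hu (by rwa [norm_conjH])
  have h2 := key v (conjH u) (u - v) hv (by rwa [norm_conjH])
  have h3 := key v v (conjH (u - v)) hv hv
  rw [norm_conjH] at h3
  refine (norm_add₃_le).trans ?_
  linarith

end Hper

/-! ### The free Schrödinger group -/

namespace Hper

open L2Q (freq expo)

variable {L : ℝ} {k m : ℕ}

/-- The Fourier multiplier `e^{-iω²t/2}`, `ω = πn/L`, of the free Schrödinger group. -/
def phase (L : ℝ) (n : ℤ) (t : ℝ) : ℂ := Complex.exp (Complex.I * ((-(freq L n ^ 2 / 2) * t : ℝ) : ℂ))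

theorem norm_phase (n : ℤ) (t : ℝ) : ‖phase L n t‖ = 1 := by
  rw [phase, mul_comm, Complex.norm_exp_ofReal_mul_I]

theorem phase_zero (n : ℤ) : phase L n 0 = 1 := by simp [phase]

theorem phase_add (n : ℤ) (s t : ℝ) : phase L n (s + t) = phase L n s * phase L n t := by
  rw [phase, phase, phase, ← Complex.exp_add]
  congr 1
  push_cast
  ring

theorem hasDerivAt_phase (n : ℤ) (t : ℝ) :
    HasDerivAt (phase L n) (-(Complex.I * (freq L n ^ 2 / 2 : ℝ)) * phase L n t) t := by
  have h : HasDerivAt (fun s : ℝ => Complex.I * ((-(freq L n ^ 2 / 2) * s : ℝ) : ℂ))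
      (-(Complex.I * (freq L n ^ 2 / 2 : ℝ))) t := by
    have h2 := (Complex.ofRealCLM.hasDerivAt (x := t)).const_mul
      (-(Complex.I * ((freq L n ^ 2 / 2 : ℝ) : ℂ)))
    simp only [Complex.ofRealCLM_apply, Complex.ofReal_one, mul_one] at h2
    convert! h2 using 2 with s
    push_cast
    ring
  have h' := h.cexp
  rwa [mul_comm (Complex.exp _)] at h'

theorem norm_phase_sub_le (n : ℤ) (s t : ℝ) :
    ‖phase L n s - phase L n t‖ ≤ freq L n ^ 2 / 2 * |s - t| := by
  have h : phase L n s - phase L n t = phase L n t * (phase L n (s - t) - 1) := by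
    rw [mul_sub, ← phase_add, mul_one, add_sub_cancel]
  rw [h, norm_mul, norm_phase, one_mul, phase]
  refine (Real.norm_exp_I_mul_ofReal_sub_one_le).trans (le_of_eq ?_)
  rw [Real.norm_eq_abs, abs_mul, abs_neg, abs_of_nonneg (by positivity)]

/-- The second derivative as an operator `H^k_per(Q) → H^{k-2}_per(Q)`. -/
def dxx (hk : 2 ≤ k) (u : Hper L k) : Hper L (k - 2) :=
  ⟨WithLp.toLp 2 fun j => u.1 ⟨j + 2, by omega⟩, fun j => u.2 ⟨j + 2, by omega⟩⟩

theorem toL2_dxx (hk : 2 ≤ k) (u : Hper L k) : toL2 (dxx hk u) = dx u 2 hk := rfl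

theorem weight_sub_two_mul_le (hk : 2 ≤ k) (n : ℤ) :
    weight L (k - 2) n * freq L n ^ 4 ≤ weight L k n := by
  obtain ⟨j, rfl⟩ := Nat.exists_eq_add_of_le' hk
  simp only [Nat.add_sub_cancel]
  rw [weight, weight, Finset.sum_mul, Finset.sum_range_succ' _ (j + 2),
    Finset.sum_range_succ' _ (j + 1)]
  have : ∀ i, freq L n ^ (2 * i) * freq L n ^ 4 = freq L n ^ (2 * (i + 1 + 1)) := fun i => by ring
  simp only [this]
  have h1 : 0 ≤ freq L n ^ (2 * (0 + 1)) := (even_two_mul _).pow_nonneg _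
  have h2 : 0 ≤ freq L n ^ (2 * 0) := (even_two_mul _).pow_nonneg _
  linarith

variable [hL : Fact (0 < L)]

/-- Convergence in `H^k_per(Q)` by dominated convergence of the Fourier coefficients. -/
theorem tendsto_zero_of_coef {α : Type*} {l : Filter α} {f : α → Hper L k} {b : ℤ → ℝ}
    (hb : Summable b) (hle : ∀ᶠ a in l, ∀ n, weight L k n * ‖coef (f a) n‖ ^ 2 ≤ b n)
    (hlim : ∀ n, Tendsto (fun a => coef (f a) n) l (𝓝 0)) : Tendsto f l (𝓝 0) := by
  have h := tendsto_tsum_of_dominated_convergence (𝓕 := l)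
    (f := fun a n => weight L k n * ‖coef (f a) n‖ ^ 2) (g := fun _ => (0 : ℝ)) hb
    (fun n => by simpa using ((hlim n).norm.pow 2).const_mul (weight L k n))
    (hle.mono fun a ha n => by
      rw [Real.norm_of_nonneg (mul_nonneg (weight_nonneg n) (by positivity))]
      exact ha n)
  simp only [(hasSum_norm_sq _).tsum_eq, tsum_zero] at h
  rw [tendsto_zero_iff_norm_tendsto_zero]
  have h2 := h.sqrt
  simpa [Real.sqrt_sq] using h2

/-- The free Schrödinger group `e^{it∂ₓ²/2}` on `H^k_per(Q)`. -/
def grp (t : ℝ) (u : Hper L k) : Hper L k :=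
  ofCoef (fun n => phase L n t * coef u n) (by
    simpa [norm_mul, norm_phase] using (hasSum_norm_sq u).summable)

theorem coef_grp (t : ℝ) (u : Hper L k) (n : ℤ) : coef (grp t u) n = phase L n t * coef u n :=
  coef_ofCoef _ _ n

theorem norm_grp (t : ℝ) (u : Hper L k) : ‖grp t u‖ = ‖u‖ := by
  have h := (hasSum_norm_sq (grp t u)).unique (a₁ := ‖grp t u‖ ^ 2) (a₂ := ‖u‖ ^ 2) (by
    simpa [coef_grp, norm_mul, norm_phase] using hasSum_norm_sq u)
  rwa [sq_eq_sq₀ (norm_nonneg _) (norm_nonneg _)] at h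

theorem wiener_grp (t : ℝ) (u : Hper L k) : wiener (grp t u) = wiener u := by
  simp [wiener, coef_grp, norm_phase]

theorem grp_zero (u : Hper L k) : grp 0 u = u :=
  ext_coef fun n => by rw [coef_grp, phase_zero, one_mul]

theorem grp_grp (s t : ℝ) (u : Hper L k) : grp s (grp t u) = grp (s + t) u :=
  ext_coef fun n => by rw [coef_grp, coef_grp, coef_grp, phase_add, mul_assoc]

theorem grp_neg_grp (t : ℝ) (u : Hper L k) : grp t (grp (-t) u) = u := by
  rw [grp_grp, add_neg_cancel, grp_zero]

theorem grp_add (t : ℝ) (u v : Hper L k) : grp t (u + v) = grp t u + grp t v :=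
  ext_coef fun n => by rw [coef_add, coef_grp, coef_grp, coef_grp, coef_add, mul_add]

theorem grp_sub (t : ℝ) (u v : Hper L k) : grp t (u - v) = grp t u - grp t v :=
  ext_coef fun n => by rw [coef_sub, coef_grp, coef_grp, coef_grp, coef_sub, mul_sub]

theorem grp_smul (t : ℝ) (c : ℂ) (u : Hper L k) : grp t (c • u) = c • grp t u :=
  ext_coef fun n => by rw [coef_smul, coef_grp, coef_grp, coef_smul, mul_left_comm]

theorem continuous_grp_left (u : Hper L k) : Continuous fun t => grp t u := by
  refine continuous_iff_continuousAt.2 fun t => ?_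
  rw [ContinuousAt, ← tendsto_sub_nhds_zero_iff]
  refine tendsto_zero_of_coef ((hasSum_norm_sq u).summable.mul_left 4)
    (Eventually.of_forall fun s n => ?_) fun n => ?_
  · rw [coef_sub, coef_grp, coef_grp, ← sub_mul, norm_mul, mul_pow]
    have h : ‖phase L n s - phase L n t‖ ≤ 2 := by
      refine (norm_sub_le _ _).trans ?_
      rw [norm_phase, norm_phase]
      norm_num
    have h2 : ‖phase L n s - phase L n t‖ ^ 2 ≤ 4 := by
      nlinarith [norm_nonneg (phase L n s - phase L n t)]
    have h3 := mul_nonneg (weight_nonneg (L := L) (k := k) n) (sq_nonneg ‖coef u n‖)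
    nlinarith
  · simp only [coef_sub, coef_grp, ← sub_mul]
    have h := ((hasDerivAt_phase (L := L) n t).continuousAt.tendsto.sub_const
      (phase L n t)).mul_const (coef u n)
    simpa using h

theorem tendsto_grp {α : Type*} {l : Filter α} {τ : α → ℝ} {f : α → Hper L k} {t : ℝ}
    {u : Hper L k} (hτ : Tendsto τ l (𝓝 t)) (hf : Tendsto f l (𝓝 u)) :
    Tendsto (fun a => grp (τ a) (f a)) l (𝓝 (grp t u)) := by
  have h1 : Tendsto (fun a => grp (τ a) u) l (𝓝 (grp t u)) :=
    ((continuous_grp_left u).tendsto t).comp hτ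
  have h2 : Tendsto (fun a => grp (τ a) (f a - u)) l (𝓝 0) := by
    rw [tendsto_zero_iff_norm_tendsto_zero]
    simp only [norm_grp]
    rw [← tendsto_zero_iff_norm_tendsto_zero]
    exact tendsto_sub_nhds_zero_iff.2 hf
  simpa [grp_sub] using h1.add h2

theorem coef_dxx (hk : 2 ≤ k) (u : Hper L k) (n : ℤ) :
    coef (dxx hk u) n = -(freq L n : ℂ) ^ 2 * coef u n := by
  rw [coef, toL2_dxx, coef_dx, mul_pow, Complex.I_sq, neg_one_mul]

theorem norm_dxx_le (hk : 2 ≤ k) (u : Hper L k) : ‖dxx hk u‖ ≤ ‖u‖ := by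
  refine (abs_le_of_sq_le_sq' ?_ (norm_nonneg _)).2
  refine hasSum_le (fun n => ?_) (hasSum_norm_sq (dxx hk u)) (hasSum_norm_sq u)
  rw [coef_dxx, norm_mul, norm_neg, norm_pow, Complex.norm_real, mul_pow, Real.norm_eq_abs,
    sq_abs, ← pow_mul, ← mul_assoc]
  exact mul_le_mul_of_nonneg_right (weight_sub_two_mul_le hk n) (by positivity)

theorem continuous_dxx (hk : 2 ≤ k) : Continuous (dxx hk : Hper L k → Hper L (k - 2)) := by
  refine (LipschitzWith.of_dist_le_mul (K := 1) fun u v => ?_).continuous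
  have h : dxx hk u - dxx hk v = dxx hk (u - v) :=
    ext_coef fun n => by rw [coef_sub, coef_dxx, coef_dxx, coef_dxx, coef_sub, mul_sub]
  rw [dist_eq_norm, dist_eq_norm, h, NNReal.coe_one, one_mul]
  exact norm_dxx_le hk _

/-- The free evolution is differentiable with values in `H^{k-2}`. -/
theorem hasDerivAt_grp (hk : 2 ≤ k) (u : Hper L k) (t : ℝ) :
    HasDerivAt (fun s => incl (Nat.sub_le k 2) (grp s u))
      ((Complex.I / 2) • dxx hk (grp t u)) t := by
  rw [hasDerivAt_iff_tendsto_slope, ← tendsto_sub_nhds_zero_iff]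
  have hc : ∀ s n, coef (slope (fun s => incl (Nat.sub_le k 2) (grp s u)) t s
      - (Complex.I / 2) • dxx hk (grp t u)) n = (((s - t)⁻¹ : ℝ) * (phase L n s - phase L n t)
        - (-(Complex.I * (freq L n ^ 2 / 2 : ℝ)) * phase L n t)) * coef u n := fun s n => by
    rw [coef_sub, coef_smul, coef_dxx, coef_grp, slope_def_module, ← Complex.coe_smul, coef_smul,
      coef_sub, coef_incl, coef_incl, coef_grp, coef_grp]
    push_cast
    ring
  refine tendsto_zero_of_coef (hasSum_norm_sq u).summable ?_ fun n => ?_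
  · filter_upwards [self_mem_nhdsWithin] with s hs n
    have hs' : s - t ≠ 0 := sub_ne_zero.2 hs
    have h1 : ‖(((s - t)⁻¹ : ℝ) : ℂ) * (phase L n s - phase L n t)‖ ≤ freq L n ^ 2 / 2 := by
      rw [norm_mul, Complex.norm_real, norm_inv, Real.norm_eq_abs, inv_mul_le_iff₀ (by positivity),
        mul_comm]
      exact norm_phase_sub_le n s t
    have h2 : ‖-(Complex.I * ((freq L n ^ 2 / 2 : ℝ) : ℂ)) * phase L n t‖ = freq L n ^ 2 / 2 := by
      rw [norm_mul, norm_neg, norm_mul, norm_phase, Complex.norm_I, Complex.norm_real,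
        Real.norm_of_nonneg (by positivity)]
      ring
    have h3 := (norm_sub_le (((s - t)⁻¹ : ℝ) * (phase L n s - phase L n t))
        (-(Complex.I * (freq L n ^ 2 / 2 : ℝ)) * phase L n t)).trans (add_le_add h1 h2.le)
    rw [add_halves] at h3
    rw [hc, norm_mul, mul_pow, ← mul_assoc]
    refine mul_le_mul_of_nonneg_right (le_trans ?_ (weight_sub_two_mul_le hk n)) (by positivity)
    refine mul_le_mul_of_nonneg_left ?_ (weight_nonneg n)
    calc _ ≤ (freq L n ^ 2) ^ 2 := by gcongr
      _ = _ := by ring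
  · simp only [hc]
    have h := (hasDerivAt_iff_tendsto_slope.1 (hasDerivAt_phase (L := L) n t))
    rw [← tendsto_sub_nhds_zero_iff] at h
    simpa [slope_def_module] using h.mul_const (coef u n)

/-- Variation of constants: if `v` is differentiable with values in `H^k`, then `e^{it∂ₓ²/2}v(t)`
is differentiable with values in `H^{k-2}`. -/
theorem hasDerivWithinAt_grp (hk : 2 ≤ k) {v : ℝ → Hper L k} {v' : Hper L k} {s : Set ℝ} {t : ℝ}
    (hv : HasDerivWithinAt v v' s t) :
    HasDerivWithinAt (fun r => incl (Nat.sub_le k 2) (grp r (v r)))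
      ((Complex.I / 2) • dxx hk (grp t (v t)) + incl (Nat.sub_le k 2) (grp t v')) s t := by
  have h1 := (hasDerivAt_grp hk (v t) t).hasDerivWithinAt (s := s)
  have h2 : HasDerivWithinAt (fun r => incl (Nat.sub_le k 2) (grp r (v r - v t)))
      (incl (Nat.sub_le k 2) (grp t v')) s t := by
    rw [hasDerivWithinAt_iff_tendsto_slope] at hv ⊢
    have h3 : Tendsto (fun r => inclCLM (Nat.sub_le k 2) (grp r (slope v t r))) (𝓝[s \ {t}] t)
        (𝓝 (inclCLM (Nat.sub_le k 2) (grp t v'))) :=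
      ((inclCLM (Nat.sub_le k 2)).continuous.tendsto _).comp
        (tendsto_grp (tendsto_nhdsWithin_of_tendsto_nhds tendsto_id) hv)
    refine h3.congr fun r => ?_
    rw [slope_def_module, slope_def_module, sub_self, inclCLM_apply]
    have h4 : grp t (0 : Hper L k) = 0 := by
      simpa using grp_smul t 0 (0 : Hper L k)
    have h5 : incl (Nat.sub_le k 2) (0 : Hper L k) = 0 := (inclCLM (Nat.sub_le k 2)).map_zero
    rw [h4, h5, sub_zero, ← Complex.coe_smul, ← Complex.coe_smul, grp_smul, incl_smul]
  refine (h1.add h2).congr_of_eventuallyEq (Eventually.of_forall fun r => ?_) ?_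
  · change _ = incl (Nat.sub_le k 2) (grp r (v t)) + incl (Nat.sub_le k 2) (grp r (v r - v t))
    rw [← incl_add, ← grp_add, add_sub_cancel]
  · change _ = incl (Nat.sub_le k 2) (grp t (v t)) + incl (Nat.sub_le k 2) (grp t (v t - v t))
    rw [← incl_add, ← grp_add, add_sub_cancel]

end Hper

/-! ### Mass and energy laws -/

/-- Differentiation of a functional whose increments along a curve `w` are `Re ⟨w(r) - w(t), G(r)⟩`
with `G` continuous at `t`. The functional need not be defined on all of `E`: the energy below is
differentiated along curves that are differentiable only in `L²(Q)`. -/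
theorem hasDerivWithinAt_of_sub_eq_re_inner {E : Type*} [NormedAddCommGroup E]
    [InnerProductSpace ℂ E] [NormedSpace ℝ E] [IsScalarTower ℝ ℂ E] {w : ℝ → E} {w' : E}
    {P : ℝ → ℝ} {G : ℝ → E} {s : Set ℝ} {t : ℝ} (hw : HasDerivWithinAt w w' s t)
    (hG : ContinuousWithinAt G s t)
    (hP : ∀ r ∈ s, P r - P t = (⟪w r - w t, G r⟫_ℂ).re) :
    HasDerivWithinAt P (⟪w', G t⟫_ℂ).re s t := by
  rw [hasDerivWithinAt_iff_tendsto_slope] at hw ⊢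
  have hG' : Tendsto G (𝓝[s \ {t}] t) (𝓝 (G t)) := hG.mono_left (nhdsWithin_mono t sdiff_subset)
  refine (Complex.continuous_re.tendsto _).comp (hw.inner hG') |>.congr' ?_
  filter_upwards [self_mem_nhdsWithin] with r hr
  simp only [Function.comp_apply]
  rw [slope_def_module, slope_def_field, hP r hr.1, ← algebraMap_smul ℂ ((r - t)⁻¹),
    inner_smul_left, Complex.coe_algebraMap, Complex.conj_ofReal, Complex.re_ofReal_mul,
    div_eq_inv_mul]

theorem norm_sq_sub_norm_sq {E : Type*} [NormedAddCommGroup E] [InnerProductSpace ℂ E] (a b : E) :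
    ‖a‖ ^ 2 - ‖b‖ ^ 2 = (⟪a - b, a + b⟫_ℂ).re := by
  have h : (⟪a, b⟫_ℂ).re = (⟪b, a⟫_ℂ).re := inner_re_symm (𝕜 := ℂ) a b
  rw [inner_sub_left, inner_add_right, inner_add_right, inner_self_eq_norm_sq_to_K,
    inner_self_eq_norm_sq_to_K]
  simp [← Complex.ofReal_pow]
  linarith

theorem conj_I_div_two : conj (Complex.I / 2) = ((-1 / 2 : ℝ) : ℂ) * Complex.I := by
  rw [map_div₀, Complex.conj_I, map_ofNat]
  push_cast
  ring

theorem le_gronwallBound_of_hasDerivWithinAt {f f' : ℝ → ℝ} {d K ε τ : ℝ}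
    (hf : ∀ t ∈ Icc 0 τ, HasDerivWithinAt f (f' t) (Icc 0 τ) t) (h0 : f 0 ≤ d)
    (hb : ∀ t ∈ Icc 0 τ, f' t ≤ K * f t + ε) : ∀ t ∈ Icc 0 τ, f t ≤ gronwallBound d K ε t := by
  intro t ht
  have h := le_gronwallBound_of_liminf_deriv_right_le (f := f) (f' := f') (a := 0) (b := τ)
    (fun x hx => (hf x hx).continuousWithinAt) (fun x hx r hr => ?_) h0
    (fun x hx => hb x (Ico_subset_Icc_self hx)) t ht
  · simpa using h
  · have h2 : HasDerivWithinAt f (f' x) (Ici x) x := by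
      refine (hf x (Ico_subset_Icc_self hx)).mono_of_mem_nhdsWithin ?_
      exact mem_of_superset (Icc_mem_nhdsGE hx.2) (Icc_subset_Icc_left hx.1)
    have h3 := h2.liminf_right_slope_le hr
    simpa [slope_def_field, div_eq_inv_mul] using h3

namespace L2Q

variable {L : ℝ}

theorem re_inner_eq (f g : L2Q L) :
    (⟪f, g⟫_ℂ).re = ∫ x, (g x * conj (f x)).re ∂(volQ L) := by
  have h := L2.integrable_inner (𝕜 := ℂ) f g
  simp only [RCLike.inner_apply] at h
  rw [L2.inner_def]
  exact (integral_re h).symm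

theorem norm_sq_eq_integral (f : L2Q L) : ‖f‖ ^ 2 = ∫ x, ‖f x‖ ^ 2 ∂(volQ L) := by
  have h := re_inner_eq f f
  rw [inner_self_eq_norm_sq_to_K] at h
  have e : (((‖f‖ : ℝ) : ℂ) ^ 2).re = ‖f‖ ^ 2 := by norm_cast
  refine e.symm.trans (h.trans (integral_congr_ae (Eventually.of_forall fun x => ?_)))
  simp only
  rw [Complex.mul_conj, Complex.ofReal_re, Complex.normSq_eq_norm_sq]

end L2Q

namespace Hper

open L2Q (freq expo)

variable {L : ℝ} [hL : Fact (0 < L)]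

/-- The quartic functional `∫ |u|⁴`, as the square of the `L²` norm of `|u|² = uū`. -/
def quart (u : Hper L 2) : ℝ := ‖toL2 (mul one_le_two u (conjH u))‖ ^ 2

theorem quart_nonneg (u : Hper L 2) : 0 ≤ quart u := sq_nonneg _

theorem quart_le (u : Hper L 2) : quart u ≤ (expoNorm L * wiener u) ^ 2 * ‖toL2 u‖ ^ 2 := by
  have h := norm_toL2_mul_le one_le_two u (conjH u)
  rw [norm_toL2_conjH] at h
  rw [quart, ← mul_pow]
  gcongr

theorem norm_toL2_cub_le (u : Hper L 2) :
    ‖toL2 (cub one_le_two u)‖ ^ 2 ≤ (expoNorm L * wiener u) ^ 4 * ‖toL2 u‖ ^ 2 := by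
  have hw := wiener_nonneg u
  have hκ := expoNorm_nonneg (L := L)
  have h : ‖toL2 (cub one_le_two u)‖ ≤ (expoNorm L * wiener u) ^ 2 * ‖toL2 u‖ := by
    refine (norm_toL2_mul_le one_le_two _ u).trans ?_
    have h2 := wiener_mul_le one_le_two u (conjH u)
    rw [wiener_conjH] at h2
    calc expoNorm L * wiener (mul one_le_two u (conjH u)) * ‖toL2 u‖
        ≤ expoNorm L * (expoNorm L * (wiener u * wiener u)) * ‖toL2 u‖ := by gcongr
      _ = _ := by ring
  calc ‖toL2 (cub one_le_two u)‖ ^ 2 ≤ ((expoNorm L * wiener u) ^ 2 * ‖toL2 u‖) ^ 2 := by gcongr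
    _ = _ := by ring

/-- The Cauchy–Schwarz inequality between `∫ |u|²` and `∫ |u|⁴`. -/
theorem norm_pow_four_le_quart (u : Hper L 2) : (‖toL2 u‖ ^ 2) ^ 2 ≤ 2 * L * quart u := by
  have hL0 := hL.out
  set p := toL2 (mul one_le_two u (conjH u)) with hp
  have h1 : L2Q.coef p 0 = (expoNorm L : ℂ) * ((‖toL2 u‖ ^ 2 : ℝ) : ℂ) := by
    rw [L2Q.coef_eq, L2Q.norm_sq_eq_integral, ← integral_complex_ofReal]
    change (expoNorm L : ℂ) * _ = _
    congr 1
    refine integral_congr_ae ?_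
    filter_upwards [toL2_mul_conjH one_le_two u] with x hx
    rw [hx, neg_zero, L2Q.expo_zero, mul_one]
    push_cast
    rfl
  have h2 := le_hasSum (L2Q.hasSum_norm_sq p) 0 fun n _ => by positivity
  rw [h1, norm_mul, Complex.norm_real, Complex.norm_real, mul_pow, Real.norm_eq_abs, sq_abs,
    Real.norm_eq_abs, sq_abs] at h2
  have h3 := expoNorm_sq (L := L)
  calc (‖toL2 u‖ ^ 2) ^ 2 = 2 * L * (expoNorm L ^ 2 * (‖toL2 u‖ ^ 2) ^ 2) := by
        linear_combination -(‖toL2 u‖ ^ 2) ^ 2 * h3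
    _ ≤ 2 * L * quart u := by
        rw [quart]
        gcongr

theorem inner_cub_self (u : Hper L 2) :
    ⟪toL2 (cub one_le_two u), toL2 u⟫_ℂ = (quart u : ℂ) := by
  have h : (quart u : ℂ) = ⟪toL2 (mul one_le_two u (conjH u)),
      toL2 (mul one_le_two u (conjH u))⟫_ℂ := by
    rw [inner_self_eq_norm_sq_to_K, quart]
    norm_cast
  rw [h, L2.inner_def, L2.inner_def]
  refine integral_congr_ae ?_
  filter_upwards [toL2_cub one_le_two u, toL2_mul_conjH one_le_two u] with x h1 h2
  rw [h1, h2, RCLike.inner_apply, RCLike.inner_apply, map_mul, map_pow, Complex.conj_ofReal,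
    mul_left_comm, Complex.mul_conj, Complex.normSq_eq_norm_sq]
  push_cast
  ring

theorem inner_dx_two_self (u : Hper L 2) :
    ⟪toL2 u, dx u 2 le_rfl⟫_ℂ = -((‖dx u 1 one_le_two‖ ^ 2 : ℝ) : ℂ) := by
  rw [inner_dx_two one_le_two le_rfl, inner_self_eq_norm_sq_to_K]
  norm_cast

/-- The dissipation of the nonlinear damping: `Re ∫ |u|²ū u_xx ≤ 0`. -/
theorem re_inner_cub_dx_two_nonpos (u : Hper L 2) :
    (⟪toL2 (cub one_le_two u), dx u 2 le_rfl⟫_ℂ).re ≤ 0 := by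
  rw [inner_dx_two one_le_two le_rfl, Complex.neg_re, neg_nonpos, L2Q.re_inner_eq]
  refine integral_nonneg_of_ae ?_
  filter_upwards [dx_one_mul one_le_two (mul one_le_two u (conjH u)) u,
    dx_one_mul one_le_two u (conjH u), dx_conjH u 1 one_le_two, toL2_conjH u,
    toL2_mul_conjH one_le_two u] with x h1 h2 h3 h4 h5
  rw [cub, h1, h2, h3, h4, h5, Pi.zero_apply]
  set a := toL2 u x
  set b := dx u 1 one_le_two x
  -- the left-hand side is `2|a|²|b|² + Re (ā²b²)`
  have e : ((b * conj ((b * conj a + a * conj b) * a + (‖a‖ : ℂ) ^ 2 * b)).re)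
      = ‖a‖ ^ 2 * ‖b‖ ^ 2 + 2 * ((b * conj a).re) ^ 2 := by
    rw [← Complex.normSq_eq_norm_sq, ← Complex.normSq_eq_norm_sq, ← Complex.ofReal_pow,
      ← Complex.normSq_eq_norm_sq]
    simp [Complex.normSq_apply]
    ring
  rw [e]
  positivity

variable {γ δ τ : ℝ}

/-- The right-hand side of the equation, solved for `u_t`. -/
def rhs (γ δ : ℝ) (u : Hper L 2) : L2Q L :=
  (Complex.I / 2) • dx u 2 le_rfl + (γ : ℂ) • toL2 u
    + ((δ : ℂ) + Complex.I) • toL2 (cub one_le_two u)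

/-- Continuous curves in `H²` on a compact time interval that solve the equation with values in
`L²`. -/
structure StrongSol (γ δ τ : ℝ) (u : ℝ → Hper L 2) : Prop where
  cont : ContinuousOn u (Icc 0 τ)
  deriv : ∀ t ∈ Icc 0 τ,
    HasDerivWithinAt (fun s => toL2 (u s)) (rhs γ δ (u t)) (Icc 0 τ) t

namespace StrongSol

variable {u v : ℝ → Hper L 2}

/-- The mass law `(‖u‖²)' = 2γ‖u‖² + 2δ∫|u|⁴`. -/
theorem hasDerivWithinAt_norm_sq (hu : StrongSol γ δ τ u) {t : ℝ} (ht : t ∈ Icc 0 τ) :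
    HasDerivWithinAt (fun s => ‖toL2 (u s)‖ ^ 2)
      (2 * γ * ‖toL2 (u t)‖ ^ 2 + 2 * δ * quart (u t)) (Icc 0 τ) t := by
  have h := hasDerivWithinAt_of_sub_eq_re_inner (P := fun s => ‖toL2 (u s)‖ ^ 2)
    (G := fun s => toL2 (u s) + toL2 (u t)) (hu.deriv t ht)
    ((hu.deriv t ht).continuousWithinAt.add continuousWithinAt_const) fun r _ => norm_sq_sub_norm_sq _ _
  convert! h using 1
  have h1 : ⟪dx (u t) 2 le_rfl, toL2 (u t)⟫_ℂ = -((‖dx (u t) 1 one_le_two‖ ^ 2 : ℝ) : ℂ) := by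
    rw [← inner_conj_symm, inner_dx_two_self, map_neg, Complex.conj_ofReal]
  rw [← two_smul ℂ, inner_smul_right, rhs, inner_add_left, inner_add_left, inner_smul_left,
    inner_smul_left, inner_smul_left, inner_cub_self, h1, conj_I_div_two, inner_self_eq_norm_sq_to_K]
  simp [← Complex.ofReal_pow]
  ring

/-- Continuous dependence in `L²(Q)`, as long as both solutions have Wiener norm at most `W`. -/
theorem norm_toL2_sub_le (hu : StrongSol γ δ τ u) (hv : StrongSol γ δ τ v) {W : ℝ}
    (hWu : ∀ t ∈ Icc 0 τ, wiener (u t) ≤ W) (hWv : ∀ t ∈ Icc 0 τ, wiener (v t) ≤ W) {t : ℝ}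
    (ht : t ∈ Icc 0 τ) :
    ‖toL2 (u t) - toL2 (v t)‖ ^ 2 ≤ ‖toL2 (u 0) - toL2 (v 0)‖ ^ 2
      * Real.exp (2 * (|γ| + (|δ| + 1) * (3 * (expoNorm L * W) ^ 2)) * t) := by
  rw [← gronwallBound_ε0]
  set K := 2 * (|γ| + (|δ| + 1) * (3 * (expoNorm L * W) ^ 2))
  refine le_gronwallBound_of_hasDerivWithinAt
    (f := fun t => ‖toL2 (u t) - toL2 (v t)‖ ^ 2)
    (f' := fun r => (⟪rhs γ δ (u r) - rhs γ δ (v r),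
      (toL2 (u r) - toL2 (v r)) + (toL2 (u r) - toL2 (v r))⟫_ℂ).re)
    (fun r hr => ?_) le_rfl (fun r hr => ?_) t ht
  · have hd := (hu.deriv r hr).sub (hv.deriv r hr)
    exact hasDerivWithinAt_of_sub_eq_re_inner (P := fun s => ‖toL2 (u s) - toL2 (v s)‖ ^ 2)
      (G := fun s => (toL2 (u s) - toL2 (v s)) + (toL2 (u r) - toL2 (v r))) hd
      (hd.continuousWithinAt.add continuousWithinAt_const) fun s _ => norm_sq_sub_norm_sq _ _
  · set w := u r - v r
    have e1 : toL2 (u r) - toL2 (v r) = toL2 w := (map_sub _ _ _).symm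
    have e2 : rhs γ δ (u r) - rhs γ δ (v r) = (Complex.I / 2) • dx w 2 le_rfl + (γ : ℂ) • toL2 w
        + ((δ : ℂ) + Complex.I) • (toL2 (cub one_le_two (u r)) - toL2 (cub one_le_two (v r))) := by
      have : dx w 2 le_rfl = dx (u r) 2 le_rfl - dx (v r) 2 le_rfl := map_sub (dxCLM 2 le_rfl) _ _
      rw [rhs, rhs, this, ← e1]
      module
    have h1 : ⟪dx w 2 le_rfl, toL2 w⟫_ℂ = -((‖dx w 1 one_le_two‖ ^ 2 : ℝ) : ℂ) := by
      rw [← inner_conj_symm, inner_dx_two_self, map_neg, Complex.conj_ofReal]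
    have h2 := norm_toL2_cub_sub_le one_le_two (u r) (v r) (hWu r hr) (hWv r hr)
    rw [e1] at h2
    rw [e2]
    simp only [e1]
    set c := toL2 (cub one_le_two (u r)) - toL2 (cub one_le_two (v r))
    have h3 : (⟪((δ : ℂ) + Complex.I) • c, toL2 w⟫_ℂ).re
        ≤ (|δ| + 1) * (3 * (expoNorm L * W) ^ 2) * ‖toL2 w‖ ^ 2 := by
      have hn : ‖(δ : ℂ) + Complex.I‖ ≤ |δ| + 1 := by
        refine (norm_add_le _ _).trans ?_
        rw [Complex.norm_real, Complex.norm_I, Real.norm_eq_abs]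
      calc (⟪((δ : ℂ) + Complex.I) • c, toL2 w⟫_ℂ).re
          ≤ ‖⟪((δ : ℂ) + Complex.I) • c, toL2 w⟫_ℂ‖ := Complex.re_le_norm _
        _ ≤ ‖((δ : ℂ) + Complex.I) • c‖ * ‖toL2 w‖ := norm_inner_le_norm _ _
        _ ≤ (|δ| + 1) * (3 * (expoNorm L * W) ^ 2 * ‖toL2 w‖) * ‖toL2 w‖ := by
          rw [norm_smul]
          gcongr
        _ = _ := by ring
    rw [← two_smul ℂ (toL2 w), inner_smul_right, inner_add_left, inner_add_left, inner_smul_left,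
      inner_smul_left, h1, conj_I_div_two, inner_self_eq_norm_sq_to_K]
    have h4 : γ * ‖toL2 w‖ ^ 2 ≤ |γ| * ‖toL2 w‖ ^ 2 := by
      gcongr
      exact le_abs_self γ
    simp [← Complex.ofReal_pow]
    linarith

/-- The energy `‖u_x‖² - ∫|u|⁴`. -/
def energy (u : Hper L 2) : ℝ := ‖dx u 1 one_le_two‖ ^ 2 - quart u

theorem quart_sub_quart (a b : Hper L 2) :
    quart a - quart b = (⟪toL2 a - toL2 b, toL2 (mul one_le_two
      (mul one_le_two a (conjH a) + mul one_le_two b (conjH b)) (a + b))⟫_ℂ).re := by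
  rw [quart, quart, L2Q.re_inner_eq, L2Q.norm_sq_eq_integral, L2Q.norm_sq_eq_integral,
    ← integral_sub ((memLp_two_iff_integrable_sq_norm (Lp.memLp _).1).1 (Lp.memLp _))
      ((memLp_two_iff_integrable_sq_norm (Lp.memLp _).1).1 (Lp.memLp _))]
  refine integral_congr_ae ?_
  filter_upwards [toL2_mul one_le_two
    (mul one_le_two a (conjH a) + mul one_le_two b (conjH b)) (a + b), toL2_add_ae a b,
    toL2_add_ae (mul one_le_two a (conjH a)) (mul one_le_two b (conjH b)),
    toL2_mul_conjH one_le_two a, toL2_mul_conjH one_le_two b,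
    Lp.coeFn_sub (toL2 a) (toL2 b)] with x h1 h2 h3 h4 h5 h6
  rw [h1, h2, h3, h4, h5, h6, Pi.sub_apply, norm_pow, norm_pow, Complex.norm_real,
    Complex.norm_real, norm_norm, norm_norm]
  generalize toL2 a x = p
  generalize toL2 b x = q
  rw [← Complex.ofReal_pow, ← Complex.ofReal_pow, ← Complex.normSq_eq_norm_sq,
    ← Complex.normSq_eq_norm_sq]
  simp [Complex.normSq_apply]
  ring

/-- The energy law. For `δ ≤ 0` its third term is nonpositive, by `re_inner_cub_dx_two_nonpos`. -/
theorem hasDerivWithinAt_energy (hu : StrongSol γ δ τ u) {t : ℝ} (ht : t ∈ Icc 0 τ) :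
    HasDerivWithinAt (fun s => energy (u s))
      (2 * γ * ‖dx (u t) 1 one_le_two‖ ^ 2 - 4 * γ * quart (u t)
        - 2 * δ * (⟪toL2 (cub one_le_two (u t)), dx (u t) 2 le_rfl⟫_ℂ).re
        - 4 * δ * ‖toL2 (cub one_le_two (u t))‖ ^ 2) (Icc 0 τ) t := by
  set G : ℝ → L2Q L := fun s => -(dxCLM 2 le_rfl (u s + u t) + toL2 (mulCLM one_le_two
    (mulCLM one_le_two (u s) (conjH (u s)) + mulCLM one_le_two (u t) (conjH (u t)))
      (u s + u t))) with hG
  have hGc : ContinuousWithinAt G (Icc 0 τ) t := by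
    have h1 : ContinuousWithinAt u (Icc 0 τ) t := hu.cont t ht
    have h2 : ContinuousWithinAt (fun s => conjH (u s)) (Icc 0 τ) t :=
      continuous_conjH.continuousAt.comp_continuousWithinAt h1
    simp only [hG]
    fun_prop
  have h := hasDerivWithinAt_of_sub_eq_re_inner (P := fun s => energy (u s)) (hu.deriv t ht) hGc
    (fun r _ => by
      simp only [hG, energy, mulCLM_apply, dxCLM_apply]
      rw [inner_neg_right, inner_add_right, Complex.neg_re, Complex.add_re, ← quart_sub_quart]
      have h1 : toL2 (u r) - toL2 (u t) = toL2 (u r - u t) := (map_sub _ _ _).symm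
      rw [h1, inner_dx_two one_le_two le_rfl]
      have h2 : dx (u r - u t) 1 one_le_two = dx (u r) 1 one_le_two - dx (u t) 1 one_le_two :=
        map_sub (dxCLM 1 one_le_two) _ _
      have h3 : dx (u r + u t) 1 (by omega) = dx (u r) 1 one_le_two + dx (u t) 1 one_le_two :=
        map_add (dxCLM 1 one_le_two) _ _
      rw [h2, h3]
      rw [Complex.neg_re, ← norm_sq_sub_norm_sq]
      ring)
  convert! h using 1
  have hGt : G t = -((2 : ℂ) • (dx (u t) 2 le_rfl + (2 : ℂ) • toL2 (cub one_le_two (u t)))) := by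
    simp only [hG, ← two_smul ℂ, map_smul, smul_apply]
    rw [dxCLM_apply, mulCLM_apply, mulCLM_apply, cub]
    module
  have h1 : ⟪toL2 (u t), toL2 (cub one_le_two (u t))⟫_ℂ = (quart (u t) : ℂ) := by
    rw [← inner_conj_symm, inner_cub_self, Complex.conj_ofReal]
  rw [hGt]
  set z := dx (u t) 2 le_rfl + (2 : ℂ) • toL2 (cub one_le_two (u t)) with hz
  have hr : rhs γ δ (u t) = (Complex.I / 2) • z
      + ((γ : ℂ) • toL2 (u t) + (δ : ℂ) • toL2 (cub one_le_two (u t))) := by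
    rw [rhs, hz]
    module
  rw [hr, inner_neg_right, inner_smul_right, inner_add_left, inner_smul_left _ z, conj_I_div_two,
    inner_self_eq_norm_sq_to_K, inner_add_left, inner_smul_left, inner_smul_left, hz,
    inner_add_right, inner_add_right, inner_smul_right, inner_smul_right, inner_dx_two_self, h1,
    inner_self_eq_norm_sq_to_K]
  simp [← Complex.ofReal_pow]
  ring

end StrongSol

end Hper

/-! ### A priori bounds and uniqueness -/

namespace Hper

variable {L : ℝ} [hL : Fact (0 < L)] {γ δ τ : ℝ}

namespace StrongSol

variable {u v : ℝ → Hper L 2}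

/-- The damping `δ ≤ 0` leaves at most the growth of the linear equation. -/
theorem norm_toL2_sq_le (hδ : δ ≤ 0) (hu : StrongSol γ δ τ u) {t : ℝ} (ht : t ∈ Icc 0 τ) :
    ‖toL2 (u t)‖ ^ 2 ≤ ‖toL2 (u 0)‖ ^ 2 * Real.exp (2 * γ * t) := by
  rw [← gronwallBound_ε0]
  refine le_gronwallBound_of_hasDerivWithinAt (fun r hr => hu.hasDerivWithinAt_norm_sq hr) le_rfl
    (fun r _ => ?_) t ht
  have := mul_nonneg (neg_nonneg.2 hδ) (quart_nonneg (u r))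
  linarith

/-- The energy controls `‖u_x‖` up to the mass. -/
theorem half_le_energy_add (u : Hper L 2) {m C : ℝ} (hm : ‖toL2 u‖ ^ 2 ≤ m) (hC0 : 0 ≤ C)
    (hC : (expoNorm L * wiener u) ^ 4 ≤ C * (m * (m + ‖dx u 1 one_le_two‖ ^ 2))) :
    ‖dx u 1 one_le_two‖ ^ 2 / 2 ≤ energy u + (m / 2 + m ^ 2 * (2 * C * m + 1) / 4) ∧
      quart u ≤ ‖dx u 1 one_le_two‖ ^ 2 / 2 + (m / 2 + m ^ 2 * (2 * C * m + 1) / 4) := by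
  set y := ‖dx u 1 one_le_two‖ ^ 2
  have hy : 0 ≤ y := sq_nonneg _
  have hm0 : 0 ≤ m := (sq_nonneg _).trans hm
  set X := (expoNorm L * wiener u) ^ 2 with hX
  have hq : quart u ≤ X * m := (quart_le u).trans (by gcongr)
  have hX2 : X ^ 2 ≤ C * (m * (m + y)) := by
    rw [hX, ← pow_mul]
    exact hC
  set D := 2 * C * m + 1
  have hD : 0 < D := by positivity
  -- the inequality between the means with weight `D`
  have h1 : X * m ≤ X ^ 2 / D + m ^ 2 * D / 4 := by
    have h2 : X ^ 2 / D + m ^ 2 * D / 4 - X * m = (X - m * D / 2) ^ 2 / D := by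
      field_simp
      ring
    have : 0 ≤ (X - m * D / 2) ^ 2 / D := by positivity
    linarith
  have h3 : X ^ 2 / D ≤ (m + y) / 2 := by
    rw [div_le_div_iff₀ hD two_pos]
    have : 0 ≤ m + y := by positivity
    nlinarith
  have h4 : quart u ≤ y / 2 + (m / 2 + m ^ 2 * D / 4) := by linarith
  refine ⟨?_, h4⟩
  unfold energy
  linarith

/-- A priori bound: for `δ ≤ 0` the Wiener norm stays bounded on bounded time intervals, in terms
of the `H¹` norm of the initial value. -/
theorem exists_wiener_bound (L : ℝ) [hL : Fact (0 < L)] (γ : ℝ) {δ : ℝ} (hδ : δ ≤ 0) (R T : ℝ) :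
    ∃ W : ℝ, ∀ τ ≤ T, ∀ u : ℝ → Hper L 2, StrongSol γ δ τ u → ‖toL2 (u 0)‖ ^ 2 ≤ R →
      ‖dx (u 0) 1 one_le_two‖ ^ 2 ≤ R → ∀ t ∈ Icc 0 τ, wiener (u t) ≤ W := by
  set m := R * Real.exp (2 * |γ| * T) with hm
  set C₀ := 256 * sobConst L ^ 2 with hC₀
  have hC₀0 : 0 ≤ C₀ := by positivity
  set C := expoNorm L ^ 4 * C₀ with hC
  have hC0 : 0 ≤ C := by have := expoNorm_nonneg (L := L); positivity
  -- with `m` a bound for the mass, the energy `E` satisfies `‖∂ₓu‖² ≤ 2(E + B)` and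
  -- `E' ≤ A‖∂ₓu‖² + const ≤ 2AE + ε`; hence `‖∂ₓu‖² ≤ Y` by Gronwall's inequality
  set B := m / 2 + m ^ 2 * (2 * C * m + 1) / 4 with hB
  set A := 4 * |γ| + 4 * |δ| * (C * m ^ 2) with hA
  set ε := 2 * (A * B) + (4 * |γ| * B + 4 * |δ| * (C * m ^ 3)) with hε
  set Y := 2 * (gronwallBound R (2 * A) ε T + B) with hY
  refine ⟨C₀ * (m * (m + Y)) + 1, fun τ hτ u hu h0 h1 t ht => ?_⟩
  have hR : 0 ≤ R := (sq_nonneg _).trans h0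
  have hm0 : 0 ≤ m := by positivity
  have hB0 : 0 ≤ B := by positivity
  have hA0 : 0 ≤ A := by positivity
  have hε0 : 0 ≤ ε := by positivity
  have hmass : ∀ r ∈ Icc 0 τ, ‖toL2 (u r)‖ ^ 2 ≤ m := fun r hr => by
    refine (hu.norm_toL2_sq_le hδ hr).trans ?_
    have hg : 2 * γ * r ≤ 2 * |γ| * T :=
      calc 2 * γ * r ≤ 2 * |γ| * r := by
            have := hr.1
            gcongr
            exact le_abs_self γ
        _ ≤ 2 * |γ| * T := by
            gcongr
            exact hr.2.trans hτ
    rw [hm]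
    gcongr
  have hw : ∀ r ∈ Icc 0 τ, wiener (u r) ^ 4 ≤ C₀ * (m * (m + ‖dx (u r) 1 one_le_two‖ ^ 2)) :=
    fun r hr => by
      refine (wiener_pow_four_le one_le_two (u r)).trans ?_
      have := hmass r hr
      gcongr
  have hw' : ∀ r ∈ Icc 0 τ, (expoNorm L * wiener (u r)) ^ 4
      ≤ C * (m * (m + ‖dx (u r) 1 one_le_two‖ ^ 2)) := fun r hr => by
    rw [mul_pow, hC, mul_assoc]
    have := hw r hr
    have := expoNorm_nonneg (L := L)
    gcongr
  have hE : ∀ r ∈ Icc 0 τ, energy (u r) ≤ gronwallBound R (2 * A) ε r := by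
    refine le_gronwallBound_of_hasDerivWithinAt (fun r hr => hu.hasDerivWithinAt_energy hr) ?_
      fun r hr => ?_
    · unfold energy
      linarith [quart_nonneg (u 0)]
    · obtain ⟨e1, e2⟩ := half_le_energy_add (u r) (hmass r hr) hC0 (hw' r hr)
      have hQ : ‖toL2 (cub one_le_two (u r))‖ ^ 2
          ≤ C * m ^ 3 + C * m ^ 2 * ‖dx (u r) 1 one_le_two‖ ^ 2 := by
        refine (norm_toL2_cub_le (u r)).trans ?_
        calc (expoNorm L * wiener (u r)) ^ 4 * ‖toL2 (u r)‖ ^ 2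
            ≤ (C * (m * (m + ‖dx (u r) 1 one_le_two‖ ^ 2))) * m := by
              have := hw' r hr
              have := hmass r hr
              gcongr
          _ = _ := by ring
      have hq0 := quart_nonneg (u r)
      have hd := re_inner_cub_dx_two_nonpos (u r)
      set y := ‖dx (u r) 1 one_le_two‖ ^ 2
      have hy : 0 ≤ y := sq_nonneg _
      set q := quart (u r)
      set Q := ‖toL2 (cub one_le_two (u r))‖ ^ 2
      set d := (⟪toL2 (cub one_le_two (u r)), dx (u r) 2 le_rfl⟫_ℂ).re
      have hδ' : |δ| = -δ := abs_of_nonpos hδ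
      have t1 : 2 * γ * y ≤ 2 * |γ| * y := by gcongr; exact le_abs_self γ
      have t2 : -(4 * γ * q) ≤ 4 * |γ| * q := by
        have : -γ * q ≤ |γ| * q := by gcongr; exact neg_le_abs γ
        linarith
      have t3 : -(2 * δ * d) ≤ 0 := by nlinarith
      have t4 : -(4 * δ * Q) ≤ 4 * |δ| * (C * m ^ 3 + C * m ^ 2 * y) := by
        have : |δ| * Q ≤ |δ| * (C * m ^ 3 + C * m ^ 2 * y) := by gcongr
        rw [hδ'] at this ⊢
        linarith
      have t5 : 4 * |γ| * q ≤ 4 * |γ| * (y / 2 + B) := by gcongr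
      have t6 : A * y ≤ A * (2 * (energy (u r) + B)) := by
        gcongr
        linarith
      have t7 : A * y = 4 * |γ| * y + 4 * |δ| * (C * m ^ 2 * y) := by rw [hA]; ring
      rw [hε]
      linarith
  have hy : ‖dx (u t) 1 one_le_two‖ ^ 2 ≤ Y := by
    have e1 := (half_le_energy_add (u t) (hmass t ht) hC0 (hw' t ht)).1
    have e2 := hE t ht
    have e3 := gronwallBound_mono hR hε0 (by positivity : 0 ≤ 2 * A) (ht.2.trans hτ)
    rw [hY]
    linarith
  have h4 : wiener (u t) ^ 4 ≤ C₀ * (m * (m + Y)) := (hw t ht).trans (by gcongr)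
  have hw0 := wiener_nonneg (u t)
  rcases le_or_gt (wiener (u t)) 1 with h | h
  · have : 0 ≤ C₀ * (m * (m + Y)) := le_trans (by positivity) h4
    linarith
  · have : wiener (u t) ≤ wiener (u t) ^ 4 := le_self_pow₀ h.le (by norm_num)
    linarith

theorem exists_wiener_le (hu : StrongSol γ δ τ u) : ∃ W, ∀ t ∈ Icc 0 τ, wiener (u t) ≤ W := by
  obtain ⟨C, hC⟩ := isCompact_Icc.exists_bound_of_continuousOn hu.cont
  refine ⟨√(8 * sobConst L) * C, fun t ht => (wiener_le one_le_two _).trans ?_⟩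
  have := hC t ht
  gcongr

theorem eqOn_of_eq (hu : StrongSol γ δ τ u) (hv : StrongSol γ δ τ v) (h0 : u 0 = v 0) :
    EqOn u v (Icc 0 τ) := by
  intro t ht
  obtain ⟨W₁, h1⟩ := hu.exists_wiener_le
  obtain ⟨W₂, h2⟩ := hv.exists_wiener_le
  have h := hu.norm_toL2_sub_le hv (W := max W₁ W₂) (fun r hr => (h1 r hr).trans (le_max_left _ _))
    (fun r hr => (h2 r hr).trans (le_max_right _ _)) ht
  rw [h0, sub_self, norm_zero, zero_pow two_ne_zero, zero_mul] at h
  have h3 : ‖toL2 (u t) - toL2 (v t)‖ = 0 := by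
    have := norm_nonneg (toL2 (u t) - toL2 (v t))
    nlinarith
  exact toL2_injective (sub_eq_zero.1 (norm_eq_zero.1 h3))

end StrongSol

end Hper

/-! ### Global solutions of ordinary differential equations with an a priori bound -/

/-- Continuity method: a bound that improves itself propagates. -/
theorem lt_of_bootstrap {f : ℝ → ℝ} {T R : ℝ} (hf : ContinuousOn f (Icc 0 T)) (h0 : f 0 < R)
    (h : ∀ τ ∈ Icc 0 T, (∀ t ∈ Icc 0 τ, f t ≤ R) → f τ < R) : ∀ t ∈ Icc 0 T, f t < R := by
  have hcross : ∀ t ∈ Icc 0 T, R ≤ f t → ∃ s ∈ Icc 0 t, f s = R := fun t ht hR => by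
    have := intermediate_value_Icc ht.1 (hf.mono (Icc_subset_Icc_right ht.2))
    obtain ⟨s, hs, e⟩ := this ⟨h0.le, hR⟩
    exact ⟨s, hs, e⟩
  by_contra! hcon
  obtain ⟨t, ht, hR⟩ := hcon
  obtain ⟨s, hs, e⟩ := hcross t ht hR
  have hcl : IsCompact (Icc 0 T ∩ f ⁻¹' {R}) :=
    (isCompact_Icc).of_isClosed_subset (hf.preimage_isClosed_of_isClosed isClosed_Icc
      isClosed_singleton) inter_subset_left
  obtain ⟨σ, ⟨hσ, hσR⟩, hmin⟩ := hcl.exists_isLeast ⟨s, ⟨hs.1, hs.2.trans ht.2⟩, e⟩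
  refine (h σ hσ fun r hr => ?_).ne hσR
  by_contra! hlt
  obtain ⟨q, hq, eq⟩ := hcross r ⟨hr.1, hr.2.trans hσ.2⟩ hlt.le
  have h1 : σ ≤ q := hmin ⟨⟨hq.1, hq.2.trans (hr.2.trans hσ.2)⟩, eq⟩
  have h2 : q = r := le_antisymm hq.2 (hr.2.trans h1)
  rw [h2] at eq
  exact hlt.ne' eq

/-- A locally Lipschitz equation, for which solutions obey an a priori bound, is solvable on the
whole time interval: it is enough to solve the equation whose vector field is cut off outside
a large ball. -/
theorem exists_hasDerivWithinAt_of_apriori {E : Type*} [NormedAddCommGroup E] [NormedSpace ℝ E]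
    [CompleteSpace E] {F : ℝ → E → E} (hcont : ∀ x, Continuous fun t => F t x)
    (hzero : ∀ t, F t 0 = 0)
    (hlip : ∀ R : ℝ, 0 ≤ R → ∃ K : ℝ, 0 ≤ K ∧ ∀ t x y, ‖x‖ ≤ R → ‖y‖ ≤ R →
      ‖F t x - F t y‖ ≤ K * ‖x - y‖)
    (x₀ : E) {T B : ℝ} (hT : 0 ≤ T) (hx₀ : ‖x₀‖ ≤ B)
    (hapriori : ∀ τ ∈ Icc 0 T, ∀ x : ℝ → E, x 0 = x₀ →
      (∀ t ∈ Icc 0 τ, HasDerivWithinAt x (F t (x t)) (Icc 0 τ) t) → ‖x τ‖ ≤ B) :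
    ∃ x : ℝ → E, x 0 = x₀ ∧ ∀ t ∈ Icc 0 T, HasDerivWithinAt x (F t (x t)) (Icc 0 T) t := by
  set R := B + 1 with hR
  have hB : 0 ≤ B := (norm_nonneg _).trans hx₀
  obtain ⟨K, hK0, hK⟩ := hlip (R + 1) (by linarith)
  set M := K * (R + 1) with hM
  have hM0 : 0 ≤ M := by positivity
  have hFM : ∀ t x, ‖x‖ ≤ R + 1 → ‖F t x‖ ≤ M := fun t x hx => by
    have := hK t x 0 hx (by rw [norm_zero]; linarith)
    rw [hzero, sub_zero, sub_zero] at this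
    exact this.trans (mul_le_mul_of_nonneg_left hx hK0)
  -- the cut-off function: `1` on the ball of radius `R`, `0` outside that of radius `R + 1`
  set θ : E → ℝ := fun x => max 0 (min 1 (R + 1 - ‖x‖)) with hθ
  have hθ0 : ∀ x, 0 ≤ θ x := fun x => le_max_left _ _
  have hθ1 : ∀ x, θ x ≤ 1 := fun x => max_le zero_le_one (min_le_left _ _)
  have hθout : ∀ x, R + 1 < ‖x‖ → θ x = 0 := fun x hx =>
    max_eq_left ((min_le_right _ _).trans (by linarith))
  have hθin : ∀ x, ‖x‖ ≤ R → θ x = 1 := fun x hx => by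
    rw [hθ]
    simp only
    rw [min_eq_left (by linarith), max_eq_right zero_le_one]
  have hθlip : ∀ x y, |θ x - θ y| ≤ ‖x - y‖ := fun x y => by
    refine (abs_max_sub_max_le_max _ _ _ _).trans (max_le (by simp) ?_)
    refine (abs_min_sub_min_le_max _ _ _ _).trans (max_le (by simp) ?_)
    rw [show R + 1 - ‖x‖ - (R + 1 - ‖y‖) = ‖y‖ - ‖x‖ by ring, abs_sub_comm]
    exact abs_norm_sub_norm_le x y
  set G : ℝ → E → E := fun t x => θ x • F t x with hG
  have hGM : ∀ t x, ‖G t x‖ ≤ M := fun t x => by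
    rw [hG]
    simp only
    rw [norm_smul, Real.norm_of_nonneg (hθ0 x)]
    rcases le_or_gt ‖x‖ (R + 1) with h | h
    · calc θ x * ‖F t x‖ ≤ 1 * M := mul_le_mul (hθ1 x) (hFM t x h) (norm_nonneg _) zero_le_one
        _ = M := one_mul M
    · rw [hθout x h, zero_mul]
      exact hM0
  have hGlip1 : ∀ t x y, ‖x‖ ≤ R + 1 → ‖G t x - G t y‖ ≤ (M + K) * ‖x - y‖ := fun t x y hx => by
    rcases le_or_gt ‖y‖ (R + 1) with hy | hy
    · have e : G t x - G t y = (θ x - θ y) • F t x + θ y • (F t x - F t y) := by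
        simp only [hG]
        module
      rw [e]
      refine (norm_add_le _ _).trans ?_
      rw [norm_smul, norm_smul, Real.norm_eq_abs, Real.norm_of_nonneg (hθ0 y), add_mul]
      refine add_le_add ?_ ?_
      · rw [mul_comm M]
        exact mul_le_mul (hθlip x y) (hFM t x hx) (norm_nonneg _) (norm_nonneg _)
      · calc θ y * ‖F t x - F t y‖ ≤ 1 * (K * ‖x - y‖) :=
              mul_le_mul (hθ1 y) (hK t x y hx hy) (norm_nonneg _) zero_le_one
          _ = _ := one_mul _
    · have e : G t x - G t y = (θ x - θ y) • F t x := by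
        simp only [hG, hθout y hy]
        module
      rw [e, norm_smul, Real.norm_eq_abs]
      calc |θ x - θ y| * ‖F t x‖ ≤ ‖x - y‖ * M :=
            mul_le_mul (hθlip x y) (hFM t x hx) (norm_nonneg _) (norm_nonneg _)
        _ ≤ (M + K) * ‖x - y‖ := by nlinarith [norm_nonneg (x - y)]
  have hGlip : ∀ t x y, ‖G t x - G t y‖ ≤ (M + K) * ‖x - y‖ := fun t x y => by
    rcases le_or_gt ‖x‖ (R + 1) with hx | hx
    · exact hGlip1 t x y hx
    · rcases le_or_gt ‖y‖ (R + 1) with hy | hy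
      · rw [norm_sub_rev, norm_sub_rev x]
        exact hGlip1 t y x hy
      · simp only [hG, hθout x hx, hθout y hy, zero_smul, sub_self, norm_zero]
        positivity
  have hPL : IsPicardLindelof G (tmin := 0) (tmax := T) ⟨0, le_rfl, hT⟩ x₀
      ⟨M * T, by positivity⟩ 0 ⟨M, hM0⟩ ⟨M + K, by positivity⟩ := by
    refine ⟨fun t _ => ?_, fun x _ => ?_, fun t _ x _ => hGM t x, ?_⟩
    · refine (LipschitzWith.of_dist_le_mul fun x y => ?_).lipschitzOnWith
      rw [dist_eq_norm, dist_eq_norm]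
      exact hGlip t x y
    · exact (continuous_const.smul (hcont x)).continuousOn
    · simp only [sub_zero, sub_self, max_eq_left hT, NNReal.coe_zero]
      exact le_rfl
  obtain ⟨x, hx0, hx⟩ := hPL.exists_eq_forall_mem_Icc_hasDerivWithinAt₀
  have hx0' : x 0 = x₀ := hx0
  have hbound : ∀ t ∈ Icc 0 T, ‖x t‖ < R := by
    refine lt_of_bootstrap (f := fun t => ‖x t‖)
      (fun t ht => (hx t ht).continuousWithinAt.norm) (by rw [hx0']; linarith) fun τ hτ hle => ?_
    have := hapriori τ hτ x hx0' fun t ht => by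
      have h := (hx t ⟨ht.1, ht.2.trans hτ.2⟩).mono (Icc_subset_Icc_right hτ.2)
      simpa only [hG, hθin _ (hle t ht), one_smul] using h
    linarith
  refine ⟨x, hx0', fun t ht => ?_⟩
  have h := hx t ht
  simpa only [hG, hθin _ (hbound t ht).le, one_smul] using h

/-! ### Existence and uniqueness of solutions -/

theorem hasDerivWithinAt_Ici_of_Icc {E : Type*} [NormedAddCommGroup E] [NormedSpace ℝ E]
    {f : ℝ → E} {f' : E} {τ t a : ℝ} (h : HasDerivWithinAt f f' (Icc 0 τ) t)
    (ht : t < τ) (ha0 : 0 ≤ a) : HasDerivWithinAt f f' (Ici a) t := by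
  refine h.mono_of_mem_nhdsWithin ?_
  filter_upwards [self_mem_nhdsWithin, mem_nhdsWithin_of_mem_nhds (Iio_mem_nhds ht)] with s h1 h2
  exact ⟨ha0.trans h1, le_of_lt h2⟩

namespace Hper

variable {L : ℝ} {k m : ℕ} {γ δ τ : ℝ}

theorem timeInterval_top : timeInterval ⊤ = Ici 0 := by
  ext t
  simp [timeInterval, EReal.coe_lt_top]

theorem Icc_subset_timeInterval {T : EReal} {τ : ℝ} (h : (τ : EReal) < T) :
    Icc 0 τ ⊆ timeInterval T := fun _ ht =>
  ⟨ht.1, lt_of_le_of_lt (EReal.coe_le_coe_iff.2 ht.2) h⟩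

theorem hasDerivWithinAt_toL2 {f : ℝ → Hper L m} {f' : Hper L m} {s : Set ℝ} {t : ℝ}
    (h : HasDerivWithinAt f f' s t) :
    HasDerivWithinAt (fun r => toL2 (f r)) (toL2 f') s t :=
  ((toL2 : Hper L m →L[ℂ] L2Q L).restrictScalars ℝ).hasFDerivAt.comp_hasDerivWithinAt t h

variable [hL : Fact (0 < L)]

/-- The terms of order zero of the equation, solved for `u_t`. -/
def nonlin (hk : 1 ≤ k) (γ δ : ℝ) (u : Hper L k) : Hper L k :=
  (γ : ℂ) • u + ((δ : ℂ) + Complex.I) • cub hk u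

theorem norm_nonlin_le (hk : 1 ≤ k) (γ δ : ℝ) (u : Hper L k) :
    ‖nonlin hk γ δ u‖ ≤ (|γ| + (|δ| + 1) * (cubConst L k * wiener u ^ 2)) * ‖u‖ := by
  have hn : ‖(δ : ℂ) + Complex.I‖ ≤ |δ| + 1 := by
    refine (norm_add_le _ _).trans ?_
    rw [Complex.norm_real, Complex.norm_I, Real.norm_eq_abs]
  refine (norm_add_le _ _).trans ?_
  rw [norm_smul, norm_smul, Complex.norm_real, Real.norm_eq_abs, add_mul, mul_assoc (|δ| + 1)]
  gcongr
  exact norm_cub_le hk u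

theorem continuous_nonlin (hk : 1 ≤ k) (γ δ : ℝ) :
    Continuous (nonlin hk γ δ : Hper L k → Hper L k) := by
  have h (f : Hper L k → Hper L k) (hf : Continuous f) :
      Continuous fun u => (γ : ℂ) • u + ((δ : ℂ) + Complex.I) • f u :=
    (continuous_const_smul (γ : ℂ)).add (hf.const_smul ((δ : ℂ) + Complex.I))
  exact h (cub hk) (continuous_cub hk)

theorem exists_norm_nonlin_sub_le (hk : 1 ≤ k) (γ δ R : ℝ) (hR : 0 ≤ R) : ∃ K : ℝ, 0 ≤ K ∧
    ∀ u v : Hper L k, ‖u‖ ≤ R → ‖v‖ ≤ R →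
      ‖nonlin hk γ δ u - nonlin hk γ δ v‖ ≤ K * ‖u - v‖ := by
  obtain ⟨K, hK0, hK⟩ := exists_norm_cub_sub_le (L := L) hk R hR
  refine ⟨‖(γ : ℂ)‖ + ‖(δ : ℂ) + Complex.I‖ * K, by positivity, fun u v hu hv => ?_⟩
  have e : nonlin hk γ δ u - nonlin hk γ δ v
      = (γ : ℂ) • (u - v) + ((δ : ℂ) + Complex.I) • (cub hk u - cub hk v) := by
    rw [nonlin, nonlin]
    module
  rw [e]
  refine (norm_add_le _ _).trans ?_
  rw [norm_smul, norm_smul, add_mul, mul_assoc]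
  gcongr
  exact hK u v hu hv

/-- The vector field of the equation for `v(t) = e^{-it∂ₓ²/2}u(t)`. -/
def field (hk : 1 ≤ k) (γ δ t : ℝ) (v : Hper L k) : Hper L k :=
  grp (-t) (nonlin hk γ δ (grp t v))

theorem grp_field (hk : 1 ≤ k) (γ δ t : ℝ) (v : Hper L k) :
    grp t (field hk γ δ t v) = nonlin hk γ δ (grp t v) := grp_neg_grp _ _

theorem rhs_incl (hk : 2 ≤ k) (u : Hper L k) :
    rhs γ δ (incl hk u) = toL2 ((Complex.I / 2) • dxx hk u
      + incl (Nat.sub_le k 2) (nonlin (one_le_two.trans hk) γ δ u)) := by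
  have h : toL2 (cub one_le_two (incl hk u)) = toL2 (cub (one_le_two.trans hk) u) := by
    rw [← incl_cub one_le_two hk u, toL2_incl hk (cub (one_le_two.trans hk) u)]
  rw [rhs, h, map_add, map_smul, toL2_incl (Nat.sub_le k 2), nonlin, map_add, map_smul, map_smul,
    toL2_dxx, toL2_incl hk u, dx_incl hk u, add_assoc]

theorem strongSol_of_field (hk : 2 ≤ k) {v : ℝ → Hper L k}
    (hv : ∀ t ∈ Icc 0 τ, HasDerivWithinAt v (field (one_le_two.trans hk) γ δ t (v t))
      (Icc 0 τ) t) :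
    StrongSol γ δ τ (fun t => incl hk (grp t (v t))) where
  cont t ht := ((inclCLM hk).continuous.tendsto _).comp
    (tendsto_grp (tendsto_nhdsWithin_of_tendsto_nhds tendsto_id) (hv t ht).continuousWithinAt)
  deriv t ht := by
    have h := hasDerivWithinAt_toL2 (hasDerivWithinAt_grp hk (hv t ht))
    rw [grp_field, ← rhs_incl] at h
    exact h

theorem incl_injective (h : m ≤ k) : Function.Injective (incl h : Hper L k → Hper L m) :=
  fun u v e => toL2_injective (by rw [← toL2_incl h u, ← toL2_incl h v, e])

theorem grp_injective (t : ℝ) : Function.Injective (grp t : Hper L k → Hper L k) := fun u v h => by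
  rw [← grp_neg_grp (-t) u, ← grp_neg_grp (-t) v, neg_neg, h]

/-- For `δ ≤ 0` the equation for `e^{-it∂ₓ²/2}u(t)` is solvable on every bounded time interval. -/
theorem exists_field_solution (hk : 2 ≤ k) (γ : ℝ) (hδ : δ ≤ 0) (u₀ : Hper L k) {T : ℝ}
    (hT : 0 ≤ T) : ∃ v : ℝ → Hper L k, v 0 = u₀ ∧ ∀ t ∈ Icc 0 T,
      HasDerivWithinAt v (field (one_le_two.trans hk) γ δ t (v t)) (Icc 0 T) t := by
  have hk1 : 1 ≤ k := one_le_two.trans hk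
  obtain ⟨W, hW⟩ := StrongSol.exists_wiener_bound L γ hδ (‖u₀‖ ^ 2) T
  set C := |γ| + (|δ| + 1) * (cubConst L k * W ^ 2)
  have hC : 0 ≤ C := by have := cubConst_nonneg (L := L) (k := k); positivity
  refine exists_hasDerivWithinAt_of_apriori (F := field hk1 γ δ) (fun x => ?_) (fun t => ?_)
    (fun R hR => ?_) u₀ hT (B := ‖u₀‖ * Real.exp (C * T)) ?_ fun τ hτ v h0 hv => ?_
  · refine continuous_iff_continuousAt.2 fun t => ?_
    exact tendsto_grp (continuous_neg.tendsto t)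
      (((continuous_nonlin hk1 γ δ).tendsto _).comp ((continuous_grp_left x).tendsto t))
  · have h : ‖field hk1 γ δ t (0 : Hper L k)‖ ≤ 0 := by
      rw [field, norm_grp]
      refine (norm_nonlin_le hk1 γ δ _).trans ?_
      rw [norm_grp, norm_zero, mul_zero]
    exact norm_le_zero_iff.1 h
  · obtain ⟨K, hK0, hK⟩ := exists_norm_nonlin_sub_le (L := L) hk1 γ δ R hR
    refine ⟨K, hK0, fun t x y hx hy => ?_⟩
    rw [field, field, ← grp_sub, norm_grp]
    have := hK (grp t x) (grp t y) (by rwa [norm_grp]) (by rwa [norm_grp])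
    rwa [← grp_sub, norm_grp] at this
  · exact le_mul_of_one_le_right (norm_nonneg _) (Real.one_le_exp (by positivity))
  · have hs := strongSol_of_field hk hv
    have hi : incl hk (grp 0 (v 0)) = incl hk u₀ := by rw [grp_zero, h0]
    have hw : ∀ t ∈ Icc 0 τ, wiener (v t) ≤ W := fun t ht => by
      have h := hW τ hτ.2 _ hs (by
        simp only [hi]
        have := norm_toL2_le u₀
        rw [toL2_incl]
        gcongr) (by
        simp only [hi]
        have := norm_dx_le 1 hk1 u₀
        rw [dx_incl]
        gcongr) t ht
      rwa [wiener_incl, wiener_grp] at h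
    have h := norm_le_gronwallBound_of_norm_deriv_right_le (f := v)
      (f' := fun t => field hk1 γ δ t (v t)) (δ := ‖u₀‖) (K := C) (ε := 0) (a := 0) (b := τ)
      (fun t ht => (hv t ht).continuousWithinAt)
      (fun t ht => hasDerivWithinAt_Ici_of_Icc (hv t (Ico_subset_Icc_self ht)) ht.2 ht.1)
      (by rw [h0]) (fun t ht => by
        rw [field, norm_grp, add_zero]
        refine (norm_nonlin_le hk1 γ δ _).trans ?_
        rw [norm_grp, wiener_grp]
        have h1 := hw t (Ico_subset_Icc_self ht)
        have h2 := wiener_nonneg (v t)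
        have := cubConst_nonneg (L := L) (k := k)
        simp only [C]
        gcongr) τ ⟨hτ.1, le_rfl⟩
    rw [gronwallBound_ε0, sub_zero] at h
    refine h.trans ?_
    have := hτ.2
    gcongr

theorem field_solution_unique (hk : 2 ≤ k) {v w : ℝ → Hper L k} (h0 : v 0 = w 0)
    (hv : ∀ t ∈ Icc 0 τ, HasDerivWithinAt v (field (one_le_two.trans hk) γ δ t (v t))
      (Icc 0 τ) t)
    (hw : ∀ t ∈ Icc 0 τ, HasDerivWithinAt w (field (one_le_two.trans hk) γ δ t (w t))
      (Icc 0 τ) t) : EqOn v w (Icc 0 τ) := by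
  intro t ht
  have h := (strongSol_of_field hk hv).eqOn_of_eq (strongSol_of_field hk hw)
    (by simp only [h0]) ht
  exact grp_injective t (incl_injective hk h)

/-- Solutions on the intervals `[0, n]` agree where both are defined, and glue to a global one. -/
theorem exists_field_solution_Ici (hk : 2 ≤ k) (γ : ℝ) (hδ : δ ≤ 0) (u₀ : Hper L k) :
    ∃ v : ℝ → Hper L k, v 0 = u₀ ∧ ∀ t, 0 ≤ t →
      HasDerivWithinAt v (field (one_le_two.trans hk) γ δ t (v t)) (Ici 0) t := by
  choose x hx0 hx using fun n : ℕ => exists_field_solution hk γ hδ u₀ (n.cast_nonneg (α := ℝ))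
  have hagree : ∀ (n m : ℕ), n ≤ m → EqOn (x n) (x m) (Icc 0 n) := fun n m hnm => by
    have hnm' : (n : ℝ) ≤ m := by exact_mod_cast hnm
    refine field_solution_unique hk (by rw [hx0, hx0]) (hx n) fun t ht => ?_
    exact (hx m t ⟨ht.1, ht.2.trans hnm'⟩).mono (Icc_subset_Icc_right hnm')
  set v : ℝ → Hper L k := fun t => x (⌈t⌉₊) t with hv
  have hvx : ∀ (n : ℕ), EqOn v (x n) (Icc 0 n) := fun n t ht =>
    hagree ⌈t⌉₊ n (Nat.ceil_le.2 ht.2) ⟨ht.1, Nat.le_ceil t⟩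
  refine ⟨v, by simp [hv, hx0], fun t ht => ?_⟩
  set N := ⌈t⌉₊ + 1
  have hN : t < (N : ℝ) := by
    push_cast [N]
    linarith [Nat.le_ceil t]
  have htN : t ∈ Icc 0 (N : ℝ) := ⟨ht, hN.le⟩
  rw [hvx N htN]
  refine hasDerivWithinAt_Ici_of_Icc ?_ hN le_rfl
  exact (hx N t htN).congr (hvx N) (hvx N htN)

/-- The equation, solved for `u_t`. -/
theorem ae_eqn_iff (hk : 2 ≤ k) (u : Hper L k) (f : L2Q L) :
    (∀ᵐ x ∂(volQ L), Complex.I * f x + (1 / 2 : ℂ) * (dx u 2 hk) x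
        + (‖(toL2 u) x‖ : ℂ) ^ 2 * (toL2 u) x
      = Complex.I * (γ : ℂ) * (toL2 u) x
        + Complex.I * (δ : ℂ) * (‖(toL2 u) x‖ : ℂ) ^ 2 * (toL2 u) x) ↔
      f = rhs γ δ (incl hk u) := by
  have hr : rhs γ δ (incl hk u) =ᵐ[volQ L] fun x => Complex.I / 2 * dx u 2 hk x
      + (γ : ℂ) * toL2 u x + ((δ : ℂ) + Complex.I) * ((‖toL2 u x‖ : ℂ) ^ 2 * toL2 u x) := by
    have h1 := toL2_cub one_le_two (incl hk u)
    rw [toL2_incl hk u] at h1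
    rw [rhs]
    filter_upwards [h1, Lp.coeFn_add ((Complex.I / 2) • dx (incl hk u) 2 le_rfl
      + (γ : ℂ) • toL2 (incl hk u)) (((δ : ℂ) + Complex.I) • toL2 (cub one_le_two (incl hk u))),
      Lp.coeFn_add ((Complex.I / 2) • dx (incl hk u) 2 le_rfl) ((γ : ℂ) • toL2 (incl hk u)),
      Lp.coeFn_smul (Complex.I / 2) (dx (incl hk u) 2 le_rfl),
      Lp.coeFn_smul (γ : ℂ) (toL2 (incl hk u)),
      Lp.coeFn_smul ((δ : ℂ) + Complex.I) (toL2 (cub one_le_two (incl hk u)))]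
      with x h1 h2 h3 h4 h5 h6
    rw [h2, Pi.add_apply, h3, Pi.add_apply, h4, h5, h6, Pi.smul_apply, Pi.smul_apply, Pi.smul_apply,
      h1, smul_eq_mul, smul_eq_mul, smul_eq_mul, toL2_incl hk u, dx_incl hk u]
  have hI := Complex.I_mul_I
  constructor
  · intro h
    refine Lp.ext ?_
    filter_upwards [h, hr] with x h1 h2
    rw [h2]
    linear_combination (-Complex.I) * h1 - (f x - (γ : ℂ) * toL2 u x
      - δ * (‖toL2 u x‖ : ℂ) ^ 2 * toL2 u x) * (-hI)
  · rintro rfl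
    filter_upwards [hr] with x h2
    rw [h2]
    linear_combination (1 / 2 * dx u 2 hk x + (‖toL2 u x‖ : ℂ) ^ 2 * toL2 u x) * hI

variable {u₀ : Hper L k} {u : ℝ → Hper L k} {T : EReal}

theorem hasDerivWithinAt_toL2_of_isSolution {hk : 2 ≤ k} (h : IsSolution L γ δ hk u₀ T u) {t : ℝ}
    (ht : t ∈ timeInterval T) :
    HasDerivWithinAt (fun s => toL2 (u s)) (rhs γ δ (incl hk (u t))) (timeInterval T) t := by
  obtain ⟨ut, -, hut⟩ := h.eqn
  have h2 := hasDerivWithinAt_toL2 (hut t ht).1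
  rwa [(ae_eqn_iff hk (u t) _).1 (hut t ht).2] at h2

theorem strongSol_of_isSolution {hk : 2 ≤ k} (h : IsSolution L γ δ hk u₀ T u) {τ : ℝ}
    (hτ : (τ : EReal) < T) : StrongSol γ δ τ (fun t => incl hk (u t)) where
  cont := (inclCLM hk).continuous.comp_continuousOn (h.cont.mono (Icc_subset_timeInterval hτ))
  deriv _ ht := (hasDerivWithinAt_toL2_of_isSolution h (Icc_subset_timeInterval hτ ht)).mono
    (Icc_subset_timeInterval hτ)

/-- Solutions with the same initial value agree on their common interval of existence. -/
theorem isSolution_unique {hk : 2 ≤ k} {v : ℝ → Hper L k} {T' : EReal}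
    (hu : IsSolution L γ δ hk u₀ T u) (hv : IsSolution L γ δ hk u₀ T' v) {t : ℝ}
    (ht : t ∈ timeInterval T) (ht' : t ∈ timeInterval T') : u t = v t :=
  incl_injective hk ((strongSol_of_isSolution hu ht.2).eqOn_of_eq
    (strongSol_of_isSolution hv ht'.2) (by simp only [hu.init, hv.init]) ⟨ht.1, le_rfl⟩)

theorem exists_isSolution_top (hk : 2 ≤ k) (γ : ℝ) (hδ : δ ≤ 0) (u₀ : Hper L k) :
    ∃ u, IsSolution L γ δ hk u₀ ⊤ u := by
  have hk1 : 1 ≤ k := one_le_two.trans hk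
  obtain ⟨v, h0, hv⟩ := exists_field_solution_Ici hk γ hδ u₀
  obtain ⟨u, hu⟩ : ∃ u : ℝ → Hper L k, u = fun t => grp t (v t) := ⟨_, rfl⟩
  have hc : ContinuousOn u (Ici 0) := fun t ht => by
    rw [hu]
    exact tendsto_grp (tendsto_nhdsWithin_of_tendsto_nhds tendsto_id)
      (hv t ht).continuousWithinAt
  have hn : ContinuousOn (fun t => nonlin hk1 γ δ (u t)) (Ici 0) :=
    (continuous_nonlin hk1 γ δ).comp_continuousOn hc
  have hn' : ContinuousOn (fun t => incl (Nat.sub_le k 2) (nonlin hk1 γ δ (u t))) (Ici 0) :=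
    (inclCLM (Nat.sub_le k 2)).continuous.comp_continuousOn hn
  have hd : ContinuousOn (fun t => dxx hk (u t)) (Ici 0) :=
    (continuous_dxx hk).comp_continuousOn hc
  refine ⟨u, EReal.zero_lt_top, by simp only [hu, grp_zero, h0], ?_,
    fun t => (Complex.I / 2) • dxx hk (u t) + incl (Nat.sub_le k 2) (nonlin hk1 γ δ (u t)),
    ?_, fun t ht => ⟨?_, ?_⟩⟩
  · rwa [timeInterval_top]
  · rw [timeInterval_top]
    exact (hd.const_smul (Complex.I / 2)).add hn'
  · rw [timeInterval_top] at ht ⊢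
    have h := hasDerivWithinAt_grp hk (hv t ht)
    rw [grp_field] at h
    rw [hu]
    exact h
  · exact (ae_eqn_iff hk _ _).2 (rhs_incl hk _).symm

theorem eq_top_of_isMaximalSolution {hk : 2 ≤ k} (hδ : δ ≤ 0)
    (h : IsMaximalSolution L γ δ hk u₀ T u) : T = ⊤ := by
  obtain ⟨v, hv⟩ := exists_isSolution_top hk γ hδ u₀
  refine top_le_iff.1 (h.2 ⊤ v hv fun t ht => isSolution_unique h.1 hv ht ?_)
  rw [timeInterval_top]
  exact ht.1

end Hper

/-! ### Weak compactness -/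

/-- Hilbert spaces are reflexive. -/
theorem inclusionInDoubleDualWeak_surjective {E : Type*} [NormedAddCommGroup E]
    [InnerProductSpace ℂ E] [CompleteSpace E] :
    Function.Surjective (NormedSpace.inclusionInDoubleDualWeak ℂ E) := by
  intro ψ
  set Ψ : StrongDual ℂ (StrongDual ℂ E) := WeakDual.toStrongDual ψ
  -- the functional `x ↦ conj (Ψ ⟪x, ·⟫)`
  set g : StrongDual ℂ E := LinearMap.mkContinuous
    { toFun := fun x => conj (Ψ (InnerProductSpace.toDual ℂ E x))
      map_add' := fun x y => by simp
      map_smul' := fun c x => by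
        rw [LinearIsometryEquiv.map_smulₛₗ, map_smul, smul_eq_mul, map_mul, Complex.conj_conj]
        rfl } ‖Ψ‖ (fun x => by
        have h := Ψ.le_opNorm (InnerProductSpace.toDual ℂ E x)
        rw [LinearIsometryEquiv.norm_map] at h
        simpa using h)
  refine ⟨toWeakSpace ℂ E ((InnerProductSpace.toDual ℂ E).symm g), ?_⟩
  apply DFunLike.ext
  intro ℓ
  obtain ⟨y, rfl⟩ := (InnerProductSpace.toDual ℂ E).surjective ℓ
  change ⟪y, (InnerProductSpace.toDual ℂ E).symm g⟫_ℂ = Ψ (InnerProductSpace.toDual ℂ E y)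
  rw [← inner_conj_symm, InnerProductSpace.toDual_symm_apply]
  exact Complex.conj_conj _

theorem isCompact_toWeakSpace_closedBall {E : Type*} [NormedAddCommGroup E]
    [InnerProductSpace ℂ E] [CompleteSpace E] (R : ℝ) :
    IsCompact (toWeakSpace ℂ E '' Metric.closedBall 0 R) := by
  have h1 := (convex_closedBall (0 : E) R).toWeakSpace_closure ℂ
  rw [Metric.isClosed_closedBall.closure_eq] at h1
  rw [h1]
  refine NormedSpace.isCompact_closure_of_isBounded ℂ E _ ?_ fun _ _ =>
    inclusionInDoubleDualWeak_surjective _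
  rw [preimage_image_eq _ (toWeakSpace ℂ E).injective]
  exact Metric.isBounded_closedBall

namespace L2Q

variable {L : ℝ}

/-- The bilinear pairing `(f, g) ↦ ∫_Q f g dx` on `L²(Q)`. -/
def pairing (L : ℝ) : L2Q L →L[ℂ] L2Q L →L[ℂ] ℂ :=
  (ContinuousLinearMap.mul ℂ ℂ).lpPairing (volQ L) 2 2

theorem pairing_apply (f g : L2Q L) : pairing L f g = ∫ x, f x * g x ∂(volQ L) := by
  simp [pairing, ContinuousLinearMap.lpPairing_eq_integral]

theorem norm_pairing_le (f g : L2Q L) : ‖pairing L f g‖ ≤ ‖f‖ * ‖g‖ := by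
  have h : pairing L f g = ⟪star f, g⟫_ℂ := by
    rw [pairing_apply, L2.inner_def]
    refine integral_congr_ae ?_
    filter_upwards [Lp.coeFn_star f] with x hx
    rw [hx, RCLike.inner_apply, Pi.star_apply, RCLike.star_def, Complex.conj_conj, mul_comm]
  have h2 : ‖star f‖ ≤ ‖f‖ := by
    refine Lp.norm_le_norm_of_ae_le ?_
    filter_upwards [Lp.coeFn_star f] with x hx
    rw [hx, Pi.star_apply, norm_star]
  rw [h]
  exact (norm_inner_le_norm _ _).trans (by gcongr)

/-- The embedding `L²(Q) → H^{-s}_per(Q)` as a bounded operator. -/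
def toDualCLM (L : ℝ) (s : ℕ) : L2Q L →L[ℂ] HperDual L s :=
  ((ContinuousLinearMap.compL ℂ (Hper L s) (L2Q L) ℂ).flip Hper.toL2).comp (pairing L)

theorem toDual_apply_eq_pairing (s : ℕ) (f : L2Q L) (w : Hper L s) :
    toDual s f w = pairing L f (Hper.toL2 w) := rfl

variable [hL : Fact (0 < L)]

/-- The projection onto the Fourier modes of index at most `N` in absolute value. -/
def trunc (L : ℝ) (N : ℕ) : L2Q L →L[ℂ] L2Q L :=
  ∑ n ∈ Finset.Icc (-(N : ℤ)) N, (innerSL ℂ (expoLp L n)).smulRight (expoLp L n)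

theorem trunc_apply (N : ℕ) (f : L2Q L) :
    trunc L N f = ∑ n ∈ Finset.Icc (-(N : ℤ)) N, coef f n • expoLp L n := by
  simp [trunc, coef_eq_inner]

theorem coef_trunc (N : ℕ) (f : L2Q L) (m : ℤ) :
    coef (trunc L N f) m = if m ∈ Finset.Icc (-(N : ℤ)) N then coef f m else 0 := by
  rw [coef_eq_inner, trunc_apply, inner_sum]
  simp only [inner_smul_right, orthonormal_iff_ite.1 (orthonormal_expoLp hL.out), mul_ite, mul_one,
    mul_zero, Finset.sum_ite_eq]

/-- High Fourier modes are small in `L²` relative to the norm of `H¹`. -/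
theorem norm_sub_trunc_le (N : ℕ) (w : Hper L 1) :
    ‖Hper.toL2 w - trunc L N (Hper.toL2 w)‖ ≤ L / Real.pi * ‖w‖ / (N + 1) := by
  have hL0 := hL.out
  have h1 := hasSum_norm_sq (Hper.toL2 w - trunc L N (Hper.toL2 w))
  have h2 := (hasSum_norm_sq (Hper.dx w 1 le_rfl)).mul_left ((L / Real.pi / (N + 1)) ^ 2)
  have h3 := Hper.norm_dx_le 1 le_rfl w
  have h := hasSum_le (fun n => ?_) h1 h2
  · rw [← mul_pow] at h
    refine (abs_le_of_sq_le_sq' h (by positivity)).2.trans ?_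
    rw [mul_div_right_comm]
    gcongr
  · rw [coef_sub, coef_trunc, Hper.coef_dx, pow_one, norm_mul, norm_mul, Complex.norm_I, one_mul,
      Complex.norm_real, Real.norm_eq_abs, Hper.coef, ← mul_pow]
    split_ifs with hn
    · rw [sub_self, norm_zero, zero_pow two_ne_zero]
      positivity
    · rw [sub_zero]
      have hn' : ((N : ℝ) + 1) ≤ |(n : ℝ)| := by
        have : (N : ℤ) + 1 ≤ |n| := by
          rw [Finset.mem_Icc, ← abs_le] at hn
          omega
        exact_mod_cast this
      have hf : 1 ≤ L / Real.pi / (N + 1) * |freq L n| := by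
        rw [freq, abs_div, abs_mul, abs_of_pos Real.pi_pos, abs_of_pos hL0]
        have hp := Real.pi_pos
        rw [show L / Real.pi / (N + 1) * (Real.pi * |(n : ℝ)| / L) = |(n : ℝ)| / (N + 1) by
          field_simp]
        rwa [one_le_div (by positivity)]
      have := le_mul_of_one_le_left (norm_nonneg (coef (Hper.toL2 w) n)) hf
      rw [mul_assoc] at this
      gcongr

/-- On bounded sets the embedding `L²(Q) → H^{-1}_per(Q)` is continuous from the weak topology to
the norm topology. -/
theorem continuousOn_toDual_toWeakSpace (R : ℝ) :
    ContinuousOn (fun f : WeakSpace ℂ (L2Q L) => toDual 1 ((toWeakSpace ℂ (L2Q L)).symm f))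
      (toWeakSpace ℂ (L2Q L) '' Metric.closedBall 0 R) := by
  -- `F N f` is the functional `w ↦ ∫ f · trunc N w`, of finite rank in `f`
  set F : ℕ → WeakSpace ℂ (L2Q L) → HperDual L 1 := fun N f =>
    ∑ n ∈ Finset.Icc (-(N : ℤ)) N, pairing L ((toWeakSpace ℂ (L2Q L)).symm f) (expoLp L n) •
      (innerSL ℂ (expoLp L n)).comp Hper.toL2 with hF
  have hFc : ∀ N, Continuous (F N) := fun N => by
    refine continuous_finsetSum _ fun n _ => ?_
    have h : Continuous fun f : WeakSpace ℂ (L2Q L) =>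
        pairing L ((toWeakSpace ℂ (L2Q L)).symm f) (expoLp L n) :=
      WeakBilin.eval_continuous (topDualPairing ℂ (L2Q L)).flip ((pairing L).flip (expoLp L n))
    exact h.smul continuous_const
  have hFw : ∀ N f (w : Hper L 1), F N (toWeakSpace ℂ (L2Q L) f) w
      = pairing L f (trunc L N (Hper.toL2 w)) := fun N f w => by
    simp [hF, trunc_apply, coef_eq_inner, mul_comm]
  refine TendstoUniformlyOn.continuousOn (F := F) (p := atTop) ?_
    (Eventually.of_forall fun N => (hFc N).continuousOn).frequently
  have hlim : Tendsto (fun N : ℕ => R * (L / Real.pi) / ((N : ℝ) + 1)) atTop (𝓝 0) :=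
    tendsto_const_nhds.div_atTop (tendsto_natCast_atTop_atTop.atTop_add tendsto_const_nhds)
  rw [Metric.tendstoUniformlyOn_iff]
  intro ε hε
  filter_upwards [hlim.eventually (gt_mem_nhds hε)] with N hN
  rintro _ ⟨f, hf, rfl⟩
  refine lt_of_le_of_lt ?_ hN
  rw [dist_eq_norm, LinearEquiv.symm_apply_apply]
  rw [mem_closedBall_zero_iff] at hf
  have hL0 := hL.out
  have hR : 0 ≤ R := (norm_nonneg f).trans hf
  refine ContinuousLinearMap.opNorm_le_bound _ (by positivity) fun w => ?_
  have e : (toDual 1 f - F N (toWeakSpace ℂ (L2Q L) f)) w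
      = pairing L f (Hper.toL2 w - trunc L N (Hper.toL2 w)) := by
    rw [sub_apply, hFw, toDual_apply_eq_pairing, map_sub]
  rw [e]
  refine (norm_pairing_le _ _).trans ((mul_le_mul hf (norm_sub_trunc_le N w) (norm_nonneg _)
    hR).trans (le_of_eq ?_))
  ring

end L2Q

/-- Limit sets of maps into a bounded subset of `L²(Q)`. -/
theorem weakOmegaLimit_of_norm_le {L : ℝ} {k : ℕ} [hL : Fact (0 < L)]
    {φ : ℝ → Hper L k → L2Q L} {B : Set (Hper L k)} {R : ℝ}
    (h : ∀ t, 0 ≤ t → ∀ u ∈ B, ‖φ t u‖ ≤ R) :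
    (B.Nonempty → (weakOmegaLimit φ B).Nonempty) ∧ IsCompact (weakOmegaLimit φ B) ∧
      IsCompact (L2Q.toDual 1 '' {v | toWeakSpace ℂ (L2Q L) v ∈ weakOmegaLimit φ B}) := by
  have hK := isCompact_toWeakSpace_closedBall (E := L2Q L) R
  have hK' : closure (image2 (fun t u => toWeakSpace ℂ (L2Q L) (φ t u)) (Ici 0) B)
      ⊆ toWeakSpace ℂ (L2Q L) '' Metric.closedBall 0 R := by
    refine closure_minimal ?_ hK.isClosed
    rintro _ ⟨t, ht, u, hu, rfl⟩
    exact mem_image_of_mem _ (mem_closedBall_zero_iff.2 (h t ht u hu))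
  have hsub : weakOmegaLimit φ B ⊆ toWeakSpace ℂ (L2Q L) '' Metric.closedBall 0 R :=
    (iInter₂_subset (Ici 0) (Ici_mem_atTop 0)).trans hK'
  have hc : IsCompact (weakOmegaLimit φ B) :=
    hK.of_isClosed_subset (isClosed_omegaLimit _ _ _) hsub
  refine ⟨nonempty_omegaLimit_of_isCompact_absorbing _ _ _ hK ⟨Ici 0, Ici_mem_atTop 0, hK'⟩,
    hc, ?_⟩
  convert! hc.image_of_continuousOn ((L2Q.continuousOn_toDual_toWeakSpace R).mono hsub) using 1

/-! ### Collapse, bounded orbits and the solution semigroup -/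

theorem tendsto_That_atTop {δ m : ℝ} (hδ : 0 < δ) (hm : 0 < m) :
    Tendsto (fun γ => That γ δ m) (𝓝[>] (-δ * m)) atTop := by
  have hδm : 0 < δ * m := by positivity
  have h1 : Tendsto (fun γ : ℝ => 1 / (2 * γ)) (𝓝[>] (-δ * m)) (𝓝 (1 / (2 * (-δ * m)))) :=
    (ContinuousAt.div (by fun_prop) (by fun_prop) (by nlinarith)).tendsto.mono_left
      nhdsWithin_le_nhds
  have h2 : Tendsto (fun γ : ℝ => 1 + γ / (δ * m)) (𝓝[>] (-δ * m)) (𝓝[>] 0) := by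
    refine tendsto_nhdsWithin_iff.2 ⟨?_, ?_⟩
    · have h : ContinuousAt (fun γ : ℝ => 1 + γ / (δ * m)) (-δ * m) := by fun_prop
      have e : 1 + (-δ * m) / (δ * m) = 0 := by
        rw [neg_mul, neg_div, div_self hδm.ne']
        ring
      have h' := h.tendsto
      simp only [e] at h'
      exact h'.mono_left nhdsWithin_le_nhds
    · filter_upwards [self_mem_nhdsWithin] with γ hγ
      have h : -1 < γ / (δ * m) := (lt_div_iff₀ hδm).2 (by linarith [mem_Ioi.1 hγ])
      exact mem_Ioi.2 (by linarith)
  refine h1.neg_mul_atBot ?_ (Real.tendsto_log_nhdsGT_zero.comp h2)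
  exact div_neg_of_pos_of_neg one_pos (by linarith)

/-- `That γ δ m` is half the slope at `0` of `γ ↦ log (1 + γ/(δm))`. -/
theorem tendsto_That_Ttilde (δ m : ℝ) :
    Tendsto (fun γ => That γ δ m) (𝓝[≠] 0) (𝓝 (Ttilde δ m)) := by
  have h0 : HasDerivAt (fun γ : ℝ => 1 + γ / (δ * m)) (1 / (δ * m)) 0 :=
    ((hasDerivAt_id 0).div_const _).const_add 1
  have h1 := hasDerivAt_iff_tendsto_slope_zero.1 (h0.log (by simp))
  have h2 := h1.const_mul (1 / 2)
  refine (h2.congr fun γ => ?_).trans (le_of_eq ?_)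
  · simp [That]
    ring
  · rw [Ttilde]
    congr 1
    simp
    ring

namespace Hper

variable {L : ℝ} {k : ℕ} {γ δ τ : ℝ}

section

variable {u₀ : Hper L k} {u : ℝ → Hper L k} {hk : 2 ≤ k}

theorem massM_eq (γ : ℝ) (u : ℝ → Hper L k) (t : ℝ) :
    massM L γ u t = Real.exp (-2 * γ * t) / (2 * L) * ‖toL2 (u t)‖ ^ 2 := by
  rw [massM, L2Q.norm_sq_eq_integral]

theorem isSolution_shift (h : IsSolution L γ δ hk u₀ ⊤ u) {s : ℝ} (hs : 0 ≤ s) :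
    IsSolution L γ δ hk (u s) ⊤ (fun t => u (s + t)) := by
  have hmaps : MapsTo (fun t => s + t) (Ici 0) (Ici 0) := fun t ht => add_nonneg hs ht
  obtain ⟨ut, hut, heq⟩ := h.eqn
  have hc := h.cont
  rw [timeInterval_top] at hut heq hc
  refine ⟨h.pos, by simp, ?_, fun t => ut (s + t), ?_, fun t ht => ?_⟩
  · rw [timeInterval_top]
    exact hc.comp (by fun_prop) hmaps
  · rw [timeInterval_top]
    exact hut.comp (by fun_prop) hmaps
  · rw [timeInterval_top] at ht ⊢
    refine ⟨?_, (heq _ (hmaps ht)).2⟩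
    have h1 := HasDerivWithinAt.scomp t (heq _ (hmaps ht)).1
      ((hasDerivWithinAt_id t (Ici 0)).const_add s) hmaps
    rw [one_smul] at h1
    exact h1

theorem exists_hasDerivWithinAt_toDual (s : ℕ) (h : IsSolution L γ δ hk u₀ ⊤ u) :
    ∃ ut : ℝ → HperDual L s, ContinuousOn ut (Ici 0) ∧ ∀ t, 0 ≤ t →
      HasDerivWithinAt (fun r => L2Q.toDual s (toL2 (u r))) (ut t) (Ici 0) t := by
  obtain ⟨ut, hut, heq⟩ := h.eqn
  rw [timeInterval_top] at hut heq
  refine ⟨fun t => L2Q.toDualCLM L s (toL2 (ut t)),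
    ((L2Q.toDualCLM L s).comp toL2).continuous.comp_continuousOn hut, fun t ht => ?_⟩
  exact ((L2Q.toDualCLM L s).restrictScalars ℝ).hasFDerivAt.comp_hasDerivWithinAt t
    (hasDerivWithinAt_toL2 (heq t ht).1)

theorem isMaximalSolution_of_top (h : IsSolution L γ δ hk u₀ ⊤ u) :
    IsMaximalSolution L γ δ hk u₀ ⊤ u := ⟨h, fun _ _ _ _ => le_top⟩

end

variable [hL : Fact (0 < L)]

namespace StrongSol

variable {u : ℝ → Hper L 2}

/-- With `y = ‖u‖²` and `z = e^{-2γt}y`, the bound `‖u‖⁴ ≤ 2L∫|u|⁴` gives `(-1/z)' ≥ (δ/L)e^{2γt}`,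
which limits the lifetime. Here `G(t) = ∫₀ᵗ e^{2γs} ds` in terms of its defining properties. -/
theorem mul_norm_sq_lt_one (hδ : 0 < δ) (hu : StrongSol γ δ τ u) (h0 : 0 < ‖toL2 (u 0)‖ ^ 2)
    (hτ : 0 ≤ τ) {G : ℝ → ℝ} (hG : ∀ t, HasDerivAt G (Real.exp (2 * γ * t)) t) (hG0 : G 0 = 0) :
    δ / L * G τ * ‖toL2 (u 0)‖ ^ 2 < 1 := by
  have hL0 := hL.out
  set y : ℝ → ℝ := fun t => ‖toL2 (u t)‖ ^ 2 with hy
  set z : ℝ → ℝ := fun t => Real.exp (-2 * γ * t) * y t with hz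
  have hE : ∀ t : ℝ, Real.exp (-2 * γ * t) * Real.exp (2 * γ * t) = 1 := fun t => by
    rw [← Real.exp_add]
    simp
  have hexp : ∀ t, HasDerivAt (fun t => Real.exp (-2 * γ * t))
      (Real.exp (-2 * γ * t) * (-2 * γ)) t := fun t => by
    simpa using ((hasDerivAt_id t).const_mul (-2 * γ)).exp
  have hz' : ∀ t ∈ Icc 0 τ, HasDerivWithinAt z
      (2 * δ * (Real.exp (-2 * γ * t) * quart (u t))) (Icc 0 τ) t := fun t ht => by
    convert! (hexp t).hasDerivWithinAt.mul (hu.hasDerivWithinAt_norm_sq ht) using 1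
    ring
  have hmono : ∀ t ∈ Icc 0 τ, y 0 ≤ z t := fun t ht => by
    have h := le_gronwallBound_of_hasDerivWithinAt (f := fun t => -z t) (d := -y 0) (K := 0)
      (ε := 0) (fun t ht => (hz' t ht).neg) (by simp [hz]) (fun t _ => by
        have := quart_nonneg (u t)
        rw [zero_mul, add_zero, neg_nonpos]
        positivity) t ht
    rw [gronwallBound_ε0, zero_mul, Real.exp_zero, mul_one] at h
    linarith
  have hpos : ∀ t ∈ Icc 0 τ, 0 < z t := fun t ht => h0.trans_le (hmono t ht)
  have h := le_gronwallBound_of_hasDerivWithinAt (f := fun t => (z t)⁻¹ + δ / L * G t)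
    (d := (y 0)⁻¹) (K := 0) (ε := 0)
    (fun t ht => ((hz' t ht).inv (hpos t ht).ne').add
      ((hG t).hasDerivWithinAt.const_mul (δ / L))) (by simp [hz, hG0]) (fun t ht => by
        rw [zero_mul, add_zero, neg_div, neg_add_nonpos_iff,
          le_div_iff₀ (pow_pos (hpos t ht) 2)]
        have hq := norm_pow_four_le_quart (u t)
        have e : Real.exp (2 * γ * t) * z t ^ 2 = Real.exp (-2 * γ * t) * y t ^ 2 := by
          simp only [hz]
          linear_combination Real.exp (-2 * γ * t) * y t ^ 2 * hE t
        rw [mul_assoc, e, div_mul_eq_mul_div, div_le_iff₀ hL0]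
        have := mul_le_mul_of_nonneg_left hq (mul_pos hδ (Real.exp_pos (-2 * γ * t))).le
        simp only [hy]
        linarith) τ ⟨hτ, le_rfl⟩
  rw [gronwallBound_ε0, zero_mul, Real.exp_zero, mul_one] at h
  have h3 : δ / L * G τ < (y 0)⁻¹ := by linarith [inv_pos.2 (hpos τ ⟨hτ, le_rfl⟩)]
  calc δ / L * G τ * ‖toL2 (u 0)‖ ^ 2 < (y 0)⁻¹ * ‖toL2 (u 0)‖ ^ 2 := by gcongr
    _ = 1 := inv_mul_cancel₀ h0.ne'

/-- Linear growth against nonlinear damping keeps the `L²`-norm bounded: the mass law gives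
`y' ≤ 2γy + (δ/L)y² ≤ -2γy + 4γ²L/(-δ)` for `y = ‖u‖²`. -/
theorem norm_toL2_sq_le_add (hγ : 0 < γ) (hδ : δ < 0) (hu : StrongSol γ δ τ u) {t : ℝ}
    (ht : t ∈ Icc 0 τ) : ‖toL2 (u t)‖ ^ 2 ≤ ‖toL2 (u 0)‖ ^ 2 + 2 * γ * L / (-δ) := by
  have hL0 := hL.out
  have hδ' : 0 < -δ := by linarith
  have h := le_gronwallBound_of_hasDerivWithinAt (K := -(2 * γ)) (ε := 4 * γ ^ 2 * L / (-δ))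
    (fun r hr => hu.hasDerivWithinAt_norm_sq hr) le_rfl (fun r _ => by
      have hq := norm_pow_four_le_quart (u r)
      set y := ‖toL2 (u r)‖ ^ 2
      rw [← sub_le_iff_le_add', le_div_iff₀ hδ']
      -- `4γy - (-δ/L)y² ≤ 4γ²L/(-δ)` by completing the square
      have h1 : δ * δ * y ^ 2 ≤ δ * δ * (2 * L * quart (u r)) :=
        mul_le_mul_of_nonneg_left hq (mul_self_nonneg δ)
      refine le_of_mul_le_mul_left ?_ hL0
      nlinarith [sq_nonneg (2 * γ * L + δ * y)]) t ht
  refine h.trans ?_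
  rw [gronwallBound_of_K_ne_0 (by linarith)]
  have he : Real.exp (-(2 * γ) * t) ≤ 1 := Real.exp_le_one_iff.2 (by nlinarith [ht.1])
  have e : 4 * γ ^ 2 * L / -δ / -(2 * γ) * (Real.exp (-(2 * γ) * t) - 1)
      = 2 * γ * L / (-δ) * (1 - Real.exp (-(2 * γ) * t)) := by
    field_simp
    ring
  simp only [e]
  have h1 : 0 ≤ 2 * γ * L / (-δ) := by positivity
  have h2 := Real.exp_pos (-(2 * γ) * t)
  exact add_le_add (mul_le_of_le_one_right (sq_nonneg _) he)
    (mul_le_of_le_one_right h1 (by linarith))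

end StrongSol

variable {u₀ : Hper L k} {u : ℝ → Hper L k} {T : EReal} {hk : 2 ≤ k}

/-- `That` is the time at which the bound of `StrongSol.mul_norm_sq_lt_one` would reach `1`. -/
theorem le_That (h : IsSolution L γ δ hk u₀ T u) (hδ : 0 < δ) (hM : 0 < massM L γ u 0)
    (hγ0 : γ ≠ 0) (hγ : -δ * massM L γ u 0 < γ) : T ≤ (That γ δ (massM L γ u 0) : EReal) := by
  have hL0 := hL.out
  set M := massM L γ u 0 with hMdef
  have hδM : 0 < δ * M := by positivity
  have hpos : 0 < 1 + γ / (δ * M) := by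
    have : -1 < γ / (δ * M) := (lt_div_iff₀ hδM).2 (by linarith)
    linarith
  by_contra! hlt
  have e0 : ‖toL2 (u 0)‖ ^ 2 = 2 * L * M := by
    rw [hMdef, massM_eq]
    simp
    field_simp
  have hT0 : 0 ≤ That γ δ M := by
    rw [That]
    rcases lt_or_gt_of_ne hγ0 with hneg | hpos'
    · refine mul_nonneg_of_nonpos_of_nonpos (one_div_nonpos.2 (by linarith))
        (Real.log_nonpos hpos.le ?_)
      have := div_neg_of_neg_of_pos hneg hδM
      linarith
    · refine mul_nonneg (by positivity) (Real.log_nonneg ?_)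
      have := div_pos hpos' hδM
      linarith
  have key := (strongSol_of_isSolution h hlt).mul_norm_sq_lt_one hδ
    (by rw [toL2_incl, e0]; positivity) hT0
    (G := fun t => (Real.exp (2 * γ * t) - 1) / (2 * γ)) (fun t => by
      have := ((((hasDerivAt_id t).const_mul (2 * γ)).exp).sub_const 1).div_const (2 * γ)
      convert! this using 1
      simp
      field_simp) (by simp)
  have e1 : 2 * γ * That γ δ M = Real.log (1 + γ / (δ * M)) := by
    rw [That]
    field_simp
  rw [toL2_incl, e0, e1, Real.exp_log hpos] at key
  have e2 : δ / L * ((1 + γ / (δ * M) - 1) / (2 * γ)) * (2 * L * M) = 1 := by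
    field_simp
    ring
  exact absurd e2 key.ne

theorem le_Ttilde (h : IsSolution L 0 δ hk u₀ T u) (hδ : 0 < δ) (hM : 0 < massM L 0 u 0) :
    T ≤ (Ttilde δ (massM L 0 u 0) : EReal) := by
  have hL0 := hL.out
  set M := massM L 0 u 0 with hMdef
  by_contra! hlt
  have e0 : ‖toL2 (u 0)‖ ^ 2 = 2 * L * M := by
    rw [hMdef, massM_eq]
    simp
    field_simp
  have key := (strongSol_of_isSolution h hlt).mul_norm_sq_lt_one hδ
    (by rw [toL2_incl, e0]; positivity) (by rw [Ttilde]; positivity)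
    (G := fun t => t) (fun t => by simpa using hasDerivAt_id' t) rfl
  rw [toL2_incl, e0] at key
  have e2 : δ / L * Ttilde δ M * (2 * L * M) = 1 := by
    rw [Ttilde]
    field_simp
  exact absurd e2 key.ne

theorem tendsto_norm_toL2 (h : IsSolution L γ δ hk u₀ ⊤ u) (hγ : γ < 0) (hδ : δ < 0) :
    Tendsto (fun t => ‖toL2 (u t)‖) atTop (𝓝 0) := by
  have hlim : Tendsto (fun t => ‖toL2 (u 0)‖ ^ 2 * Real.exp (2 * γ * t)) atTop (𝓝 0) := by
    have hγ2 : 2 * γ < 0 := by linarith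
    have h := (Real.tendsto_exp_atBot.comp (tendsto_id.const_mul_atTop_of_neg hγ2)).const_mul
      (‖toL2 (u 0)‖ ^ 2)
    rwa [mul_zero] at h
  have hsq : Tendsto (fun t => ‖toL2 (u t)‖ ^ 2) atTop (𝓝 0) :=
    squeeze_zero' (Eventually.of_forall fun t => sq_nonneg _)
      ((eventually_ge_atTop 0).mono fun t ht =>
        (strongSol_of_isSolution h (EReal.coe_lt_top t)).norm_toL2_sq_le hδ.le ⟨ht, le_rfl⟩) hlim
  simpa using hsq.sqrt

/-- The value at time `t` of the global solution with initial value `u₀`, for `δ ≤ 0`. -/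
def flow (hk : 2 ≤ k) (γ : ℝ) (hδ : δ ≤ 0) (t : ℝ) (u₀ : Hper L k) : Hper L k :=
  (exists_isSolution_top hk γ hδ u₀).choose t

theorem isSolution_flow (hk : 2 ≤ k) (γ : ℝ) (hδ : δ ≤ 0) (u₀ : Hper L k) :
    IsSolution L γ δ hk u₀ ⊤ (fun t => flow hk γ hδ t u₀) :=
  (exists_isSolution_top hk γ hδ u₀).choose_spec

theorem flow_eq (hδ : δ ≤ 0) (h : IsSolution L γ δ hk u₀ ⊤ u) {t : ℝ} (ht : 0 ≤ t) :
    flow hk γ hδ t u₀ = u t :=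
  isSolution_unique (isSolution_flow hk γ hδ u₀) h (by rwa [timeInterval_top])
    (by rwa [timeInterval_top])

theorem flow_add (hδ : δ ≤ 0) {s t : ℝ} (hs : 0 ≤ s) (ht : 0 ≤ t) (u₀ : Hper L k) :
    flow hk γ hδ (s + t) u₀ = flow hk γ hδ t (flow hk γ hδ s u₀) :=
  (flow_eq hδ (isSolution_shift (isSolution_flow hk γ hδ u₀) hs) ht).symm

/-- The a priori bound is uniform over a ball around the initial value, where the difference
estimate then applies with one constant. -/
theorem continuous_toL2_flow (hδ : δ ≤ 0) {t : ℝ} (ht : 0 ≤ t) :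
    Continuous fun u₀ : Hper L k => toL2 (flow hk γ hδ t u₀) := by
  have hk1 : 1 ≤ k := one_le_two.trans hk
  refine continuous_iff_continuousAt.2 fun u₀ => ?_
  obtain ⟨W, hW⟩ := StrongSol.exists_wiener_bound L γ hδ ((‖u₀‖ + 1) ^ 2) t
  have hsol := fun v : Hper L k =>
    strongSol_of_isSolution (isSolution_flow hk γ hδ v) (EReal.coe_lt_top t)
  have hw : ∀ v : Hper L k, ‖v‖ ≤ ‖u₀‖ + 1 → ∀ r ∈ Icc 0 t,
      wiener (incl hk (flow hk γ hδ r v)) ≤ W := fun v hv => by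
    have h0 : flow hk γ hδ 0 v = v := (isSolution_flow hk γ hδ v).init
    refine hW t le_rfl _ (hsol v) ?_ ?_
    · simp only [h0]
      have := norm_toL2_le v
      rw [toL2_incl hk v]
      gcongr
      linarith
    · simp only [h0]
      have := norm_dx_le 1 hk1 v
      rw [dx_incl hk v]
      gcongr
      linarith
  set C := Real.exp (2 * (|γ| + (|δ| + 1) * (3 * (expoNorm L * W) ^ 2)) * t)
  have hsq : Tendsto (fun v : Hper L k =>
      ‖toL2 (flow hk γ hδ t v) - toL2 (flow hk γ hδ t u₀)‖ ^ 2) (𝓝 u₀) (𝓝 0) := by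
    have hlim : Tendsto (fun v : Hper L k => ‖toL2 v - toL2 u₀‖ ^ 2 * C) (𝓝 u₀) (𝓝 0) := by
      have h : Continuous fun v : Hper L k => ‖toL2 v - toL2 u₀‖ ^ 2 * C := by fun_prop
      simpa using h.tendsto u₀
    refine squeeze_zero' (Eventually.of_forall fun v => sq_nonneg _) ?_ hlim
    filter_upwards [continuous_norm.continuousAt.eventually_le_const (lt_add_one ‖u₀‖)] with v hv
    have h := (hsol v).norm_toL2_sub_le (hsol u₀) (hw v hv) (hw u₀ (lt_add_one _).le)
      (t := t) ⟨ht, le_rfl⟩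
    have h0 : ∀ v : Hper L k, flow hk γ hδ 0 v = v := fun v => (isSolution_flow hk γ hδ v).init
    simpa only [toL2_incl, h0] using h
  rw [ContinuousAt, tendsto_iff_norm_sub_tendsto_zero]
  simpa using hsq.sqrt

theorem norm_toL2_flow_sq_le (hγ : 0 < γ) (hδ : δ < 0) {t : ℝ} (ht : 0 ≤ t) (u₀ : Hper L k) :
    ‖toL2 (flow hk γ hδ.le t u₀)‖ ^ 2 ≤ ‖u₀‖ ^ 2 + 2 * γ * L / (-δ) := by
  have hs := strongSol_of_isSolution (isSolution_flow hk γ hδ.le u₀) (EReal.coe_lt_top t)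
  have h := hs.norm_toL2_sq_le_add hγ hδ (t := t) ⟨ht, le_rfl⟩
  have h0 : flow hk γ hδ.le 0 u₀ = u₀ := (isSolution_flow hk γ hδ.le u₀).init
  simp only [toL2_incl, h0] at h
  refine h.trans ?_
  have := norm_toL2_le u₀
  gcongr

end Hper

end

theorem theorem2p2 (L : ℝ) (hL : 0 < L) (k : ℕ) (hk : 2 ≤ k) :
    -- collapse in finite time
    (∀ (γ δ : ℝ) (u₀ : Hper L k) (Tmax : EReal) (u : ℝ → Hper L k),
      IsMaximalSolution L γ δ hk u₀ Tmax u → 0 < δ → 0 < massM L γ u 0 →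
        (γ ≠ 0 → -δ * massM L γ u 0 < γ → Tmax ≤ (That γ δ (massM L γ u 0) : EReal)) ∧
        (γ = 0 → Tmax ≤ (Ttilde δ (massM L γ u 0) : EReal))) ∧
    -- global existence and limit set
    (∀ γ δ : ℝ, 0 < γ → δ < 0 →
      ∃ φ : ℝ → Hper L k → L2Q L,
        -- the maximal solution exists for all times, and `φ(t, u₀)` is its value at time `t`
        (∀ u₀ : Hper L k,
          (∃ u, IsMaximalSolution L γ δ hk u₀ ⊤ u) ∧
          ∀ Tmax u, IsMaximalSolution L γ δ hk u₀ Tmax u →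
            Tmax = ⊤ ∧ ∀ t, 0 ≤ t → φ t u₀ = Hper.toL2 (u t)) ∧
        -- `u ∈ C([0,∞), L²)`, `u_t ∈ C([0,∞), H^{-1}_per)`
        (∀ u₀ : Hper L k,
          ContinuousOn (fun t => φ t u₀) (Ici 0) ∧
          ∃ ut : ℝ → HperDual L 1, ContinuousOn ut (Ici 0) ∧
            ∀ t, 0 ≤ t →
              HasDerivWithinAt (fun s => L2Q.toDual 1 (φ s u₀)) (ut t) (Ici 0) t) ∧
        -- `φ` is a dynamical system
        (∀ u₀ : Hper L k, φ 0 u₀ = Hper.toL2 u₀) ∧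
        (∀ (s t : ℝ) (u₀ v₀ : Hper L k), 0 ≤ s → 0 ≤ t →
          φ s u₀ = Hper.toL2 v₀ → φ (s + t) u₀ = φ t v₀) ∧
        (∀ t : ℝ, 0 ≤ t → Continuous (φ t)) ∧
        -- with bounded orbits
        (∀ u₀ : Hper L k, ∃ C : ℝ, ∀ t, 0 ≤ t → ‖φ t u₀‖ ≤ C) ∧
        -- and compact limit sets
        (∀ B : Set (Hper L k), Bornology.IsBounded B →
          (B.Nonempty → (weakOmegaLimit φ B).Nonempty) ∧
          IsCompact (weakOmegaLimit φ B) ∧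
          IsCompact (L2Q.toDual 1 '' {v | toWeakSpace ℂ (L2Q L) v ∈ weakOmegaLimit φ B}))) ∧
    -- full decay
    (∀ (γ δ : ℝ) (u₀ : Hper L k) (Tmax : EReal) (u : ℝ → Hper L k),
      IsMaximalSolution L γ δ hk u₀ Tmax u → γ < 0 → δ < 0 →
        Tmax = ⊤ ∧ Tendsto (fun t => ‖Hper.toL2 (u t)‖) atTop (𝓝 0)) ∧
    -- behaviour of the collapse time bound
    (∀ δ M₀ : ℝ, 0 < δ → 0 < M₀ →
      Tendsto (fun γ => That γ δ M₀) (𝓝[>] (-δ * M₀)) atTop ∧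
      Tendsto (fun γ => That γ δ M₀) (𝓝[≠] 0) (𝓝 (Ttilde δ M₀))) := by
  have : Fact (0 < L) := ⟨hL⟩
  refine ⟨fun γ δ u₀ Tmax u h hδ hM => ⟨fun hγ0 hγ => Hper.le_That h.1 hδ hM hγ0 hγ, ?_⟩,
    fun γ δ hγ hδ => ?_, fun γ δ u₀ Tmax u h hγ hδ => ?_,
    fun δ m hδ hm => ⟨tendsto_That_atTop hδ hm, tendsto_That_Ttilde δ m⟩⟩
  · rintro rfl
    exact Hper.le_Ttilde h.1 hδ hM
  · have hsol := Hper.isSolution_flow (L := L) hk γ hδ.le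
    have hbound : ∀ (R : ℝ) (t : ℝ), 0 ≤ t → ∀ u₀ : Hper L k, ‖u₀‖ ≤ R →
        ‖Hper.toL2 (Hper.flow hk γ hδ.le t u₀)‖ ≤ √(R ^ 2 + 2 * γ * L / (-δ)) :=
      fun R t ht u₀ hu => by
        refine Real.le_sqrt_of_sq_le ((Hper.norm_toL2_flow_sq_le hγ hδ ht u₀).trans ?_)
        gcongr
    refine ⟨fun t u₀ => Hper.toL2 (Hper.flow hk γ hδ.le t u₀),
      fun u₀ => ⟨⟨_, Hper.isMaximalSolution_of_top (hsol u₀)⟩, fun Tmax u h => ?_⟩,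
      fun u₀ => ⟨?_, Hper.exists_hasDerivWithinAt_toDual 1 (hsol u₀)⟩,
      fun u₀ => congrArg Hper.toL2 (hsol u₀).init, fun s t u₀ v₀ hs ht h => ?_,
      fun t ht => Hper.continuous_toL2_flow hδ.le ht,
      fun u₀ => ⟨_, fun t ht => hbound ‖u₀‖ t ht u₀ le_rfl⟩, fun B hB => ?_⟩
    · obtain rfl := Hper.eq_top_of_isMaximalSolution hδ.le h
      exact ⟨rfl, fun t ht => congrArg Hper.toL2 (Hper.flow_eq hδ.le h.1 ht)⟩
    · have hc := (hsol u₀).cont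
      rw [Hper.timeInterval_top] at hc
      exact Hper.toL2.continuous.comp_continuousOn hc
    · have h' : Hper.flow hk γ hδ.le s u₀ = v₀ := Hper.toL2_injective h
      change Hper.toL2 _ = Hper.toL2 _
      rw [Hper.flow_add hδ.le hs ht, h']
    · obtain ⟨R, hR⟩ := hB.exists_norm_le
      exact weakOmegaLimit_of_norm_le fun t ht u hu => hbound R t ht u (hR u hu)
  · obtain rfl := Hper.eq_top_of_isMaximalSolution hδ.le h
    exact ⟨rfl, Hper.tendsto_norm_toL2 h.1 hγ hδ⟩
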